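/- Let $N\ge 3$ and let $\zeta\in\mathbb C$ satisfy $\zeta^N=-1$. For moduli $v=1-u_0$ and $u=(u_1,\dots,u_{N-2})\in\mathbb C^{N-2}$ let $A(x)=x^N-\sum_{n=0}^{N-2}u_nx^n$, and consider the curve $y^2=A(x)^2-1$ with the differential $\lambda=xA'(x)\,dx/y$. Powers of $v$ and of $2-v$ are principal. *The function $R$.* Let $x_\zeta$ be the root of $A(x)=-1$ with $|x_\zeta-v^{1/N}\zeta|<|v|^{1/N}/N$ (the small branch point labelled by $\zeta$), and put $i\pi R(\zeta)=\int\lambda$, the integral being along the straight segment from $x=0$ to $x=x_\zeta$, with $y$ continued along it from the value $y=-i\sqrt v\,\sqrt{2-v}$ at $x=0$ (a square root of $v(v-2)=A(0)^2-1$). *The function $Q$.* For $\ell=(\ell_1,\dots,\ell_{N-2})\in\mathbb Z_{\ge0}^{N-2}$ put $L=1+\sum_j j\ell_j$, $M=\sum_j\ell_j$, $\alpha=\frac{NM-L}{2N}$. With $F={}_2F_1$ let $$Q(\xi)=\sum_{\ell}\frac{2^{M-L/N}}{2\pi^2N}\,\xi^{NM+L+N}\,\Gamma\!\left(\tfrac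 LN\right)Y(\xi^N,\alpha;u_0)\,\frac{u_1^{\ell_1}\cdots u_{N-2}^{\ell_{N-2}}}{\ell_1!\cdots\ell_{N-2}!},$$ $$Y(s,\alpha;u_0)=2u_0\,s\cos^2(\pi\alpha)\,\Gamma(\alpha+\tfrac12)^2F(\alpha+\tfrac12,\alpha+\tfrac12;\tfrac32;u_0^2)+\sin^2(\pi\alpha)\,\Gamma(\alpha)^2F(\alpha,\alpha;\tfrac12;u_0^2)$$ be the expansion about the $\mathbb Z_{2N}$-symmetric point $u_0=u_1=\dots=u_{N-2}=0$. **(i)** *$R(\zeta)$ is the analytic continuation in $v=1-u_0$ of $Q(\zeta)$.* Precisely: for all $\rho\in(1,2)$ and $r\in(0,1)$ there is $\delta>0$ such that for every $u$ with $|u_n|<\delta$ for all $n$, with $$U=\{v:|v-1|<r\},\qquad V=\{v\in\mathbb C\setminus(-\infty,0]:\ |v|<\rho,\ |u_n|<\delta|v|^{1-n/N}\text{ for }1\le n\le N-2\},$$ the series $Q(\zeta)$ converges absolutely for $v\in U$; for $v\in V$ the integral $R(\zeta)$ is well defined (there is exactly one root $x_\zeta$ as above, the segment meets no branch point before its end,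 and $\lambda$ is integrable along it); $U$, $V$ and $U\cap V$ are open and connected (in particular non-empty); $Q(\zeta)$ is holomorphic in $v\in U$; $R(\zeta)$ is holomorphic in $v\in V$; and $Q(\zeta)=R(\zeta)$ for $v\in U\cap V$. **(ii)** Let $\alpha\in\mathbb R$ be such that $4\alpha$ is not an odd integer, and let $$f_1=\frac{2(2v)^{\frac12-2\alpha}}{1-4\alpha}F(\tfrac12,\tfrac12;\tfrac32-2\alpha;\tfrac v2),\quad f_2=F(2\alpha,2\alpha;2\alpha+\tfrac12;\tfrac v2),$$ $$f_3=-2(1-v)F(\alpha+\tfrac12,\alpha+\tfrac12;\tfrac32;(1-v)^2),\quad f_4=F(\alpha,\alpha;\tfrac12;(1-v)^2).$$ Then for $|1-v|<1$ one has $\binom{f_1}{f_2}=\mathcal S\binom{f_3}{f_4}$, where $$\mathcal S=\sqrt\pi\begin{pmatrix}\dfrac{\Gamma(\frac12-2\alpha)}{\Gamma(\frac12-\alpha)^2}&\dfrac{\Gamma(\frac12-2\alpha)}{\Gamma(1-\alpha)^2}\\[2ex]\dfrac{\Gamma(\frac12+2\alpha)}{\Gamma(\alpha)^2}&\dfrac{\Gamma(\frac12+2\alpha)}{\Gamma(\frac12+\alpha)^2}\end{pmatrix}$$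 (with $1/\Gamma=0$ at the poles of $\Gamma$), and $\mathcal S\in SL(2,\mathbb R)$. -/

import Mathlib

namespace SeibergWitten

/-! ### The curve, the differential and its integrals

The moduli are `u₀` and `u₁, …, u_{N-2}`; the latter form a vector `u : Fin (N - 2) → ℂ` whose
entry of index `i` is `u_{i+1}`. The strong-coupling scale is `Λ = 1`. -/

/-- `A(x) = x ^ N - ∑_{n=0}^{N-2} u_n x ^ n`; the curve is `y ^ 2 = A(x) ^ 2 - 1`. -/
noncomputable def curvePoly (N : ℕ) (u₀ : ℂ) (u : Fin (N - 2) → ℂ) : Polynomial ℂ :=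
  Polynomial.X ^ N - Polynomial.C u₀ -
    ∑ i : Fin (N - 2), Polynomial.C (u i) * Polynomial.X ^ (i.val + 1)

/-- `y` is a continuous lift to the curve `y ^ 2 = A(x) ^ 2 - 1` of the straight path
`t ↦ t * b`, `0 ≤ t ≤ 1`, starting at the point `(0, y₀)` and meeting no branch point
before its end. -/
structure IsLift (A : Polynomial ℂ) (b y₀ : ℂ) (y : ℝ → ℂ) : Prop where
  continuousOn : ContinuousOn y (Set.Icc 0 1)
  start : y 0 = y₀
  on_curve : ∀ t ∈ Set.Icc (0 : ℝ) 1, y t ^ 2 = A.eval ((t : ℂ) * b) ^ 2 - 1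
  ne_zero : ∀ t ∈ Set.Ico (0 : ℝ) 1, y t ≠ 0

/-- The lift is unique. -/
theorem IsLift.eqOn {A : Polynomial ℂ} {b y₀ : ℂ} {y y' : ℝ → ℂ}
    (h : IsLift A b y₀ y) (h' : IsLift A b y₀ y') : Set.EqOn y y' (Set.Ico 0 1) := by
  have hs : Set.Ico (0 : ℝ) 1 ⊆ Set.Icc 0 1 := Set.Ico_subset_Icc_self
  refine isPreconnected_Ico.eq_of_sq_eq (h.continuousOn.mono hs) (h'.continuousOn.mono hs)
    ?_ (fun {t} ht => h'.ne_zero t ht) (y := 0) (by simp) (by rw [h.start, h'.start])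
  intro t ht
  simp only [Pi.pow_apply]
  rw [h.on_curve t (hs ht), h'.on_curve t (hs ht)]

/-- The pull-back of the differential `λ = x A'(x) dx / y` to the lifted path. -/
noncomputable def pullbackDifferential (A : Polynomial ℂ) (b : ℂ) (y : ℝ → ℂ) (t : ℝ) : ℂ :=
  ((t : ℂ) * b) * A.derivative.eval ((t : ℂ) * b) / y t * b

/-- The integral of `λ` from the point `(0, y₀)` to the branch point `(b, 0)`, along the straight
path, with `y` continued along the path from the starting value `y₀`. -/
noncomputable def abelianIntegral (A : Polynomial ℂ) (b y₀ : ℂ) : ℂ :=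
  ∫ t in (0 : ℝ)..1, pullbackDifferential A b (Classical.epsilon (IsLift A b y₀)) t

/-! ### The function `R(ζ)` -/

/-- `x` is the small branch point labelled by `ζ` (where `ζ ^ N = -1`) of the curve with moduli
`u₀ = 1 - v` and `u`: in the rescaled coordinate `z = x / v ^ (1 / N)`, it is the root of
`A = -1` that lies in the disc of radius `1 / N` about `ζ`. -/
def IsSmallBranchPoint (N : ℕ) (ζ v : ℂ) (u : Fin (N - 2) → ℂ) (x : ℂ) : Prop :=
  (curvePoly N (1 - v) u).eval x = -1 ∧
    ‖x - v ^ (1 / (N : ℂ)) * ζ‖ < ‖v ^ (1 / (N : ℂ))‖ * (1 / (N : ℝ))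

/-- The small branch point labelled by `ζ`. -/
noncomputable def smallBranchPoint (N : ℕ) (ζ v : ℂ) (u : Fin (N - 2) → ℂ) : ℂ :=
  Classical.epsilon (IsSmallBranchPoint N ζ v u)

/-- The ordinate `y₀ = -i √v √(2 - v)` of one of the two points of the curve over `x = 0`, so that
`y₀ ^ 2 = v (v - 2)`; at `v = 1` it is `-i`. -/
noncomputable def basePoint (v : ℂ) : ℂ :=
  -Complex.I * v ^ (1 / 2 : ℂ) * (2 - v) ^ (1 / 2 : ℂ)

/-- `i π R(ζ) = ∫_0^ζ λ`, as a function of the moduli `v = 1 - u₀` and `u`. -/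
noncomputable def R (N : ℕ) (ζ v : ℂ) (u : Fin (N - 2) → ℂ) : ℂ :=
  abelianIntegral (curvePoly N (1 - v) u) (smallBranchPoint N ζ v u) (basePoint v) /
    (Complex.I * Real.pi)

/-- The integral that defines `R(ζ)` makes sense: there is exactly one small branch point labelled
by `ζ`, the curve continues along the straight path to it, and `λ` is integrable there. -/
def RWellDefined (N : ℕ) (ζ v : ℂ) (u : Fin (N - 2) → ℂ) : Prop :=
  (∃! x, IsSmallBranchPoint N ζ v u x) ∧
    ∃ y, IsLift (curvePoly N (1 - v) u) (smallBranchPoint N ζ v u) (basePoint v) y ∧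
      IntervalIntegrable
        (pullbackDifferential (curvePoly N (1 - v) u) (smallBranchPoint N ζ v u) y)
        MeasureTheory.volume 0 1

/-! ### The expansion of `Q(ξ)` around the `ℤ_{2N}` symmetric point -/

/-- `L = 1 + ∑ j ℓ_j`. -/
def sumL {N : ℕ} (l : Fin (N - 2) → ℕ) : ℕ := 1 + ∑ i, (i.val + 1) * l i

/-- `M = ∑ ℓ_j`. -/
def sumM {N : ℕ} (l : Fin (N - 2) → ℕ) : ℕ := ∑ i, l i

/-- `α = (N M - L) / (2 N)`. -/
noncomputable def alpha {N : ℕ} (l : Fin (N - 2) → ℕ) : ℝ :=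
  ((N : ℝ) * sumM l - sumL l) / (2 * N)

/-- The function `Y(s, α; u₀)`, where `s = ξ ^ N`. -/
noncomputable def Y (s : ℂ) (α : ℝ) (u₀ : ℂ) : ℂ :=
  2 * u₀ * s * ((Real.cos (Real.pi * α) ^ 2 * Real.Gamma (α + 1 / 2) ^ 2 : ℝ) : ℂ) *
      ₂F₁ ((α : ℂ) + 1 / 2) ((α : ℂ) + 1 / 2) (3 / 2 : ℂ) (u₀ ^ 2) +
    ((Real.sin (Real.pi * α) ^ 2 * Real.Gamma α ^ 2 : ℝ) : ℂ) *
      ₂F₁ (α : ℂ) (α : ℂ) (1 / 2 : ℂ) (u₀ ^ 2)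

/-- The term of multi-index `l` of the expansion of `Q(ξ)`; note `M - L / N = 2 α`. -/
noncomputable def QTerm (N : ℕ) (ξ u₀ : ℂ) (u : Fin (N - 2) → ℂ) (l : Fin (N - 2) → ℕ) : ℂ :=
  (((2 : ℝ) ^ ((sumM l : ℝ) - (sumL l : ℝ) / N) / (2 * Real.pi ^ 2 * N) : ℝ) : ℂ) *
    ξ ^ (N * sumM l + sumL l + N) * (Real.Gamma ((sumL l : ℝ) / N) : ℂ) *
    Y (ξ ^ N) (alpha l) u₀ * ∏ i, u i ^ l i / (Nat.factorial (l i) : ℂ)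

/-- The sum of the expansion of `Q(ξ)`. -/
noncomputable def Q (N : ℕ) (ξ u₀ : ℂ) (u : Fin (N - 2) → ℂ) : ℂ := ∑' l, QTerm N ξ u₀ u l

/-! ### Analytic continuation -/

/-- `g` on the domain `V` is the (direct) analytic continuation of `f` on the domain `U`. -/
structure IsAnalyticContinuation (f : ℂ → ℂ) (U : Set ℂ) (g : ℂ → ℂ) (V : Set ℂ) : Prop where
  isOpen_left : IsOpen U
  isConnected_left : IsConnected U
  isOpen_right : IsOpen V
  isConnected_right : IsConnected V
  isConnected_inter : IsConnected (U ∩ V)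
  analytic_left : AnalyticOnNhd ℂ f U
  analytic_right : AnalyticOnNhd ℂ g V
  eqOn : Set.EqOn f g (U ∩ V)

/-- For fixed `u`, the values `v` of the cut disc `|v| < ρ` at which the rescaled moduli
`v_n = v ^ (n / N - 1) u_n` satisfy `|v_n| < δ`. -/
def scalingDomain (N : ℕ) (ρ δ : ℝ) (u : Fin (N - 2) → ℂ) : Set ℂ :=
  {v | v ∈ Complex.slitPlane ∧ ‖v‖ < ρ ∧
    ∀ i : Fin (N - 2), ‖u i‖ < δ * ‖v‖ ^ (1 - ((i.val : ℝ) + 1) / N)}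

/-! ### The two bases of hypergeometric functions and their connection matrix -/

/-- `f₁(α, v)`. -/
noncomputable def f₁ (α : ℝ) (v : ℂ) : ℂ :=
  2 * (2 * v) ^ (1 / 2 - 2 * (α : ℂ)) / (1 - 4 * α) *
    ₂F₁ (1 / 2 : ℂ) (1 / 2 : ℂ) (3 / 2 - 2 * (α : ℂ)) (v / 2)

/-- `f₂(α, v)`. -/
noncomputable def f₂ (α : ℝ) (v : ℂ) : ℂ :=
  ₂F₁ (2 * (α : ℂ)) (2 * (α : ℂ)) (2 * (α : ℂ) + 1 / 2) (v / 2)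

/-- `f₃(α, v)`. -/
noncomputable def f₃ (α : ℝ) (v : ℂ) : ℂ :=
  -2 * (1 - v) * ₂F₁ ((α : ℂ) + 1 / 2) ((α : ℂ) + 1 / 2) (3 / 2 : ℂ) ((1 - v) ^ 2)

/-- `f₄(α, v)`. -/
noncomputable def f₄ (α : ℝ) (v : ℂ) : ℂ :=
  ₂F₁ (α : ℂ) (α : ℂ) (1 / 2 : ℂ) ((1 - v) ^ 2)

/-- The connection matrix `𝒮`, where `1 / Γ` is `0` at the poles of `Γ`. -/
noncomputable def connectionMatrix (α : ℝ) : Matrix (Fin 2) (Fin 2) ℝ :=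
  !![Real.Gamma (1 / 2) * Real.Gamma (1 / 2 - 2 * α) / Real.Gamma (1 / 2 - α) ^ 2,
     Real.Gamma (1 / 2) * Real.Gamma (1 / 2 - 2 * α) / Real.Gamma (1 - α) ^ 2;
     Real.Gamma (1 / 2) * Real.Gamma (1 / 2 + 2 * α) / Real.Gamma α ^ 2,
     Real.Gamma (1 / 2) * Real.Gamma (1 / 2 + 2 * α) / Real.Gamma (1 / 2 + α) ^ 2]

end SeibergWitten

namespace SeibergWitten

open Complex Set

/-! ### Power series on the unit disc -/

/-! Part (ii). Division by the lower Gamma value turns `f₁` and `f₂` into `hSol` and `gSol`, built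
from series regularized by `1/Γ`. Differentiation in `v` sends `hSol α` and `gSol α` to multiples of
the same functions at `α + 1/2` (`hasDerivAt_hSol`, `hasDerivAt_gSol`). Their Taylor coefficients at
`v = 1` are therefore values at `v = 1` with shifted `α`, and these are explicit: `√π / Γ(1 - α)²`
and `√π / Γ(α + 1/2)²` (`hSol_one`, `gSol_one`). The even and odd parts of the Taylor series are
multiples of `f₄` and `f₃`, which gives the connection matrix; its determinant is `1` by the
reflection formula.

Part (i). In the coordinate `x = v^(1/N) z` one has `A = -1 + v p(z)` with `p = 1 + z^N - ∑ a_n z^n`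
and `a_n = v^(n/N - 1) u_n`, hence `A² - 1 = -v p (2 - v p)`. For small `a` a contraction gives one
zero of `p` near `ζ`, holomorphic in `a` (`exists_isRootFun`). Along the segment to it `p` stays
close to `1 - t^N`, so all square roots can be principal. Expanding `(1 - v p / 2)^(-1/2)`
binomially and integrating by parts writes `R(ζ)` as a series in `v` whose terms contain the moments
`∫ p^(k + 1/2)` (`hasSum_R`).

Each moment is expanded in the total degree `M` of `a`. Under the integral sign this can be done
only for exponents `s` with `M < Re s`, where the coefficients are Beta integrals. Both sides are
holomorphic for `0 < Re s`, so the formula persists down to `s = k + 1/2` (`IsRootFun.coeff_eq`).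
For a fixed multi-index `l` the sum over `k` is again a regularized hypergeometric series, a
multiple of `hSol (alpha l) v`, and the expansion at `v = 1` from part (ii) identifies `hSol` with
`Y(-1, α; 1 - v)` (`Y_neg_one_eq`). Thus the inner sums are exactly the terms of `Q(ζ)`
(`hasSum_QTerm`). Cauchy estimates justify the exchange of the sums over `k` and `M`.

The absolute convergence of `Q(ζ)` on the disc about `v = 1` is proved separately: Gamma function
estimates bound the Taylor majorant of `hSol`, and the terms are dominated by a multinomial series
(`QMajorant_le`). The domains are connected because arcs about `0` and radial segments join their
points to `1`. -/

theorem hasSum_of_eq {ι E : Type*} [AddCommMonoid E] [TopologicalSpace E] {f g : ι → E} {a : E}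
    (h : HasSum f a) (e : ∀ k, g k = f k) : HasSum g a := (funext e : g = f) ▸ h

/-- The power series with coefficients `c` converges absolutely on the open unit disc. -/
def ConvergesOnDisc (c : ℕ → ℂ) : Prop :=
  ∀ r : ℝ, 0 ≤ r → r < 1 → Summable fun k => ‖c k‖ * r ^ k

theorem ConvergesOnDisc.summable {c : ℕ → ℂ} (hc : ConvergesOnDisc c) {z : ℂ} (hz : ‖z‖ < 1) :
    Summable fun k => c k * z ^ k := by
  refine Summable.of_norm ?_
  simpa using hc ‖z‖ (norm_nonneg z) hz

theorem ConvergesOnDisc.hasDerivAt {c : ℕ → ℂ} (hc : ConvergesOnDisc c) {z : ℂ} (hz : ‖z‖ < 1) :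
    ∃ d, HasDerivAt (fun w => ∑' k, c k * w ^ k) d z ∧
      HasSum (fun k : ℕ => c k * (k * z ^ (k - 1))) d := by
  obtain ⟨r, hr1, hr2⟩ := exists_between hz
  have hr0 : 0 ≤ r := (norm_nonneg z).trans hr1.le
  have hdiff : ∀ k : ℕ, DifferentiableOn ℂ (fun w : ℂ => c k * w ^ k) (Metric.ball 0 r) :=
    fun k => by fun_prop
  have hbound : ∀ k : ℕ, ∀ w ∈ Metric.ball (0 : ℂ) r, ‖c k * w ^ k‖ ≤ ‖c k‖ * r ^ k := by
    intro k w hw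
    rw [norm_mul, norm_pow]
    have : ‖w‖ ≤ r := by simpa using (mem_ball_zero_iff.1 hw).le
    gcongr
  have hzm : z ∈ Metric.ball (0 : ℂ) r := by simpa using hr1
  have h1 := hasSum_deriv_of_summable_norm (hc r hr0 hr2) hdiff Metric.isOpen_ball hbound hzm
  have h2 := differentiableOn_tsum_of_summable_norm (hc r hr0 hr2) hdiff Metric.isOpen_ball hbound
  refine ⟨_, (h2.differentiableAt (Metric.isOpen_ball.mem_nhds hzm)).hasDerivAt, ?_⟩
  exact hasSum_of_eq h1 fun k => by simp

theorem summable_shift {c : ℕ → ℂ} {z : ℂ} (h : Summable fun k : ℕ => c k * (k * z ^ (k - 1))) :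
    HasSum (fun k : ℕ => c (k + 1) * ((k + 1 : ℕ) * z ^ k))
      (∑' k : ℕ, c k * (k * z ^ (k - 1))) := by
  have := (hasSum_nat_add_iff' 1).2 h.hasSum
  simpa using this

/-! ### The regularized hypergeometric series `∑ (a)_k² z^k / (k! Γ(c + k))` -/

/-- Its coefficients. -/
noncomputable def regCoeff (a c : ℂ) (k : ℕ) : ℂ :=
  (ascPochhammer ℂ k).eval a ^ 2 / (k.factorial * Gamma (c + k))

/-- Its sum. -/
noncomputable def regF (a c z : ℂ) : ℂ := ∑' k, regCoeff a c k * z ^ k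

theorem coeff_eq_regCoeff (a c : ℂ) (k : ℕ) :
    (regularizedGaussHGFunSeries a a c).coeff k = regCoeff a c k := by
  rw [coeff_regularizedGaussHGFunSeries, regCoeff, sq]

theorem convergesOnDisc_regCoeff (a c : ℂ) : ConvergesOnDisc (regCoeff a c) := by
  intro r hr0 hr1
  have h := (regularizedGaussHGFunSeries a a c).summable_norm_mul_pow (r := ⟨r, hr0⟩)
    (lt_of_lt_of_le (by rw [← ENNReal.coe_one]; exact ENNReal.coe_lt_coe.2 hr1) (radius_regularizedGaussHGFunSeries_ge_one a a c))
  refine h.congr fun k => ?_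
  rw [FormalMultilinearSeries.norm_apply_eq_norm_coef, coeff_eq_regCoeff]
  rfl

theorem hasSum_regF (a c : ℂ) {z : ℂ} (hz : ‖z‖ < 1) :
    HasSum (fun k => regCoeff a c k * z ^ k) (regF a c z) :=
  ((convergesOnDisc_regCoeff a c).summable hz).hasSum

theorem ordinaryHypergeometric_eq (a : ℂ) {c : ℂ} (hc : ∀ k : ℕ, c ≠ -k) (z : ℂ) :
    ₂F₁ a a c z = Gamma c * regF a c z := by
  have h := ordinaryHypergeometric_div_Gamma_eq (a := a) (b := a) (z := z) hc
  rw [div_eq_iff (Gamma_ne_zero hc)] at h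
  rw [h, mul_comm, regularizedGaussHGFun, FormalMultilinearSeries.sum, regF]
  congr 1
  refine tsum_congr fun k => ?_
  rw [FormalMultilinearSeries.apply_eq_pow_smul_coeff, coeff_eq_regCoeff, smul_eq_mul, mul_comm]

/-- Since `Gamma` takes the value `0` at its poles, `(Gamma s)⁻¹` is the entire function `1/Γ` and
the functional equation has no exceptions. This is why the recursions below hold for every lower
parameter. -/
theorem inv_Gamma_eq (s : ℂ) : (Gamma s)⁻¹ = s * (Gamma (s + 1))⁻¹ :=
  one_div_Gamma_eq_self_mul_one_div_Gamma_add_one s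

theorem regCoeff_lower (a c : ℂ) (k : ℕ) :
    regCoeff a (c - 1) k = (c - 1 + k) * regCoeff a c k := by
  simp only [regCoeff, div_eq_mul_inv, mul_inv]
  rw [inv_Gamma_eq (c - 1 + k), show c - 1 + k + 1 = c + k by ring]
  ring

theorem regCoeff_succ (a c : ℂ) (k : ℕ) :
    regCoeff a c (k + 1) * (k + 1) = a ^ 2 * regCoeff (a + 1) (c + 1) k := by
  have h : ((k : ℂ) + 1) ≠ 0 := by exact_mod_cast k.succ_ne_zero
  simp only [regCoeff, ascPochhammer_succ_left, Nat.factorial_succ, Polynomial.eval_mul,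
    Polynomial.eval_comp, Polynomial.eval_add, Polynomial.eval_X, Polynomial.eval_one]
  push_cast
  rw [show c + (k + 1) = c + 1 + k by ring]
  field_simp

theorem regCoeff_succ' (a c : ℂ) (k : ℕ) :
    regCoeff a c (k + 1) * (k + 1) * (c + k) = (a + k) ^ 2 * regCoeff a c k := by
  have h : ((k : ℂ) + 1) ≠ 0 := by exact_mod_cast k.succ_ne_zero
  simp only [regCoeff, div_eq_mul_inv, mul_inv]
  rw [inv_Gamma_eq (c + k), ascPochhammer_succ_eval, Nat.factorial_succ]
  push_cast
  rw [show c + (k + 1) = c + k + 1 by ring]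
  field_simp

/-- Plain differentiation raises both parameters; this is the shift used for `gSol`. -/
theorem hasDerivAt_regF (a c : ℂ) {z : ℂ} (hz : ‖z‖ < 1) :
    HasDerivAt (regF a c) (a ^ 2 * regF (a + 1) (c + 1) z) z := by
  obtain ⟨d, hd, hs⟩ := (convergesOnDisc_regCoeff a c).hasDerivAt hz
  have h1 := summable_shift hs.summable
  rw [hs.tsum_eq] at h1
  have h2 := (hasSum_regF (a + 1) (c + 1) hz).mul_left (a ^ 2)
  have : d = a ^ 2 * regF (a + 1) (c + 1) z := by
    refine h1.unique (hasSum_of_eq h2 fun k => ?_)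
    rw [← mul_assoc, ← mul_assoc, ← regCoeff_succ]; push_cast; ring
  rw [← this]; exact hd

/-- The operator `z d/dz + (c - 1)` multiplies the coefficient of `z^k` by `c - 1 + k`, which lowers
`c` and leaves `a` alone; this is the shift used for `hSol`. -/
theorem hasDerivAt_regF' (a c : ℂ) {z : ℂ} (hz : ‖z‖ < 1) :
    ∃ d, HasDerivAt (regF a c) d z ∧ z * d + (c - 1) * regF a c z = regF a (c - 1) z := by
  obtain ⟨d, hd, hs⟩ := (convergesOnDisc_regCoeff a c).hasDerivAt hz
  refine ⟨d, hd, ?_⟩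
  have h2 := (hs.mul_left z).add ((hasSum_regF a c hz).mul_left (c - 1))
  refine h2.unique (hasSum_of_eq (hasSum_regF a (c - 1) hz) fun k => ?_)
  rw [regCoeff_lower]
  rcases k with _ | k
  · simp
  · simp [pow_succ]; ring

/-! ### The two solutions that are elementary at `v = 0` -/

/-- The solution with exponent `1/2 - 2α` at `v = 0`. -/
noncomputable def hSol (α v : ℂ) : ℂ :=
  (2 * v) ^ (1 / 2 - 2 * α) * regF (1 / 2) (3 / 2 - 2 * α) (v / 2)

/-- The solution analytic at `v = 0`. -/
noncomputable def gSol (α v : ℂ) : ℂ := regF (2 * α) (2 * α + 1 / 2) (v / 2)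

theorem norm_half_lt {v : ℂ} (hv : ‖v‖ < 2) : ‖v / 2‖ < 1 := by
  rw [norm_div]; norm_num; linarith

theorem hasDerivAt_gSol (α : ℂ) {v : ℂ} (hv : ‖v‖ < 2) :
    HasDerivAt (gSol α) (2 * α ^ 2 * gSol (α + 1 / 2) v) v := by
  have h := (hasDerivAt_regF (2 * α) (2 * α + 1 / 2) (norm_half_lt hv)).comp v
    ((hasDerivAt_id v).div_const 2)
  refine h.congr_deriv ?_
  rw [gSol, show 2 * (α + 1 / 2) = 2 * α + 1 by ring,
    show 2 * α + 1 / 2 + 1 = 2 * α + 1 + 1 / 2 by ring]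
  ring

/-- With `c = 3/2 - 2α` the prefactor is `(2v)^(c - 1)`, so the product rule produces exactly the
operator that lowers `c` by one, that is, raises `α` by `1/2`. -/
theorem hasDerivAt_hSol (α : ℂ) {v : ℂ} (hv : ‖v‖ < 2) (hs : v ∈ slitPlane) :
    HasDerivAt (hSol α) (2 * hSol (α + 1 / 2) v) v := by
  obtain ⟨d, hd, hd2⟩ := hasDerivAt_regF' (1 / 2) (3 / 2 - 2 * α) (norm_half_lt hv)
  have h1 := hd.comp v ((hasDerivAt_id v).div_const 2)
  have hs2 : 2 * v ∈ slitPlane := by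
    rcases mem_slitPlane_iff.1 hs with h | h
    · exact mem_slitPlane_iff.2 (Or.inl (by simpa using h))
    · exact mem_slitPlane_iff.2 (Or.inr (by simpa using h))
  have hv0 : (2 * v) ≠ 0 := slitPlane_ne_zero hs2
  have h2 : HasDerivAt (fun v : ℂ => (2 * v) ^ (1 / 2 - 2 * α))
      ((1 / 2 - 2 * α) * (2 * v) ^ (1 / 2 - 2 * α - 1) * 2) v := by
    simpa using ((hasDerivAt_id v).const_mul 2).cpow_const hs2
  refine (h2.mul h1).congr_deriv ?_
  simp only [Function.comp, id]
  rw [hSol, show 1 / 2 - 2 * (α + 1 / 2) = 1 / 2 - 2 * α - 1 by ring,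
    show 3 / 2 - 2 * (α + 1 / 2) = 3 / 2 - 2 * α - 1 by ring, ← hd2]
  have : (2 * v) ^ (1 / 2 - 2 * α) = (2 * v) ^ (1 / 2 - 2 * α - 1) * (2 * v) := by
    rw [cpow_sub _ 1 hv0, cpow_one, div_mul_cancel₀ _ hv0]
  rw [this]; ring

/-! ### Recursions in `α` for the values at `v = 1` -/

theorem hasSum_telescope {T : ℕ → ℂ} (h : Summable T) (h0 : T 0 = 0) :
    HasSum (fun k => T (k + 1) - T k) 0 := by
  have h1 := (hasSum_nat_add_iff' 1).2 h.hasSum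
  simpa [h0] using h1.sub h.hasSum

theorem norm_one_half_lt : ‖(1 / 2 : ℂ)‖ < 1 := by norm_num

theorem summable_mul_regCoeff (a c : ℂ) :
    Summable fun k : ℕ => (k : ℂ) * regCoeff a c k * (1 / 2) ^ k := by
  obtain ⟨d, -, hs⟩ := (convergesOnDisc_regCoeff a c).hasDerivAt norm_one_half_lt
  refine (hs.mul_left (1 / 2)).summable.congr fun k => ?_
  rcases k with _ | k
  · simp
  · simp [pow_succ]; ring

/-- At argument `1/2` the terms of the two sides differ by `T (k + 1) - T k`, where `T k` is `-2k`
times the `k`-th term of the series with lower parameter `c - 1`. This difference sums to zero. -/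
theorem regF_half_lower (c : ℂ) :
    regF (1 / 2) (c - 2) (1 / 2) = 4 * (3 / 4 - c / 2) ^ 2 * regF (1 / 2) c (1 / 2) := by
  have e : ∀ k : ℕ, regCoeff (1 / 2) (c - 2) k =
      (c - 2 + k) * (c - 1 + k) * regCoeff (1 / 2) c k := fun k => by
    rw [show c - 2 = c - 1 - 1 by ring, regCoeff_lower, regCoeff_lower]; ring
  have hT := hasSum_telescope
    (T := fun k : ℕ => -2 * ((k : ℂ) * regCoeff (1 / 2) (c - 1) k * (1 / 2) ^ k))
    ((summable_mul_regCoeff _ _).mul_left _) (by simp)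
  have h := hT.add ((hasSum_regF (1 / 2) c norm_one_half_lt).mul_left (4 * (3 / 4 - c / 2) ^ 2))
  rw [zero_add] at h
  refine (hasSum_regF _ _ norm_one_half_lt).unique (hasSum_of_eq h fun k => ?_)
  have h1 := regCoeff_succ' (1 / 2) (c - 1) k
  have h2 := regCoeff_lower (1 / 2) c k
  have h3 := regCoeff_lower (1 / 2) c (k + 1)
  have h4 := regCoeff_succ' (1 / 2) c k
  have h5 : ((k + 1 : ℕ) : ℂ) * regCoeff (1 / 2) (c - 1) (k + 1) =
      (1 / 2 + k) ^ 2 * regCoeff (1 / 2) c k := by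
    rw [h3, ← h4]; push_cast; ring
  rw [h5, e, h2, pow_succ]
  ring

/-- A telescoping sum shows that inserting `k (k - 1)` into the series multiplies it by `b²`. The
weight kills the terms `k = 0, 1`, and shifting the index by two gives the series at `b + 2` times
`b² (b + 1)² / 4`. Cancelling `b²` is what excludes `b = 0`. -/
theorem regF_half_raise {b : ℂ} (hb : b ≠ 0) :
    regF b (b + 1 / 2) (1 / 2) =
      ((b + 1) / 2) ^ 2 * regF (b + 2) (b + 2 + 1 / 2) (1 / 2) := by
  have hsum : Summable fun k : ℕ =>
      (k : ℂ) * (b - 1 / 2 + k) * regCoeff b (b + 1 / 2) k * (1 / 2) ^ k := by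
    refine (summable_mul_regCoeff b (b + 1 / 2 - 1)).congr fun k => ?_
    rw [regCoeff_lower]; ring
  have hT := (hasSum_telescope (T := fun k : ℕ =>
    -2 * ((k : ℂ) * (b - 1 / 2 + k) * regCoeff b (b + 1 / 2) k * (1 / 2) ^ k))
    (hsum.mul_left _) (by simp)).add
      ((hasSum_regF b (b + 1 / 2) norm_one_half_lt).mul_left (b ^ 2))
  have hT2 : HasSum (fun k : ℕ => (k : ℂ) * (k - 1) * regCoeff b (b + 1 / 2) k * (1 / 2) ^ k)
      (b ^ 2 * regF b (b + 1 / 2) (1 / 2)) := by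
    rw [zero_add] at hT
    refine hasSum_of_eq hT fun k => ?_
    have h1 := regCoeff_succ' b (b + 1 / 2) k
    have h5 : ((k + 1 : ℕ) : ℂ) * (b - 1 / 2 + (k + 1 : ℕ)) * regCoeff b (b + 1 / 2) (k + 1) =
      (b + k) ^ 2 * regCoeff b (b + 1 / 2) k := by
      rw [← h1]; push_cast; ring
    rw [h5, pow_succ]
    ring
  have h3 := (hasSum_nat_add_iff' 2).2 hT2
  simp only [Finset.sum_range_succ, Finset.sum_range_zero, Nat.cast_zero, Nat.cast_one, sub_self,
    mul_zero, zero_mul, add_zero, sub_zero] at h3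
  have h4 := (hasSum_regF (b + 2) (b + 2 + 1 / 2) norm_one_half_lt).mul_left
    (b ^ 2 * (b + 1) ^ 2 * (1 / 2) ^ 2)
  have h6 := h3.unique (by
    refine hasSum_of_eq h4 fun k => ?_
    have e1 := regCoeff_succ b (b + 1 / 2) (k + 1)
    have e2 := regCoeff_succ (b + 1) (b + 1 / 2 + 1) k
    rw [show b + 1 + 1 = b + 2 by ring, show b + 1 / 2 + 1 + 1 = b + 2 + 1 / 2 by ring] at e2
    have e3 : ((k + 2 : ℕ) : ℂ) * ((k + 2 : ℕ) - 1) * regCoeff b (b + 1 / 2) (k + 2) =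
        b ^ 2 * (b + 1) ^ 2 * regCoeff (b + 2) (b + 2 + 1 / 2) k := by
      have : ((k + 2 : ℕ) : ℂ) = ((k + 1 : ℕ) : ℂ) + 1 := by push_cast; ring
      rw [this]
      rw [mul_assoc (b ^ 2), ← e2, ← mul_assoc, ← e1]
      push_cast; ring
    rw [e3, pow_add]; ring)
  have hb2 : b ^ 2 ≠ 0 := pow_ne_zero _ hb
  refine mul_left_cancel₀ hb2 ?_
  rw [h6]; ring

end SeibergWitten

namespace SeibergWitten

open Complex Set MeasureTheory

/-! ### Binomial series, Beta and Euler integrals over the reals -/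

theorem choose_eq_ascPochhammer {K : Type*} [Field K] [CharZero K] (a : K) (n : ℕ) :
    Ring.choose (a + n - 1) n = (ascPochhammer K n).eval a / n.factorial := by
  rw [Ring.choose_eq_smul, Polynomial.descPochhammer_smeval_eq_ascPochhammer,
    Polynomial.ascPochhammer_smeval_cast, Polynomial.ascPochhammer_smeval_eq_eval, smul_eq_mul,
    show a + n - 1 - n + 1 = a by ring]
  field_simp

theorem hasSum_binomial_real (a : ℝ) {x : ℝ} (hx : |x| < 1) :
    HasSum (fun k : ℕ => (ascPochhammer ℝ k).eval a / k.factorial * x ^ k) ((1 - x) ^ (-a)) := by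
  have h := (Real.one_div_one_sub_rpow_hasFPowerSeriesOnBall_zero a).hasSum (y := x) (by
    rw [Metric.mem_eball, edist_zero_right, ← ofReal_norm, ← ENNReal.ofReal_one,
      ENNReal.ofReal_lt_ofReal_iff one_pos]
    exact hx)
  rw [zero_add, one_div, ← Real.rpow_neg (by linarith [abs_lt.1 hx])] at h
  refine hasSum_of_eq h fun k => ?_
  rw [FormalMultilinearSeries.ofScalars_apply_eq, smul_eq_mul, choose_eq_ascPochhammer]

theorem hasSum_binomial_complex (a : ℂ) {x : ℂ} (hx : ‖x‖ < 1) :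
    HasSum (fun k : ℕ => (ascPochhammer ℂ k).eval a / k.factorial * x ^ k) ((1 - x) ^ (-a)) := by
  have h := (one_div_one_sub_cpow_hasFPowerSeriesOnBall_zero a).hasSum (y := x) (by
    rw [Metric.mem_eball, edist_zero_right, ← ofReal_norm, ← ENNReal.ofReal_one,
      ENNReal.ofReal_lt_ofReal_iff one_pos]
    exact hx)
  rw [zero_add, one_div, ← cpow_neg] at h
  refine hasSum_of_eq h fun k => ?_
  rw [FormalMultilinearSeries.ofScalars_apply_eq, smul_eq_mul, choose_eq_ascPochhammer]

theorem betaIntegrand_eq {p q t : ℝ} (ht : t ∈ Icc (0 : ℝ) 1) :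
    (t : ℂ) ^ ((p : ℂ) - 1) * (1 - (t : ℂ)) ^ ((q : ℂ) - 1) =
      ((t ^ (p - 1) * (1 - t) ^ (q - 1) : ℝ) : ℂ) := by
  rw [ofReal_mul, ofReal_cpow ht.1, ofReal_cpow (sub_nonneg.2 ht.2)]
  push_cast; rfl

theorem intervalIntegrable_beta {p q : ℝ} (hp : 0 < p) (hq : 0 < q) :
    IntervalIntegrable (fun t : ℝ => t ^ (p - 1) * (1 - t) ^ (q - 1)) volume 0 1 := by
  have h := (betaIntegral_convergent (u := p) (v := q) (by simpa) (by simpa))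
  rw [intervalIntegrable_iff_integrableOn_Ioc_of_le zero_le_one] at h ⊢
  refine (h.re).congr ?_
  refine (ae_restrict_iff' measurableSet_Ioc).2 (Filter.Eventually.of_forall fun t ht => ?_)
  simp only [RCLike.re_to_complex]
  rw [betaIntegrand_eq ⟨ht.1.le, ht.2⟩, ofReal_re]

theorem integral_beta {p q : ℝ} (hp : 0 < p) (hq : 0 < q) :
    ∫ t in (0 : ℝ)..1, t ^ (p - 1) * (1 - t) ^ (q - 1) =
      Real.Gamma p * Real.Gamma q / Real.Gamma (p + q) := by
  have h := betaIntegral_eq_Gamma_mul_div p q (by simpa) (by simpa)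
  rw [betaIntegral, intervalIntegral.integral_congr (g := fun t : ℝ =>
    ((t ^ (p - 1) * (1 - t) ^ (q - 1) : ℝ) : ℂ)) (fun t ht => betaIntegrand_eq (by
      simpa using ht)), intervalIntegral.integral_ofReal, ← ofReal_add, Gamma_ofReal,
      Gamma_ofReal, Gamma_ofReal] at h
  exact_mod_cast h

theorem integral_beta_pow {m p q : ℝ} (hm : 0 < m) (hp : 0 < p) (hq : 0 < q) :
    ∫ t in (0 : ℝ)..1, t ^ (m * p - 1) * (1 - t ^ m) ^ (q - 1) =
      Real.Gamma p * Real.Gamma q / (m * Real.Gamma (p + q)) := by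
  -- The substitution `t ↦ t^m` is made on the half-line, with the integrand extended by zero
  -- outside the unit interval.
  have h := integral_comp_rpow_Ioi
    ((Ioo (0 : ℝ) 1).indicator fun t => t ^ (p - 1) * (1 - t) ^ (q - 1)) hm.ne'
  rw [integral_indicator measurableSet_Ioo, Measure.restrict_restrict measurableSet_Ioo,
    inter_eq_left.2 Ioo_subset_Ioi_self, ← integral_Ioc_eq_integral_Ioo,
    ← intervalIntegral.integral_of_le zero_le_one, integral_beta hp hq] at h
  have e : ∀ x ∈ Ioi (0 : ℝ), (|m| * x ^ (m - 1)) • (Ioo (0 : ℝ) 1).indicator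
      (fun t : ℝ => t ^ (p - 1) * (1 - t) ^ (q - 1)) (x ^ m) = (Ioo (0 : ℝ) 1).indicator
      (fun x => m * (x ^ (m * p - 1) * (1 - x ^ m) ^ (q - 1))) x := by
    intro x hx
    have hx0 : 0 < x := hx
    by_cases hx1 : x < 1
    · have h1 : x ^ m ∈ Ioo (0 : ℝ) 1 := ⟨Real.rpow_pos_of_pos hx0 _, Real.rpow_lt_one hx0.le hx1 hm⟩
      rw [indicator_of_mem h1, indicator_of_mem (show x ∈ Ioo (0 : ℝ) 1 from ⟨hx0, hx1⟩),
        abs_of_pos hm, smul_eq_mul, ← Real.rpow_mul hx0.le,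
        show m * p - 1 = (m - 1) + m * (p - 1) by ring, Real.rpow_add hx0]
      ring
    · have h1 : x ^ m ∉ Ioo (0 : ℝ) 1 := fun h =>
        absurd h.2 (not_lt.2 (Real.one_le_rpow (not_lt.1 hx1) hm.le))
      rw [indicator_of_notMem h1, indicator_of_notMem (fun h => hx1 h.2), smul_zero]
  rw [setIntegral_congr_fun measurableSet_Ioi e, integral_indicator measurableSet_Ioo,
    Measure.restrict_restrict measurableSet_Ioo,
    inter_eq_left.2 Ioo_subset_Ioi_self, ← integral_Ioc_eq_integral_Ioo,
    ← intervalIntegral.integral_of_le zero_le_one, intervalIntegral.integral_const_mul] at h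
  rw [mul_comm m (Real.Gamma (p + q)), ← div_div, ← h]
  field_simp

theorem Gamma_add_nat {b : ℝ} (hb : 0 < b) (k : ℕ) :
    Real.Gamma (b + k) = (ascPochhammer ℝ k).eval b * Real.Gamma b := by
  induction k with
  | zero => simp
  | succ k ih =>
    rw [ascPochhammer_succ_eval, Nat.cast_succ, ← add_assoc,
      Real.Gamma_add_one (by positivity), ih]
    ring

/-- Euler's integral for the regularized hypergeometric series. -/
theorem hasSum_euler (a : ℝ) {b d z : ℝ} (hb : 0 < b) (hd : 0 < d) (hz0 : 0 ≤ z) (hz : z < 1) :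
    HasSum (fun k : ℕ => (ascPochhammer ℝ k).eval a * (ascPochhammer ℝ k).eval b /
        (k.factorial * Real.Gamma (b + d + k)) * z ^ k)
      ((∫ t in (0 : ℝ)..1, t ^ (b - 1) * (1 - t) ^ (d - 1) * (1 - z * t) ^ (-a)) /
        (Real.Gamma b * Real.Gamma d)) := by
  have hI : uIoc (0 : ℝ) 1 = Ioc 0 1 := uIoc_of_le zero_le_one
  set f : ℝ → ℝ := fun t => t ^ (b - 1) * (1 - t) ^ (d - 1) with hf
  have hfi : IntervalIntegrable f volume 0 1 := intervalIntegrable_beta hb hd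
  set w : ℕ → ℝ := fun k => (ascPochhammer ℝ k).eval a / k.factorial with hw
  have hws : Summable fun k => ‖w k‖ * z ^ k := by
    have := ((hasSum_binomial_real a (x := z) (by rwa [abs_of_nonneg hz0])).summable).norm
    refine this.congr fun k => ?_
    rw [norm_mul, norm_pow, Real.norm_of_nonneg hz0]
  have key : HasSum (fun k => ∫ t in (0 : ℝ)..1, f t * (w k * (z * t) ^ k))
      (∫ t in (0 : ℝ)..1, f t * (1 - z * t) ^ (-a)) := by
    refine intervalIntegral.hasSum_integral_of_dominated_convergence
      (fun k t => ‖f t‖ * (‖w k‖ * z ^ k)) (fun k => ?_) (fun k => ?_) ?_ ?_ ?_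
    · exact (hfi.def'.aestronglyMeasurable).mul
        (Continuous.aestronglyMeasurable (by fun_prop))
    · refine Filter.Eventually.of_forall fun t ht => ?_
      rw [hI] at ht
      rw [norm_mul (f t), norm_mul (w k), norm_pow, Real.norm_of_nonneg (mul_nonneg hz0 ht.1.le)]
      have : z * t ≤ z := mul_le_of_le_one_right hz0 ht.2
      have h0 : 0 ≤ z * t := mul_nonneg hz0 ht.1.le
      gcongr
    · exact Filter.Eventually.of_forall fun t _ => hws.mul_left _
    · simp_rw [tsum_mul_left]
      exact hfi.norm.mul_const _
    · refine Filter.Eventually.of_forall fun t ht => ?_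
      rw [hI] at ht
      refine (hasSum_binomial_real a ?_).mul_left _
      rw [abs_of_nonneg (mul_nonneg hz0 ht.1.le)]
      exact lt_of_le_of_lt (mul_le_of_le_one_right hz0 ht.2) hz
  refine hasSum_of_eq (key.div_const _) fun k => ?_
  have e : ∫ t in (0 : ℝ)..1, f t * (w k * (z * t) ^ k) =
      w k * z ^ k * (Real.Gamma (b + k) * Real.Gamma d / Real.Gamma (b + k + d)) := by
    rw [← integral_beta (by positivity) hd, ← intervalIntegral.integral_const_mul,
      intervalIntegral.integral_of_le zero_le_one, intervalIntegral.integral_of_le zero_le_one]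
    refine setIntegral_congr_fun measurableSet_Ioc fun t ht => ?_
    simp only [hf]
    rw [show b + k - 1 = (b - 1) + (k : ℝ) by ring, Real.rpow_add ht.1, Real.rpow_natCast]
    ring
  rw [e, Gamma_add_nat hb, hw]
  have h1 := (Real.Gamma_pos_of_pos hb).ne'
  have h2 := (Real.Gamma_pos_of_pos hd).ne'
  have h3 : (Real.Gamma (b + k + d)) ≠ 0 := (Real.Gamma_pos_of_pos (by positivity)).ne'
  rw [show b + d + k = b + k + d by ring]
  field_simp

theorem ascPochhammer_eval_ofReal (k : ℕ) (a : ℝ) :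
    (ascPochhammer ℂ k).eval (a : ℂ) = ((ascPochhammer ℝ k).eval a : ℝ) := by
  induction k with
  | zero => simp
  | succ k ih => rw [ascPochhammer_succ_eval, ascPochhammer_succ_eval, ih]; push_cast; rfl

theorem regCoeff_ofReal (a c : ℝ) (k : ℕ) :
    regCoeff a c k = (((ascPochhammer ℝ k).eval a * (ascPochhammer ℝ k).eval a /
        (k.factorial * Real.Gamma (c + k)) : ℝ) : ℂ) := by
  rw [regCoeff, ascPochhammer_eval_ofReal]
  push_cast
  rw [← Gamma_ofReal]
  push_cast
  ring

theorem regF_euler {b d z : ℝ} (hb : 0 < b) (hd : 0 < d) (hz0 : 0 ≤ z) (hz : z < 1) :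
    regF b (b + d) z = (((∫ t in (0 : ℝ)..1, t ^ (b - 1) * (1 - t) ^ (d - 1) *
      (1 - z * t) ^ (-b)) / (Real.Gamma b * Real.Gamma d) : ℝ) : ℂ) := by
  have h := hasSum_ofReal.2 (hasSum_euler b hb hd hz0 hz)
  refine HasSum.unique (hasSum_regF b (b + d) (by simpa [abs_of_nonneg hz0] using hz)) ?_
  refine hasSum_of_eq h fun k => ?_
  rw [← ofReal_add, regCoeff_ofReal]
  push_cast
  ring

end SeibergWitten

namespace SeibergWitten

open Complex Set MeasureTheory

/-! ### Values at `v = 1` -/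

/-- The reflection `t = 1 - y` makes `1 - t/2` equal to `(1 + y)/2`. The factors `(1 - y)^(-1/2)`
and `(1 + y)^(-1/2)` then combine to `(1 - y²)^(-1/2)`, leaving a Beta integral in `y²`. -/
theorem integral_hSol_one {α : ℝ} (hα : α < 1 / 2) :
    ∫ t in (0 : ℝ)..1, t ^ ((1 / 2 : ℝ) - 1) * (1 - t) ^ (1 - 2 * α - 1) *
      (1 - 1 / 2 * t) ^ (-(1 / 2 : ℝ)) =
    2 ^ (1 / 2 : ℝ) * (Real.Gamma (1 / 2 - α) * Real.Gamma (1 / 2) /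
      (2 * Real.Gamma (1 / 2 - α + 1 / 2))) := by
  rw [← integral_beta_pow two_pos (by linarith) (by norm_num),
    ← intervalIntegral.integral_const_mul]
  have h := intervalIntegral.integral_comp_sub_left (a := 0) (b := 1) (fun t : ℝ =>
    t ^ ((1 / 2 : ℝ) - 1) * (1 - t) ^ (1 - 2 * α - 1) * (1 - 1 / 2 * t) ^ (-(1 / 2 : ℝ))) 1
  rw [sub_self, sub_zero] at h
  rw [← h, intervalIntegral.integral_of_le zero_le_one, intervalIntegral.integral_of_le zero_le_one,
    integral_Ioc_eq_integral_Ioo, integral_Ioc_eq_integral_Ioo]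
  refine setIntegral_congr_fun measurableSet_Ioo fun y hy => ?_
  have h0 : 0 < y := hy.1
  have h1 : 0 < 1 - y := sub_pos.2 hy.2
  have h2 : 0 < 1 + y := by linarith
  rw [show 1 - y ^ (2 : ℝ) = (1 - y) * (1 + y) by rw [Real.rpow_two]; ring,
    Real.mul_rpow h1.le h2.le, show 1 - 1 / 2 * (1 - y) = (1 + y) / 2 by ring,
    Real.div_rpow h2.le two_pos.le, sub_sub_cancel,
    show (2 : ℝ) * (1 / 2 - α) - 1 = 1 - 2 * α - 1 by ring,
    show (1 / 2 : ℝ) - 1 = -(1 / 2) by norm_num, Real.rpow_neg two_pos.le, div_inv_eq_mul]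
  ring

/-- The Möbius substitution `t = 2y / (1 + y)` preserves the unit interval and turns the integrand
into a constant times `y^(b - 1) (1 - y²)^(-1/2)`. -/
theorem integral_gSol_one {b : ℝ} (hb : 0 < b) :
    ∫ t in (0 : ℝ)..1, t ^ (b - 1) * (1 - t) ^ ((1 / 2 : ℝ) - 1) *
      (1 - 1 / 2 * t) ^ (-b) =
    2 ^ b * (Real.Gamma (b / 2) * Real.Gamma (1 / 2) /
      (2 * Real.Gamma (b / 2 + 1 / 2))) := by
  rw [← integral_beta_pow two_pos (by linarith) (by norm_num),
    ← intervalIntegral.integral_const_mul, intervalIntegral.integral_of_le zero_le_one,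
    intervalIntegral.integral_of_le zero_le_one, integral_Ioc_eq_integral_Ioo,
    integral_Ioc_eq_integral_Ioo]
  set f : ℝ → ℝ := fun y => 2 * y / (1 + y) with hf
  have him : f '' Ioo 0 1 = Ioo 0 1 := by
    ext t
    constructor
    · rintro ⟨y, hy, rfl⟩
      have h2 : 0 < 1 + y := by linarith [hy.1]
      exact ⟨div_pos (by linarith [hy.1]) h2, by rw [hf]; simp only; rw [div_lt_one h2]; linarith [hy.2]⟩
    · intro ht
      have h2 : 0 < 2 - t := by linarith [ht.2]
      refine ⟨t / (2 - t), ⟨div_pos ht.1 h2, by rw [div_lt_one h2]; linarith [ht.2]⟩, ?_⟩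
      simp only [hf]
      have : 1 + t / (2 - t) ≠ 0 := by
        have : 0 < t / (2 - t) := div_pos ht.1 h2
        positivity
      field_simp
      ring
  have hd : ∀ y ∈ Ioo (0 : ℝ) 1, HasDerivWithinAt f (2 / (1 + y) ^ 2) (Ioo 0 1) y := by
    intro y hy
    have h2 : 1 + y ≠ 0 := by linarith [hy.1]
    have := ((hasDerivAt_id y).const_mul 2).div ((hasDerivAt_id y).const_add 1) h2
    refine (this.congr_deriv ?_).hasDerivWithinAt
    simp only [id]
    congr 1
    ring
  have hinj : InjOn f (Ioo 0 1) := by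
    intro x hx y hy hxy
    have h1 : 0 < 1 + x := by linarith [hx.1]
    have h2 : 0 < 1 + y := by linarith [hy.1]
    simp only [hf] at hxy
    rw [div_eq_div_iff h1.ne' h2.ne'] at hxy
    linarith
  rw [← him, integral_image_eq_integral_abs_deriv_smul measurableSet_Ioo hd hinj, him]
  refine setIntegral_congr_fun measurableSet_Ioo fun y hy => ?_
  have h0 : 0 < y := hy.1
  have h1 : 0 < 1 - y := sub_pos.2 hy.2
  have h2 : 0 < 1 + y := by linarith
  simp only [hf, smul_eq_mul]
  rw [show 1 - 2 * y / (1 + y) = (1 - y) / (1 + y) by field_simp; ring,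
    show 1 - 1 / 2 * (2 * y / (1 + y)) = (1 + y)⁻¹ by field_simp; ring,
    show 1 - y ^ (2 : ℝ) = (1 - y) * (1 + y) by rw [Real.rpow_two]; ring,
    Real.mul_rpow h1.le h2.le, Real.div_rpow h1.le h2.le, Real.div_rpow (by positivity) h2.le,
    Real.mul_rpow two_pos.le h0.le, Real.inv_rpow h2.le, Real.rpow_neg h2.le, inv_inv,
    show (2 : ℝ) * (b / 2) - 1 = b - 1 by ring, Real.rpow_sub_one two_ne_zero,
    Real.rpow_sub_one h2.ne' b, show (1 / 2 : ℝ) - 1 = -(1 / 2) by norm_num,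
    Real.rpow_neg h2.le, abs_of_pos (by positivity)]
  have h3 : (1 + y) ^ (1 / 2 : ℝ) * (1 + y) ^ (1 / 2 : ℝ) = 1 + y := by
    rw [← Real.rpow_add h2]; norm_num
  have h4 : (1 + y) ^ b ≠ 0 := (Real.rpow_pos_of_pos h2 _).ne'
  have h5 : (1 + y) ^ (1 / 2 : ℝ) ≠ 0 := (Real.rpow_pos_of_pos h2 _).ne'
  field_simp
  rw [sq, h3]

theorem hSol_one_step (α : ℂ) : hSol (α + 1) 1 = α ^ 2 * hSol α 1 := by
  simp only [hSol, mul_one]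
  have h := regF_half_lower (3 / 2 - 2 * α)
  rw [show 3 / 2 - 2 * (α + 1) = 3 / 2 - 2 * α - 2 by ring, h,
    show 1 / 2 - 2 * (α + 1) = 1 / 2 - 2 * α - (2 : ℕ) by push_cast; ring,
    cpow_sub _ _ two_ne_zero, cpow_natCast]
  ring

theorem hSol_one_of_lt {α : ℝ} (hα : α < 1 / 2) :
    hSol α 1 = ((√Real.pi / Real.Gamma (1 - α) ^ 2 : ℝ) : ℂ) := by
  have h := regF_euler (b := 1 / 2) (d := 1 - 2 * α) (z := 1 / 2) (by norm_num) (by linarith)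
    (by norm_num) (by norm_num)
  rw [integral_hSol_one hα] at h
  have h2 := Real.Gamma_mul_Gamma_add_half (1 / 2 - α)
  have e1 : hSol α 1 = ((2 ^ (1 / 2 - 2 * α) : ℝ) : ℂ) * regF (1 / 2 : ℝ) ((1 / 2 : ℝ) + (1 - 2 * α : ℝ))
      ((1 / 2 : ℝ) : ℂ) := by
    rw [hSol, ofReal_cpow two_pos.le]
    push_cast
    congr 2 <;> ring
  rw [e1, h, ← ofReal_mul]
  congr 1
  rw [show 1 / 2 - α + 1 / 2 = 1 - α by ring, show 2 * (1 / 2 - α) = 1 - 2 * α by ring] at *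
  have g1 : Real.Gamma (1 - α) ≠ 0 := (Real.Gamma_pos_of_pos (by linarith)).ne'
  have g2 : Real.Gamma (1 - 2 * α) ≠ 0 := (Real.Gamma_pos_of_pos (by linarith)).ne'
  have g3 : Real.Gamma (1 / 2) ≠ 0 := (Real.Gamma_pos_of_pos (by norm_num)).ne'
  have h3 : (2 : ℝ) ^ (1 / 2 - 2 * α) * 2 ^ (1 / 2 : ℝ) * 2 ^ (1 - (1 - 2 * α)) = 2 := by
    rw [← Real.rpow_add two_pos, ← Real.rpow_add two_pos,
      show 1 / 2 - 2 * α + 1 / 2 + (1 - (1 - 2 * α)) = 1 by ring, Real.rpow_one]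
  have h4 : Real.Gamma (1 / 2 - α) * Real.Gamma (1 - α) * (2 ^ (1 / 2 - 2 * α) * 2 ^ (1 / 2 : ℝ)) =
      Real.Gamma (1 - 2 * α) * √Real.pi *
        (2 ^ (1 / 2 - 2 * α) * 2 ^ (1 / 2 : ℝ) * 2 ^ (1 - (1 - 2 * α))) := by
    rw [h2]; ring
  rw [h3] at h4
  generalize (2 : ℝ) ^ (1 / 2 - 2 * α) = x at *
  generalize (2 : ℝ) ^ (1 / 2 : ℝ) = y at *
  generalize Real.Gamma (1 / 2 - α) = z at *
  generalize Real.Gamma (1 - α) = w at *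
  field_simp
  linarith

/-- Euler's integral converges only for `α < 1/2`. Both sides obey the recursion of `hSol_one_step`,
which carries the formula to all real `α` in unit steps. -/
theorem hSol_one (α : ℝ) : hSol α 1 = √Real.pi * (Gamma (1 - α))⁻¹ ^ 2 := by
  have key : ∀ n : ℕ, ∀ α : ℝ, α < n + 1 / 2 →
      hSol α 1 = √Real.pi * (Gamma (1 - α))⁻¹ ^ 2 := by
    intro n
    induction n with
    | zero =>
      intro α hα
      rw [hSol_one_of_lt (by simpa using hα)]
      push_cast
      rw [← Gamma_ofReal]
      push_cast
      ring
    | succ n ih =>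
      intro α hα
      have h1 := ih (α - 1) (by push_cast at hα; linarith)
      have h2 := hSol_one_step ((α - 1 : ℝ) : ℂ)
      rw [h1] at h2
      push_cast at h2
      rw [sub_add_cancel] at h2
      rw [h2, inv_Gamma_eq (1 - (α : ℂ)), show (1 : ℂ) - (α - 1) = 1 - α + 1 by ring]
      ring
  obtain ⟨n, hn⟩ := exists_nat_gt α
  exact key n α (by linarith)

theorem gSol_one_of_pos {α : ℝ} (hα : 0 < α) :
    gSol α 1 = ((√Real.pi / Real.Gamma (α + 1 / 2) ^ 2 : ℝ) : ℂ) := by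
  have h := regF_euler (b := 2 * α) (d := 1 / 2) (z := 1 / 2) (by linarith) (by norm_num)
    (by norm_num) (by norm_num)
  rw [integral_gSol_one (by linarith)] at h
  have h2 := Real.Gamma_mul_Gamma_add_half α
  have e1 : gSol α 1 = regF (2 * α : ℝ) ((2 * α : ℝ) + (1 / 2 : ℝ)) ((1 / 2 : ℝ) : ℂ) := by
    rw [gSol]; push_cast; rfl
  rw [e1, h]
  congr 1
  rw [show 2 * α / 2 = α by ring] at *
  have g1 : Real.Gamma (α + 1 / 2) ≠ 0 := (Real.Gamma_pos_of_pos (by linarith)).ne'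
  have g2 : Real.Gamma (2 * α) ≠ 0 := (Real.Gamma_pos_of_pos (by linarith)).ne'
  have g3 : Real.Gamma (1 / 2) ≠ 0 := (Real.Gamma_pos_of_pos (by norm_num)).ne'
  have h3 : (2 : ℝ) ^ (2 * α) * 2 ^ (1 - 2 * α) = 2 := by
    rw [← Real.rpow_add two_pos]
    norm_num
  have h4 : Real.Gamma α * Real.Gamma (α + 1 / 2) * 2 ^ (2 * α) =
      Real.Gamma (2 * α) * √Real.pi * (2 ^ (2 * α) * 2 ^ (1 - 2 * α)) := by
    rw [h2]; ring
  rw [h3] at h4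
  generalize (2 : ℝ) ^ (2 * α) = x at *
  generalize Real.Gamma α = z at *
  generalize Real.Gamma (α + 1 / 2) = w at *
  field_simp
  linarith

/-- Euler's integral covers `α > 0`, and `regF_half_raise` carries the formula downwards in unit
steps. -/
theorem gSol_one (α : ℝ) : gSol α 1 = √Real.pi * (Gamma (α + 1 / 2))⁻¹ ^ 2 := by
  have key : ∀ n : ℕ, ∀ α : ℝ, -n < α →
      gSol α 1 = √Real.pi * (Gamma (α + 1 / 2))⁻¹ ^ 2 := by
    intro n
    induction n with
    | zero =>
      intro α hα
      rw [gSol_one_of_pos (by simpa using hα)]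
      push_cast
      rw [← Gamma_ofReal]
      push_cast
      ring
    | succ n ih =>
      intro α hα
      -- The step from `α + 1` to `α` cancels `(2α)²`, so `α = 0` needs its own argument: there the
      -- series consists of its constant term.
      by_cases h0 : α = 0
      · subst h0
        have hz : regF 0 (1 / 2) (1 / 2) = (Gamma (1 / 2))⁻¹ := by
          refine (hasSum_regF _ _ norm_one_half_lt).unique ?_
          convert hasSum_single 0 fun k hk => ?_ using 1
          · simp [regCoeff]
          · simp [regCoeff, hk]
        have hpi : (√Real.pi : ℂ) ≠ 0 := by
          exact_mod_cast (Real.sqrt_pos.2 Real.pi_pos).ne'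
        have hG : Gamma (1 / 2) = (√Real.pi : ℂ) := by
          have := Gamma_ofReal (1 / 2)
          rw [Real.Gamma_one_half_eq] at this
          push_cast at this
          exact this
        simp only [gSol, ofReal_zero, mul_zero, zero_add]
        rw [hz, hG]
        field_simp
      · have h1 := ih (α + 1) (by push_cast at hα; linarith)
        have h2 := regF_half_raise (b := 2 * (α : ℂ)) (by
          simpa using h0)
        simp only [gSol] at h1 ⊢
        push_cast at h1
        rw [h2, show 2 * (α : ℂ) + 2 = 2 * (α + 1) by ring, h1, inv_Gamma_eq ((α : ℂ) + 1 / 2),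
          show (α : ℂ) + 1 / 2 + 1 = α + 1 + 1 / 2 by ring]
        ring
  obtain ⟨n, hn⟩ := exists_nat_gt (-α)
  exact key n α (by linarith)

end SeibergWitten

namespace SeibergWitten

open Complex Set MeasureTheory

/-! ### Taylor expansions at `v = 1` and the connection formula -/

theorem mem_slitPlane_of_norm_sub_one_lt {v : ℂ} (hv : ‖v - 1‖ < 1) : v ∈ slitPlane := by
  simpa using mem_slitPlane_of_norm_lt_one hv

theorem norm_lt_two_of_norm_sub_one_lt {v : ℂ} (hv : ‖v - 1‖ < 1) : ‖v‖ < 2 := by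
  have := norm_add_le (v - 1) 1
  rw [sub_add_cancel, norm_one] at this
  linarith

theorem iteratedDeriv_hSol (α : ℂ) (k : ℕ) :
    ∀ v ∈ Metric.ball (1 : ℂ) 1,
      iteratedDeriv k (hSol α) v = 2 ^ k * hSol (α + k / 2) v := by
  induction k with
  | zero => intro v _; simp
  | succ k ih =>
    intro v hv
    have hv' : ‖v - 1‖ < 1 := by simpa [dist_eq_norm] using hv
    rw [iteratedDeriv_succ, Filter.EventuallyEq.deriv_eq
      (Filter.eventuallyEq_of_mem (Metric.isOpen_ball.mem_nhds hv) ih)]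
    have h := (hasDerivAt_hSol (α + k / 2) (norm_lt_two_of_norm_sub_one_lt hv')
      (mem_slitPlane_of_norm_sub_one_lt hv')).const_mul (2 ^ k)
    rw [h.deriv, show α + (k + 1 : ℕ) / 2 = α + k / 2 + 1 / 2 by push_cast; ring]
    ring

theorem iteratedDeriv_gSol (α : ℂ) (k : ℕ) :
    ∀ v ∈ Metric.ball (1 : ℂ) 1, iteratedDeriv k (gSol α) v =
      (ascPochhammer ℂ k).eval (2 * α) ^ 2 / 2 ^ k * gSol (α + k / 2) v := by
  induction k with
  | zero => intro v _; simp
  | succ k ih =>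
    intro v hv
    have hv' : ‖v - 1‖ < 1 := by simpa [dist_eq_norm] using hv
    rw [iteratedDeriv_succ, Filter.EventuallyEq.deriv_eq
      (Filter.eventuallyEq_of_mem (Metric.isOpen_ball.mem_nhds hv) ih)]
    have h := (hasDerivAt_gSol (α + k / 2) (norm_lt_two_of_norm_sub_one_lt hv')).const_mul
      ((ascPochhammer ℂ k).eval (2 * α) ^ 2 / 2 ^ k)
    rw [h.deriv, show α + (k + 1 : ℕ) / 2 = α + k / 2 + 1 / 2 by push_cast; ring,
      ascPochhammer_succ_eval]
    field_simp
    ring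

theorem hasSum_hSol (α : ℝ) {v : ℂ} (hv : v ∈ Metric.ball (1 : ℂ) 1) :
    HasSum (fun k : ℕ => ((k.factorial : ℂ)⁻¹ * (v - 1) ^ k) *
      (2 ^ k * (√Real.pi * (Gamma (1 - (α + k / 2)))⁻¹ ^ 2))) (hSol α v) := by
  have hd : DifferentiableOn ℂ (hSol α) (Metric.ball 1 1) := fun w hw => by
    have hw' : ‖w - 1‖ < 1 := by simpa [dist_eq_norm] using hw
    exact (hasDerivAt_hSol α (norm_lt_two_of_norm_sub_one_lt hw')
      (mem_slitPlane_of_norm_sub_one_lt hw')).differentiableAt.differentiableWithinAt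
  refine hasSum_of_eq (hasSum_taylorSeries_on_ball hd hv) fun k => ?_
  rw [iteratedDeriv_hSol _ _ _ (Metric.mem_ball_self one_pos), smul_eq_mul, smul_eq_mul]
  have := hSol_one (α + k / 2)
  push_cast at this
  rw [this]
  ring

theorem hasSum_gSol (α : ℝ) {v : ℂ} (hv : v ∈ Metric.ball (1 : ℂ) 1) :
    HasSum (fun k : ℕ => ((k.factorial : ℂ)⁻¹ * (v - 1) ^ k) *
      ((ascPochhammer ℂ k).eval (2 * α : ℂ) ^ 2 / 2 ^ k *
        (√Real.pi * (Gamma (α + k / 2 + 1 / 2))⁻¹ ^ 2))) (gSol α v) := by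
  have hd : DifferentiableOn ℂ (gSol α) (Metric.ball 1 1) := fun w hw => by
    have hw' : ‖w - 1‖ < 1 := by simpa [dist_eq_norm] using hw
    exact (hasDerivAt_gSol α
      (norm_lt_two_of_norm_sub_one_lt hw')).differentiableAt.differentiableWithinAt
  refine hasSum_of_eq (hasSum_taylorSeries_on_ball hd hv) fun k => ?_
  rw [iteratedDeriv_gSol _ _ _ (Metric.mem_ball_self one_pos), smul_eq_mul, smul_eq_mul]
  have := gSol_one (α + k / 2)
  push_cast at this
  rw [this]
  ring

theorem one_half_ne_neg_nat (k : ℕ) : (1 / 2 : ℂ) ≠ -k := by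
  intro h
  have := congrArg re h
  norm_num at this
  have h2 : (0 : ℝ) ≤ k := k.cast_nonneg
  linarith

theorem three_half_ne_neg_nat (k : ℕ) : (3 / 2 : ℂ) ≠ -k := by
  intro h
  have := congrArg re h
  norm_num at this
  have h2 : (0 : ℝ) ≤ k := k.cast_nonneg
  linarith

theorem hasSum_ordinaryHypergeometric (a : ℂ) {c : ℂ} (hc : ∀ k : ℕ, c ≠ -k) {z : ℂ}
    (hz : ‖z‖ < 1) :
    HasSum (fun k : ℕ => (ascPochhammer ℂ k).eval a ^ 2 /
      (k.factorial * (ascPochhammer ℂ k).eval c) * z ^ k) (₂F₁ a a c z) := by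
  rw [ordinaryHypergeometric_eq a hc]
  refine hasSum_of_eq ((hasSum_regF a c hz).mul_left (Gamma c)) fun k => ?_
  rw [regCoeff, ← Gamma_add_nat_div_Gamma_eq c hc]
  have := Gamma_ne_zero hc
  field_simp

theorem factorial_two_mul (j : ℕ) :
    ((2 * j).factorial : ℂ) = 4 ^ j * j.factorial * (ascPochhammer ℂ j).eval (1 / 2 : ℂ) := by
  induction j with
  | zero => simp
  | succ j ih =>
    rw [show 2 * (j + 1) = 2 * j + 1 + 1 by ring, Nat.factorial_succ, Nat.factorial_succ,
      Nat.factorial_succ, ascPochhammer_succ_eval]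
    push_cast
    rw [ih]
    ring

theorem factorial_two_mul_add_one (j : ℕ) :
    ((2 * j + 1).factorial : ℂ) =
      4 ^ j * j.factorial * (ascPochhammer ℂ j).eval (3 / 2 : ℂ) := by
  induction j with
  | zero => simp
  | succ j ih =>
    rw [show 2 * (j + 1) + 1 = 2 * j + 1 + 1 + 1 by ring, Nat.factorial_succ, Nat.factorial_succ,
      Nat.factorial_succ j, ascPochhammer_succ_eval]
    push_cast
    rw [ih]
    ring

theorem inv_Gamma_sub_nat (s : ℂ) (j : ℕ) :
    (Gamma (s - j))⁻¹ = (-1) ^ j * (ascPochhammer ℂ j).eval (1 - s) * (Gamma s)⁻¹ := by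
  induction j with
  | zero => simp
  | succ j ih =>
    rw [inv_Gamma_eq, show s - (j + 1 : ℕ) + 1 = s - j by push_cast; ring, ih,
      ascPochhammer_succ_eval, pow_succ]
    push_cast
    ring

theorem inv_Gamma_eq_ascPochhammer (s : ℂ) (j : ℕ) :
    (Gamma s)⁻¹ = (ascPochhammer ℂ j).eval s * (Gamma (s + j))⁻¹ := by
  induction j with
  | zero => simp
  | succ j ih =>
    rw [ih, inv_Gamma_eq (s + j), ascPochhammer_succ_eval]
    push_cast
    rw [show s + (j + 1 : ℂ) = s + j + 1 by ring]
    ring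

theorem ascPochhammer_two_mul (a : ℂ) (j : ℕ) :
    (ascPochhammer ℂ (2 * j)).eval (2 * a) =
      4 ^ j * (ascPochhammer ℂ j).eval a * (ascPochhammer ℂ j).eval (a + 1 / 2) := by
  induction j with
  | zero => simp
  | succ j ih =>
    rw [show 2 * (j + 1) = 2 * j + 1 + 1 by ring, ascPochhammer_succ_eval, ascPochhammer_succ_eval,
      ih, ascPochhammer_succ_eval, ascPochhammer_succ_eval]
    push_cast
    ring

theorem norm_sq_lt_one {v : ℂ} (hv : v ∈ Metric.ball (1 : ℂ) 1) : ‖(1 - v) ^ 2‖ < 1 := by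
  have hv' : ‖1 - v‖ < 1 := by simpa [dist_eq_norm, norm_sub_rev] using hv
  rw [norm_pow]
  exact pow_lt_one₀ (norm_nonneg _) hv' two_ne_zero

theorem hasSum_f₄ (α : ℝ) {v : ℂ} (hv : v ∈ Metric.ball (1 : ℂ) 1) :
    HasSum (fun j : ℕ => ((2 * j).factorial : ℂ)⁻¹ * 4 ^ j *
      (ascPochhammer ℂ j).eval (α : ℂ) ^ 2 * (v - 1) ^ (2 * j)) (f₄ α v) := by
  refine hasSum_of_eq (hasSum_ordinaryHypergeometric α one_half_ne_neg_nat (norm_sq_lt_one hv))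
    fun j => ?_
  have h : (ascPochhammer ℂ j).eval (1 / 2 : ℂ) ≠ 0 := fun h => by
    have := factorial_two_mul j
    rw [h, mul_zero] at this
    exact Nat.cast_ne_zero.2 (Nat.factorial_ne_zero _) this
  rw [factorial_two_mul, ← pow_mul, pow_mul (v - 1), sub_sq_comm v 1, ← pow_mul]
  have : (j.factorial : ℂ) ≠ 0 := Nat.cast_ne_zero.2 (Nat.factorial_ne_zero _)
  field_simp

theorem hasSum_f₃ (α : ℝ) {v : ℂ} (hv : v ∈ Metric.ball (1 : ℂ) 1) :
    HasSum (fun j : ℕ => ((2 * j + 1).factorial : ℂ)⁻¹ * (2 * 4 ^ j) *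
      (ascPochhammer ℂ j).eval ((α : ℂ) + 1 / 2) ^ 2 * (v - 1) ^ (2 * j + 1)) (f₃ α v) := by
  refine hasSum_of_eq ((hasSum_ordinaryHypergeometric (α + 1 / 2) three_half_ne_neg_nat
    (norm_sq_lt_one hv)).mul_left _) fun j => ?_
  have h : (ascPochhammer ℂ j).eval (3 / 2 : ℂ) ≠ 0 := fun h => by
    have := factorial_two_mul_add_one j
    rw [h, mul_zero] at this
    exact Nat.cast_ne_zero.2 (Nat.factorial_ne_zero _) this
  rw [factorial_two_mul_add_one, ← pow_mul, pow_succ (v - 1), pow_mul (v - 1), sub_sq_comm v 1,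
    ← pow_mul]
  have : (j.factorial : ℂ) ≠ 0 := Nat.cast_ne_zero.2 (Nat.factorial_ne_zero _)
  field_simp
  ring

/-- In the Taylor series at `v = 1`, the even index `2j` carries `1/Γ(1 - α - j)` and the odd index
`2j + 1` carries `1/Γ(1/2 - α - j)`. Pulling out the shift `j` leaves Pochhammer symbols that match
the coefficients of `f₄` and `f₃`. -/
theorem hSol_eq (α : ℝ) {v : ℂ} (hv : v ∈ Metric.ball (1 : ℂ) 1) :
    hSol α v = √Real.pi * ((Gamma (1 / 2 - α))⁻¹ ^ 2 * f₃ α v +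
      (Gamma (1 - α))⁻¹ ^ 2 * f₄ α v) := by
  have h := HasSum.even_add_odd
    (f := fun k : ℕ => ((k.factorial : ℂ)⁻¹ * (v - 1) ^ k) *
      (2 ^ k * (√Real.pi * (Gamma (1 - (α + k / 2)))⁻¹ ^ 2)))
    (hasSum_of_eq ((hasSum_f₄ α hv).mul_left (√Real.pi * (Gamma (1 - α))⁻¹ ^ 2 : ℂ)) fun j => by
      rw [show 1 - ((α : ℂ) + (2 * j : ℕ) / 2) = 1 - α - j by push_cast; ring,
        inv_Gamma_sub_nat, sub_sub_cancel, mul_pow, mul_pow, ← pow_mul (-1 : ℂ), mul_comm j,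
        pow_mul (-1 : ℂ), neg_one_sq, one_pow, pow_mul (2 : ℂ)]
      norm_num
      ring)
    (hasSum_of_eq ((hasSum_f₃ α hv).mul_left (√Real.pi * (Gamma (1 / 2 - α))⁻¹ ^ 2 : ℂ))
      fun j => by
      rw [show 1 - ((α : ℂ) + (2 * j + 1 : ℕ) / 2) = 1 / 2 - α - j by push_cast; ring,
        inv_Gamma_sub_nat, show (1 : ℂ) - (1 / 2 - α) = α + 1 / 2 by ring, mul_pow, mul_pow,
        ← pow_mul (-1 : ℂ), mul_comm j,
        pow_mul (-1 : ℂ), neg_one_sq, one_pow, pow_succ (2 : ℂ), pow_mul (2 : ℂ)]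
      norm_num
      ring)
  rw [(hasSum_hSol α hv).unique h]
  ring

/-- The even-odd splitting is the same, but here `(2α)_k` is split by the duplication formula and
one of its two halves absorbs the shift of the Gamma factor. -/
theorem gSol_eq (α : ℝ) {v : ℂ} (hv : v ∈ Metric.ball (1 : ℂ) 1) :
    gSol α v = √Real.pi * ((Gamma α)⁻¹ ^ 2 * f₃ α v +
      (Gamma (1 / 2 + α))⁻¹ ^ 2 * f₄ α v) := by
  have h := HasSum.even_add_odd
    (f := fun k : ℕ => ((k.factorial : ℂ)⁻¹ * (v - 1) ^ k) *
      ((ascPochhammer ℂ k).eval (2 * α : ℂ) ^ 2 / 2 ^ k *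
        (√Real.pi * (Gamma (α + k / 2 + 1 / 2))⁻¹ ^ 2)))
    (hasSum_of_eq ((hasSum_f₄ α hv).mul_left (√Real.pi * (Gamma (1 / 2 + α))⁻¹ ^ 2 : ℂ))
      fun j => by
      rw [show (α : ℂ) + (2 * j : ℕ) / 2 + 1 / 2 = 1 / 2 + α + j by push_cast; ring,
        ascPochhammer_two_mul, inv_Gamma_eq_ascPochhammer (1 / 2 + α) j, pow_mul (2 : ℂ),
        add_comm (α : ℂ) (1 / 2)]
      norm_num
      field_simp)
    (hasSum_of_eq ((hasSum_f₃ α hv).mul_left (√Real.pi * (Gamma α)⁻¹ ^ 2 : ℂ))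
      fun j => by
      rw [show (α : ℂ) + (2 * j + 1 : ℕ) / 2 + 1 / 2 = α + (j + 1 : ℕ) by push_cast; ring,
        ascPochhammer_succ_eval, ascPochhammer_two_mul, inv_Gamma_eq_ascPochhammer α (j + 1),
        ascPochhammer_succ_eval, pow_succ (2 : ℂ), pow_mul (2 : ℂ)]
      push_cast
      norm_num
      field_simp)
  rw [(hasSum_gSol α hv).unique h]
  ring

theorem f₁_eq {α : ℝ} (hα : ∀ k : ℤ, 4 * α ≠ 2 * k + 1) (v : ℂ) :
    f₁ α v = Gamma (1 / 2 - 2 * α) * hSol α v := by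
  have h0 : (1 / 2 - 2 * (α : ℂ)) ≠ 0 := fun h => hα 0 (by
    have : ((4 * α : ℝ) : ℂ) = ((2 * (0 : ℤ) + 1 : ℝ) : ℂ) := by
      push_cast; linear_combination (-2 : ℂ) * h
    exact_mod_cast this)
  have hc : ∀ k : ℕ, 3 / 2 - 2 * (α : ℂ) ≠ -k := fun k h => hα (k + 1) (by
    have : ((4 * α : ℝ) : ℂ) = ((2 * ((k : ℤ) + 1 : ℤ) + 1 : ℝ) : ℂ) := by
      push_cast; linear_combination (-2 : ℂ) * h
    exact_mod_cast this)
  rw [f₁, ordinaryHypergeometric_eq _ hc, hSol,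
    show 3 / 2 - 2 * (α : ℂ) = 1 / 2 - 2 * α + 1 by ring, Gamma_add_one _ h0,
    show 1 - 4 * (α : ℂ) = 2 * (1 / 2 - 2 * α) by ring]
  generalize 1 / 2 - 2 * (α : ℂ) = w at *
  field_simp

theorem f₂_eq {α : ℝ} (hα : ∀ k : ℤ, 4 * α ≠ 2 * k + 1) (v : ℂ) :
    f₂ α v = Gamma (1 / 2 + 2 * α) * gSol α v := by
  have hc : ∀ k : ℕ, 2 * (α : ℂ) + 1 / 2 ≠ -k := fun k h => hα (-k - 1) (by
    have : ((4 * α : ℝ) : ℂ) = ((2 * (-(k : ℤ) - 1 : ℤ) + 1 : ℝ) : ℂ) := by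
      push_cast; linear_combination (2 : ℂ) * h
    exact_mod_cast this)
  rw [f₂, ordinaryHypergeometric_eq _ hc, gSol, add_comm (1 / 2 : ℂ)]

/-- By reflection the three Gamma products are `π / cos 2πα`, `π / cos πα` and `π / sin πα`, so the
determinant is `(cos² πα - sin² πα) / cos 2πα`. The excluded values of `α` are the zeros of `cos
2πα`. -/
theorem connectionMatrix_det {α : ℝ} (hα : ∀ k : ℤ, 4 * α ≠ 2 * k + 1) :
    (connectionMatrix α).det = 1 := by
  have hcos : Real.cos (2 * (Real.pi * α)) ≠ 0 := by
    intro h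
    obtain ⟨k, hk⟩ := Real.cos_eq_zero_iff.1 h
    refine hα k ?_
    have : Real.pi * (4 * α) = Real.pi * (2 * k + 1) := by linarith
    exact mul_left_cancel₀ Real.pi_ne_zero this
  have e1 := Real.Gamma_mul_Gamma_one_sub (1 / 2 - 2 * α)
  rw [show 1 - (1 / 2 - 2 * α) = 1 / 2 + 2 * α by ring,
    show Real.pi * (1 / 2 - 2 * α) = Real.pi / 2 - 2 * (Real.pi * α) by ring,
    Real.sin_pi_div_two_sub] at e1
  have e2 := Real.Gamma_mul_Gamma_one_sub (1 / 2 - α)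
  rw [show 1 - (1 / 2 - α) = 1 / 2 + α by ring,
    show Real.pi * (1 / 2 - α) = Real.pi / 2 - Real.pi * α by ring,
    Real.sin_pi_div_two_sub] at e2
  have e3 := Real.Gamma_mul_Gamma_one_sub α
  have e4 := Real.Gamma_one_half_eq
  rw [connectionMatrix, Matrix.det_fin_two_of, e4]
  have hpi : √Real.pi * √Real.pi = Real.pi := Real.mul_self_sqrt Real.pi_pos.le
  calc _ = √Real.pi * √Real.pi * (Real.Gamma (1 / 2 - 2 * α) * Real.Gamma (1 / 2 + 2 * α)) *
        ((Real.Gamma (1 / 2 - α) * Real.Gamma (1 / 2 + α))⁻¹ ^ 2 -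
          (Real.Gamma α * Real.Gamma (1 - α))⁻¹ ^ 2) := by
        simp only [div_eq_mul_inv, mul_inv]; ring
    _ = 1 := by
        rw [e1, e2, e3, hpi, inv_div, inv_div]
        rw [Real.cos_two_mul'] at hcos ⊢
        have := Real.pi_ne_zero
        field_simp

theorem connection_formula {α : ℝ} (hα : ∀ k : ℤ, 4 * α ≠ 2 * k + 1) {v : ℂ}
    (hv : v ∈ Metric.ball (1 : ℂ) 1) :
    ![f₁ α v, f₂ α v] =
      ((connectionMatrix α).map Complex.ofReal).mulVec ![f₃ α v, f₄ α v] := by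
  have e4 := Real.Gamma_one_half_eq
  rw [f₁_eq hα, f₂_eq hα, hSol_eq α hv, gSol_eq α hv, connectionMatrix, e4]
  ext i
  fin_cases i
  · simp [Matrix.mulVec, dotProduct, Fin.sum_univ_two, ← Gamma_ofReal]
    ring
  · simp [Matrix.mulVec, dotProduct, Fin.sum_univ_two, ← Gamma_ofReal]
    ring

end SeibergWitten

namespace SeibergWitten

open Complex Set MeasureTheory Filter Topology

/-! ### Integrals depending holomorphically on a parameter -/

/-- For holomorphic integrands a local bound is enough: Cauchy's estimate on circles of half the
radius bounds the derivative, so dominated convergence applies. -/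
theorem hasDerivAt_integral_of_locally_bounded {D : Set ℂ} (hD : IsOpen D) {F : ℂ → ℝ → ℂ}
    {a b : ℝ} (hab : a ≤ b) (hdiff : ∀ t ∈ Ioo a b, DifferentiableOn ℂ (fun τ => F τ t) D)
    (hcont : ∀ τ ∈ D, ContinuousOn (F τ) (Ioo a b))
    (hbd : ∀ τ₀ ∈ D, ∃ B, ∀ᶠ τ in 𝓝 τ₀, ∀ t ∈ Ioo a b, ‖F τ t‖ ≤ B) {τ₀ : ℂ} (hτ : τ₀ ∈ D) :
    HasDerivAt (fun τ => ∫ t in a..b, F τ t) (∫ t in a..b, deriv (fun τ => F τ t) τ₀) τ₀ := by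
  obtain ⟨B, hB⟩ := hbd τ₀ hτ
  obtain ⟨r, hr, hball⟩ := Metric.mem_nhds_iff.1 (inter_mem (hD.mem_nhds hτ) hB)
  have hr2 : 0 < r / 2 := half_pos hr
  have hmeas : ∀ τ ∈ D, AEStronglyMeasurable (F τ) (volume.restrict (Ioo a b)) :=
    fun τ h => (hcont τ h).aestronglyMeasurable measurableSet_Ioo
  have hderiv : ∀ t ∈ Ioo a b, ∀ τ ∈ D, HasDerivAt (fun τ => F τ t)
      (deriv (fun τ => F τ t) τ) τ := fun t ht τ h =>
    ((hdiff t ht).differentiableAt (hD.mem_nhds h)).hasDerivAt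
  simp only [intervalIntegral.integral_of_le hab, integral_Ioc_eq_integral_Ioo]
  refine (hasDerivAt_integral_of_dominated_loc_of_deriv_le (μ := volume.restrict (Ioo a b))
    (F' := fun τ t => deriv (fun τ => F τ t) τ) (bound := fun _ => B / (r / 2))
    (Metric.ball_mem_nhds τ₀ hr2) ?_ ?_ ?_ ?_ ?_ ?_).2
  · filter_upwards [hD.mem_nhds hτ] with τ h using hmeas τ h
  · refine Integrable.of_bound (hmeas _ hτ) B ?_
    exact (ae_restrict_iff' measurableSet_Ioo).2 (Eventually.of_forall fun t ht =>
      (hball (Metric.mem_ball_self hr)).2 t ht)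
  -- The derivative is measurable in `t` as the limit of difference quotients along real increments
  -- tending to zero.
  · have hx : ∀ n : ℕ, τ₀ + ((r / 2 * (1 / 2) ^ n : ℝ) : ℂ) ∈ Metric.ball τ₀ r := fun n => by
      rw [Metric.mem_ball, dist_eq_norm, add_sub_cancel_left, norm_real, Real.norm_of_nonneg
        (by positivity)]
      have : (1 / 2 : ℝ) ^ n ≤ 1 := pow_le_one₀ (by norm_num) (by norm_num)
      nlinarith
    refine aestronglyMeasurable_of_tendsto_ae atTop (f := fun (n : ℕ) t =>
      ((r / 2 * (1 / 2) ^ n : ℝ) : ℂ)⁻¹ • (F (τ₀ + ((r / 2 * (1 / 2) ^ n : ℝ) : ℂ)) t - F τ₀ t))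
      (fun n => ?_) ?_
    · exact (((hmeas _ (hball (hx n)).1).sub (hmeas _ hτ)).const_smul
        (((r / 2 * (1 / 2) ^ n : ℝ) : ℂ)⁻¹))
    · refine (ae_restrict_iff' measurableSet_Ioo).2 (Eventually.of_forall fun t ht => ?_)
      refine (hasDerivAt_iff_tendsto_slope_zero.1 (hderiv t ht τ₀ hτ)).comp ?_
      refine tendsto_nhdsWithin_iff.2 ⟨?_, Eventually.of_forall fun n => ?_⟩
      · have : Tendsto (fun n : ℕ => r / 2 * (1 / 2 : ℝ) ^ n) atTop (𝓝 (r / 2 * 0)) :=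
          (tendsto_pow_atTop_nhds_zero_of_lt_one (by norm_num) (by norm_num)).const_mul _
        rw [mul_zero] at this
        exact_mod_cast (continuous_ofReal.tendsto 0).comp this
      · simp only [mem_compl_iff, mem_singleton_iff, ofReal_eq_zero]
        positivity
  · refine (ae_restrict_iff' measurableSet_Ioo).2 (Eventually.of_forall fun t ht τ h => ?_)
    have hsub : Metric.closedBall τ (r / 2) ⊆ Metric.ball τ₀ r := fun x hx => by
      have h1 := Metric.mem_ball.1 h
      have h2 := Metric.mem_closedBall.1 hx
      have h3 := dist_triangle x τ τ₀
      rw [Metric.mem_ball]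
      linarith
    refine Complex.norm_deriv_le_of_forall_mem_sphere_norm_le hr2 ?_ fun x hx =>
      (hball (hsub (Metric.sphere_subset_closedBall hx))).2 t ht
    refine DifferentiableOn.diffContOnCl ?_
    rw [closure_ball _ hr2.ne']
    exact (hdiff t ht).mono fun x hx => (hball (hsub hx)).1
  · exact integrable_const _
  · refine (ae_restrict_iff' measurableSet_Ioo).2 (Eventually.of_forall fun t ht τ h => ?_)
    exact hderiv t ht τ (hball (Metric.ball_subset_ball (by linarith) h)).1

theorem differentiableOn_integral_of_locally_bounded {D : Set ℂ} (hD : IsOpen D)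
    {F : ℂ → ℝ → ℂ} {a b : ℝ} (hab : a ≤ b)
    (hdiff : ∀ t ∈ Ioo a b, DifferentiableOn ℂ (fun τ => F τ t) D)
    (hcont : ∀ τ ∈ D, ContinuousOn (F τ) (Ioo a b))
    (hbd : ∀ τ₀ ∈ D, ∃ B, ∀ᶠ τ in 𝓝 τ₀, ∀ t ∈ Ioo a b, ‖F τ t‖ ≤ B) :
    DifferentiableOn ℂ (fun τ => ∫ t in a..b, F τ t) D := fun _ h =>
  (hasDerivAt_integral_of_locally_bounded hD hab hdiff hcont
    hbd h).differentiableAt.differentiableWithinAt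

/-! ### The small branch point in the rescaled coordinate -/

/-- `∑ a_n z ^ n`. -/
noncomputable def perturb {N : ℕ} (a : Fin (N - 2) → ℂ) (z : ℂ) : ℂ := ∑ i, a i * z ^ (i.val + 1)

/-- `1 + z ^ N - ∑ a_n z ^ n`. -/
noncomputable def scaledPoly {N : ℕ} (a : Fin (N - 2) → ℂ) (z : ℂ) : ℂ := 1 + z ^ N - perturb a z

/-- The derivative of `perturb`. -/
noncomputable def perturb' {N : ℕ} (a : Fin (N - 2) → ℂ) (z : ℂ) : ℂ :=
  ∑ i, a i * ((i.val + 1 : ℕ) * z ^ i.val)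

theorem hasDerivAt_perturb {N : ℕ} (a : Fin (N - 2) → ℂ) (z : ℂ) :
    HasDerivAt (perturb a) (perturb' a z) z := by
  unfold perturb perturb'
  refine HasDerivAt.fun_sum fun i _ => ?_
  simpa using (hasDerivAt_pow (i.val + 1) z).const_mul (a i)

theorem hasDerivAt_scaledPoly {N : ℕ} (a : Fin (N - 2) → ℂ) (z : ℂ) :
    HasDerivAt (scaledPoly a) (N * z ^ (N - 1) - perturb' a z) z :=
  ((hasDerivAt_pow N z).const_add 1).sub (hasDerivAt_perturb a z)

theorem norm_sum_le_of_lt {N : ℕ} {a : Fin (N - 2) → ℂ} {δ : ℝ} (ha : ∀ i, ‖a i‖ < δ)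
    {f : Fin (N - 2) → ℂ} {B : ℝ} (hf : ∀ i, ‖f i‖ ≤ B) (hδ : 0 ≤ δ) (hB : 0 ≤ B) :
    ∑ i, ‖a i‖ * ‖f i‖ ≤ δ * (N * B) := by
  have hN : ((N - 2 : ℕ) : ℝ) ≤ N := by exact_mod_cast Nat.sub_le _ _
  have := Finset.sum_le_card_nsmul (Finset.univ : Finset (Fin (N - 2)))
    (fun i => ‖a i‖ * ‖f i‖) (δ * B) (fun i _ =>
      mul_le_mul (ha i).le (hf i) (norm_nonneg _) hδ)
  rw [Finset.card_univ, Fintype.card_fin, nsmul_eq_mul] at this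
  refine this.trans ?_
  rw [mul_left_comm]
  gcongr

theorem norm_perturb_le {N : ℕ} {a : Fin (N - 2) → ℂ} {δ : ℝ} (ha : ∀ i, ‖a i‖ < δ)
    (hδ : 0 ≤ δ) {z : ℂ} (hz : ‖z‖ ≤ 2) :
    ∑ i, ‖a i‖ * ‖z‖ ^ (i.val + 1) ≤ δ * (N * 2 ^ N) := by
  simp only [← norm_pow]
  refine norm_sum_le_of_lt ha (fun i => ?_) hδ (by positivity)
  rw [norm_pow]
  calc ‖z‖ ^ (i.val + 1) ≤ 2 ^ (i.val + 1) := by gcongr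
    _ ≤ 2 ^ N := pow_le_pow_right₀ one_le_two (by have := i.2; omega)

theorem norm_perturb_le_sum {N : ℕ} (a : Fin (N - 2) → ℂ) (z : ℂ) :
    ‖perturb a z‖ ≤ ∑ i, ‖a i‖ * ‖z‖ ^ (i.val + 1) := by
  refine (norm_sum_le _ _).trans (le_of_eq ?_)
  simp

theorem norm_perturb'_le {N : ℕ} {a : Fin (N - 2) → ℂ} {δ : ℝ} (ha : ∀ i, ‖a i‖ < δ)
    (hδ : 0 ≤ δ) {z : ℂ} (hz : ‖z‖ ≤ 2) : ‖perturb' a z‖ ≤ δ * (N * (N * 2 ^ N)) := by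
  refine (norm_sum_le _ _).trans ?_
  simp only [norm_mul (a _)]
  refine norm_sum_le_of_lt ha (fun i => ?_) hδ (by positivity)
  have hi := i.2
  rw [norm_mul, norm_pow, norm_natCast]
  have h1 : ‖z‖ ^ i.val ≤ 2 ^ N :=
    calc ‖z‖ ^ i.val ≤ 2 ^ i.val := by gcongr
      _ ≤ 2 ^ N := pow_le_pow_right₀ one_le_two (by omega)
  have h2 : ((i.val + 1 : ℕ) : ℝ) ≤ N := by exact_mod_cast (by omega)
  exact mul_le_mul h2 h1 (by positivity) (by positivity)

theorem norm_eq_one_of_pow_eq_neg_one {N : ℕ} (hN : N ≠ 0) {ζ : ℂ} (hζ : ζ ^ N = -1) :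
    ‖ζ‖ = 1 := by
  have : ‖ζ‖ ^ N = 1 := by rw [← norm_pow, hζ, norm_neg, norm_one]
  exact (pow_eq_one_iff_of_nonneg (norm_nonneg _) hN).1 this

theorem re_one_add_pow_pos {N : ℕ} (hN : 2 ≤ N) {w : ℂ} (hw : ‖w‖ ≤ 1 / N) :
    0 < ((1 + w) ^ (N - 1)).re := by
  have hN2 : (2 : ℝ) ≤ N := by exact_mod_cast hN
  have hN0 : (0 : ℝ) < N := by linarith
  have hw1 : ‖w‖ ≤ 1 / 2 := hw.trans (by gcongr)
  have hre : 0 < (1 + w).re := by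
    have := (abs_le.1 (abs_re_le_norm w)).1
    simp only [add_re, one_re]
    linarith
  set x : ℂ := 1 + w with hx
  have hx0 : 0 < ‖x‖ := norm_pos_iff.2 fun h => by rw [h] at hre; simp at hre
  have harg : |arg x| < Real.pi / 2 := abs_arg_lt_pi_div_two_iff.2 (Or.inl hre)
  have him : |x.im| ≤ ‖w‖ * ‖x‖ := by
    refine abs_le_of_sq_le_sq ?_ (by positivity)
    rw [mul_pow, Complex.sq_norm, Complex.sq_norm, normSq_apply, normSq_apply, hx]
    simp only [add_re, add_im, one_re, one_im]
    nlinarith [sq_nonneg (w.im * w.im + w.re * (1 + w.re))]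
  have hsin : Real.sin |arg x| ≤ 1 / N := by
    have h1 : |Real.sin (arg x)| ≤ 1 / N := by
      rw [sin_arg, abs_div, abs_of_pos hx0, div_le_iff₀ hx0]
      exact him.trans (by gcongr)
    have h2 : Real.sin |arg x| ≤ |Real.sin (arg x)| := by
      rcases abs_cases (arg x) with ⟨h, -⟩ | ⟨h, -⟩
      · rw [h]; exact le_abs_self _
      · rw [h, Real.sin_neg]; exact neg_le_abs _
    exact h2.trans h1
  have h3 := (Real.mul_le_sin (abs_nonneg (arg x)) harg.le).trans hsin
  have h4 : |((N - 1 : ℕ) : ℝ) * arg x| < Real.pi / 2 := by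
    rw [abs_mul, Nat.abs_cast, Nat.cast_sub (by omega)]
    have h5 : |arg x| ≤ Real.pi / (2 * N) := by
      rw [div_mul_eq_mul_div, div_le_iff₀ Real.pi_pos] at h3
      rw [le_div_iff₀ (by positivity)]
      calc |arg x| * (2 * N) = 2 * |arg x| * N := by ring
        _ ≤ 1 / N * Real.pi * N := by gcongr
        _ = Real.pi := by field_simp
    calc ((N : ℝ) - (1 : ℕ)) * |arg x| ≤ ((N : ℝ) - (1 : ℕ)) * (Real.pi / (2 * N)) := by
          gcongr
          push_cast; linarith
      _ < N * (Real.pi / (2 * N)) := by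
          gcongr
          push_cast; linarith
      _ = Real.pi / 2 := by field_simp
  have h6 : x ^ (N - 1) = ((‖x‖ ^ (N - 1) : ℝ) : ℂ) * exp (((N - 1 : ℕ) * arg x : ℝ) * I) := by
    conv_lhs => rw [← norm_mul_exp_arg_mul_I x, mul_pow, ← Complex.exp_nat_mul]
    push_cast
    ring_nf
  rw [h6, re_ofReal_mul, exp_ofReal_mul_I_re]
  exact mul_pos (by positivity) (Real.cos_pos_of_mem_Ioo (abs_lt.1 h4))

/-- This is the Noshiro–Warschawski criterion: along the segment from `x` to `y`, the real part of
`e f` times the conjugate of `y - x` has positive derivative, so it cannot take the same value at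
both ends. -/
theorem injOn_of_re_deriv_pos {f f' : ℂ → ℂ} {s : Set ℂ} (hs : Convex ℝ s) {e : ℂ}
    (hf : ∀ z ∈ s, HasDerivAt f (f' z) z) (hpos : ∀ z ∈ s, 0 < (e * f' z).re) : InjOn f s := by
  intro x hx y hy hxy
  by_contra hne
  have hd0 : y - x ≠ 0 := sub_ne_zero.2 (Ne.symm hne)
  set φ : ℝ → ℝ := fun t => (e * f (x + t * (y - x)) * (starRingEnd ℂ) (y - x)).re with hφ
  have hmem : ∀ t ∈ Icc (0 : ℝ) 1, x + t * (y - x) ∈ s := fun t ht => by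
    have := hs.add_smul_sub_mem hx hy ht
    simpa using this
  have hder : ∀ t ∈ Icc (0 : ℝ) 1, HasDerivAt φ
      ((e * f' (x + t * (y - x))).re * normSq (y - x)) t := fun t ht => by
    have h1 : HasDerivAt (fun t : ℂ => x + t * (y - x)) (y - x) (t : ℂ) := by
      simpa using ((hasDerivAt_id (t : ℂ)).mul_const (y - x)).const_add x
    have h2 := (((hf _ (hmem t ht)).comp (t : ℂ) h1).const_mul e).mul_const
      ((starRingEnd ℂ) (y - x))
    have h3 := h2.real_of_complex
    refine h3.congr_deriv ?_
    rw [mul_assoc, mul_assoc, mul_conj, ← mul_assoc, re_mul_ofReal]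
  obtain ⟨c, hc, hc2⟩ := exists_hasDerivAt_eq_slope φ _ one_pos
    (fun t ht => (hder t ht).continuousAt.continuousWithinAt)
    (fun t ht => hder t (Ioo_subset_Icc_self ht))
  have h0 : φ 1 = φ 0 := by simp [hφ, hxy]
  rw [h0, sub_self, zero_div] at hc2
  exact (mul_pos (hpos _ (hmem c (Ioo_subset_Icc_self hc))) (normSq_pos.2 hd0)).ne' hc2

/-- `zr a` is the only zero of `1 + z ^ N - ∑ a_n z ^ n` in the disc of radius `1 / N` about `ζ`,
whenever `|a_n| < δ`; it depends holomorphically on `a`, and `∑ |a_n| |zr a| ^ n ≤ κ`. -/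
structure IsRootFun (N : ℕ) (ζ : ℂ) (κ δ : ℝ) (zr : (Fin (N - 2) → ℂ) → ℂ) : Prop where
  root : ∀ a, (∀ i, ‖a i‖ < δ) → scaledPoly a (zr a) = 0
  near : ∀ a, (∀ i, ‖a i‖ < δ) → ‖zr a - ζ‖ < 1 / N
  unique : ∀ a, (∀ i, ‖a i‖ < δ) → ∀ z, ‖z - ζ‖ < 1 / N → scaledPoly a z = 0 → z = zr a
  norm_le : ∀ a, (∀ i, ‖a i‖ < δ) → ‖zr a‖ ≤ 2
  sum_le : ∀ a, (∀ i, ‖a i‖ < δ) → ∑ i, ‖a i‖ * ‖zr a‖ ^ (i.val + 1) ≤ κ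
  differentiableOn : ∀ (D : Set ℂ) (a : ℂ → Fin (N - 2) → ℂ), IsOpen D →
    (∀ i, DifferentiableOn ℂ (fun τ => a τ i) D) → (∀ τ ∈ D, ∀ i, ‖a τ i‖ < δ) →
    DifferentiableOn ℂ (fun τ => zr (a τ)) D

/-- Divided by `ζ^(N - 1)`, the derivative of the unperturbed polynomial is `N (1 + w)^(N - 1)` with
`|w| < 1/N`. Its real part has a positive minimum on the closed disc, which survives a small
perturbation. -/
theorem unique_scaledPoly_root {N : ℕ} (hN : 3 ≤ N) {ζ : ℂ} (hζ : ζ ^ N = -1) :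
    ∃ δ > 0, ∀ a : Fin (N - 2) → ℂ, (∀ i, ‖a i‖ < δ) →
      InjOn (scaledPoly a) (Metric.ball ζ (1 / N)) := by
  have hN0 : (0 : ℝ) < N := by exact_mod_cast (by omega)
  have hζ1 := norm_eq_one_of_pow_eq_neg_one (by omega) hζ
  have hζ0 : ζ ≠ 0 := fun h => by rw [h, norm_zero] at hζ1; exact zero_ne_one hζ1
  obtain ⟨w₀, hw₀, hmin⟩ := (isCompact_closedBall (0 : ℂ) (1 / N)).exists_isMinOn
    ⟨0, by simp⟩ (f := fun w : ℂ => ((1 + w) ^ (N - 1)).re) (by fun_prop)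
  set m := ((1 + w₀) ^ (N - 1)).re with hm
  have hm0 : 0 < m := re_one_add_pow_pos (by omega) (by simpa using hw₀)
  -- This value turns the bound of `norm_perturb'_le` into `N m`.
  refine ⟨N * m / (N * (N * 2 ^ N)), by positivity, fun a ha => ?_⟩
  refine injOn_of_re_deriv_pos (e := (ζ ^ (N - 1))⁻¹) (convex_ball ζ (1 / N))
    (fun z _ => hasDerivAt_scaledPoly a z) fun z hz => ?_
  have hz1 : ‖z - ζ‖ < 1 / N := by simpa [dist_eq_norm] using hz
  have hN1 : (1 : ℝ) / N ≤ 1 := by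
    rw [div_le_one hN0]; exact_mod_cast (by omega)
  have hz2 : ‖z‖ ≤ 2 := by
    have := norm_add_le (z - ζ) ζ
    rw [sub_add_cancel, hζ1] at this
    linarith
  have hw : z = ζ * (1 + (z - ζ) / ζ) := by field_simp; ring
  have hwn : ‖(z - ζ) / ζ‖ ≤ 1 / N := by rw [norm_div, hζ1, div_one]; exact hz1.le
  have h1 : m ≤ ((1 + (z - ζ) / ζ) ^ (N - 1)).re := hmin (by simpa using hwn)
  have h2 : (ζ ^ (N - 1))⁻¹ * (N * z ^ (N - 1) - perturb' a z) =
      N * (1 + (z - ζ) / ζ) ^ (N - 1) - (ζ ^ (N - 1))⁻¹ * perturb' a z := by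
    conv_lhs => rw [mul_sub]; enter [1]; rw [hw, mul_pow]
    have : ζ ^ (N - 1) ≠ 0 := pow_ne_zero _ hζ0
    field_simp
  have hlt : ‖perturb' a z‖ < N * m := by
    by_cases hne : Nonempty (Fin (N - 2))
    · obtain ⟨j, hj⟩ := Finite.exists_max fun i => ‖a i‖
      have hpos : (0 : ℝ) < N * (N * 2 ^ N) := by positivity
      obtain ⟨δ', h1, h2⟩ := exists_between (ha j)
      refine lt_of_le_of_lt (norm_perturb'_le (fun i => (hj i).trans_lt h1)
        ((norm_nonneg _).trans h1.le) hz2) ?_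
      rwa [lt_div_iff₀ hpos] at h2
    · rw [not_nonempty_iff] at hne
      simp only [perturb', Finset.univ_eq_empty, Finset.sum_empty, norm_zero]
      positivity
  have h3 : ((ζ ^ (N - 1))⁻¹ * perturb' a z).re ≤ ‖perturb' a z‖ := by
    refine (re_le_norm _).trans (le_of_eq ?_)
    rw [norm_mul, norm_inv, norm_pow, hζ1, one_pow, inv_one, one_mul]
  rw [h2, sub_re, ← ofReal_natCast, re_ofReal_mul]
  have : (N : ℝ) * m ≤ N * ((1 + (z - ζ) / ζ) ^ (N - 1)).re := by gcongr
  linarith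

end SeibergWitten

/-! ### Existence and holomorphy of the small zero by a contraction -/

namespace SeibergWitten

open Complex Set MeasureTheory Filter Topology

/-- One step of the simplified Newton iteration for the zero near `ζ`. -/
noncomputable def newtonStep {N : ℕ} (ζ : ℂ) (a : Fin (N - 2) → ℂ) (z : ℂ) : ℂ :=
  z + ζ / N * scaledPoly a z

/-- The simplified Newton iteration, started at `ζ`. -/
noncomputable def newtonSeq {N : ℕ} (ζ : ℂ) (a : Fin (N - 2) → ℂ) (n : ℕ) : ℂ :=
  (newtonStep ζ a)^[n] ζ

theorem newtonSeq_succ {N : ℕ} (ζ : ℂ) (a : Fin (N - 2) → ℂ) (n : ℕ) :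
    newtonSeq ζ a (n + 1) = newtonStep ζ a (newtonSeq ζ a n) :=
  Function.iterate_succ_apply' _ _ _

/-- Since `ζ^N = -1`, the factor `ζ / N` is `-1 / p'(ζ)` for the unperturbed polynomial. The
unperturbed step therefore has derivative `1 + ζ z^(N - 1)`, which vanishes at `ζ` and is small
nearby. -/
theorem exists_newtonStep_contraction {N : ℕ} (hN : 3 ≤ N) {ζ : ℂ} (hζ : ζ ^ N = -1) :
    ∃ η > 0, η < 1 / (N : ℝ) ∧ ∃ δ > 0, ∀ a : Fin (N - 2) → ℂ, (∀ i, ‖a i‖ < δ) →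
      (∀ x ∈ Metric.closedBall ζ η, ∀ y ∈ Metric.closedBall ζ η,
        ‖newtonStep ζ a x - newtonStep ζ a y‖ ≤ 1 / 2 * ‖x - y‖) ∧
      ‖newtonStep ζ a ζ - ζ‖ ≤ η / 4 := by
  have hN0 : (0 : ℝ) < N := by exact_mod_cast (by omega)
  have hNC : (N : ℂ) ≠ 0 := by exact_mod_cast (by omega)
  have hN1 : (1 : ℝ) / N ≤ 1 := by
    rw [div_le_one hN0]; exact_mod_cast (by omega)
  have hζ1 := norm_eq_one_of_pow_eq_neg_one (by omega) hζ
  have hc : ContinuousAt (fun z : ℂ => 1 + ζ * z ^ (N - 1)) ζ := by fun_prop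
  obtain ⟨η₀, hη₀, hη⟩ := Metric.continuousAt_iff.1 hc (1 / 4) (by norm_num)
  have hζ0 : 1 + ζ * ζ ^ (N - 1) = 0 := by
    rw [← pow_succ', Nat.sub_add_cancel (by omega), hζ]; ring
  set η := min (η₀ / 2) (1 / N / 2) with hηdef
  have hηpos : 0 < η := lt_min (by positivity) (by positivity)
  have hη1 : η < 1 / N := (min_le_right _ _).trans_lt (half_lt_self (by positivity))
  -- The first bound makes the perturbation contribute at most `1/4` to the derivative of the step;
  -- the second makes the first step at most `η / 4`.
  refine ⟨η, hηpos, hη1, min (1 / (4 * (N * 2 ^ N))) (η / (4 * 2 ^ N)),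
    lt_min (by positivity) (by positivity), fun a ha => ⟨fun x hx y hy => ?_, ?_⟩⟩
  · have hder : ∀ z ∈ Metric.closedBall ζ η, HasDerivWithinAt (newtonStep ζ a)
        (1 + ζ / N * (N * z ^ (N - 1) - perturb' a z)) (Metric.closedBall ζ η) z := fun z _ =>
      ((hasDerivAt_id z).add ((hasDerivAt_scaledPoly a z).const_mul (ζ / N))).hasDerivWithinAt
    refine (convex_closedBall ζ η).norm_image_sub_le_of_norm_hasDerivWithin_le hder
      (fun z hz => ?_) hy hx
    have hz0 : ‖z - ζ‖ ≤ η := by simpa [dist_eq_norm] using hz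
    have hz2 : ‖z‖ ≤ 2 := by
      have := norm_add_le (z - ζ) ζ
      rw [sub_add_cancel, hζ1] at this
      linarith
    have h1 : ‖1 + ζ * z ^ (N - 1)‖ ≤ 1 / 4 := by
      have := hη (x := z) (by
        rw [dist_eq_norm]
        exact hz0.trans_lt ((min_le_left _ _).trans_lt (half_lt_self hη₀)))
      rw [dist_eq_norm, hζ0, sub_zero] at this
      exact this.le
    have h2 := norm_perturb'_le (fun i => (ha i).trans_le (min_le_left _ _))
      (by positivity) hz2
    have h3 : ‖ζ / N * perturb' a z‖ ≤ 1 / 4 := by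
      rw [norm_mul, norm_div, hζ1, norm_natCast]
      calc 1 / (N : ℝ) * ‖perturb' a z‖ ≤
          1 / N * (1 / (4 * (N * 2 ^ N)) * (N * (N * 2 ^ N))) := by gcongr
        _ = 1 / 4 := by field_simp
    calc _ = ‖(1 + ζ * z ^ (N - 1)) - ζ / N * perturb' a z‖ := by
          congr 1; field_simp; ring
      _ ≤ _ := norm_sub_le _ _
      _ ≤ 1 / 2 := by linarith
  · have h1 : newtonStep ζ a ζ - ζ = -(ζ / N * perturb a ζ) := by
      rw [newtonStep, scaledPoly, hζ]; ring
    have h2 := (norm_perturb_le_sum a ζ).trans (norm_perturb_le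
      (fun i => (ha i).trans_le (min_le_right _ _)) (by positivity) (by rw [hζ1]; norm_num))
    rw [h1, norm_neg, norm_mul, norm_div, hζ1, norm_natCast]
    calc 1 / (N : ℝ) * ‖perturb a ζ‖ ≤ 1 / N * (η / (4 * 2 ^ N) * (N * 2 ^ N)) := by gcongr
      _ = η / 4 := by field_simp

theorem differentiableOn_newtonSeq {N : ℕ} (ζ : ℂ) {D : Set ℂ} {a : ℂ → Fin (N - 2) → ℂ}
    (ha : ∀ i, DifferentiableOn ℂ (fun τ => a τ i) D) (n : ℕ) :
    DifferentiableOn ℂ (fun τ => newtonSeq ζ (a τ) n) D := by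
  induction n with
  | zero => exact differentiableOn_const _
  | succ n ih =>
    simp only [newtonSeq_succ, newtonStep, scaledPoly, perturb]
    refine ih.add (DifferentiableOn.const_mul (((ih.pow N).const_add 1).sub
      (DifferentiableOn.fun_sum fun i _ => (ha i).mul (ih.pow _))) _)

/-- The zero is the limit of the iteration. Every iterate is holomorphic in the parameters and the
convergence is geometric, uniformly in them, so the limit is holomorphic by Weierstrass. Uniqueness
in the larger disc of radius `1/N` comes from injectivity, not from the contraction. -/
theorem exists_isRootFun {N : ℕ} (hN : 3 ≤ N) {ζ : ℂ} (hζ : ζ ^ N = -1) {κ : ℝ} (hκ : 0 < κ) :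
    ∃ δ > 0, ∃ zr, IsRootFun N ζ κ δ zr := by
  have hN0 : (0 : ℝ) < N := by exact_mod_cast (by omega)
  have hNC : (N : ℂ) ≠ 0 := by exact_mod_cast (by omega)
  have hN1 : (1 : ℝ) / N ≤ 1 := by
    rw [div_le_one hN0]; exact_mod_cast (by omega)
  have hζ1 := norm_eq_one_of_pow_eq_neg_one (by omega) hζ
  have hζ0 : ζ ≠ 0 := fun h => by rw [h, norm_zero] at hζ1; exact zero_ne_one hζ1
  obtain ⟨η, hη, hηN, δ₁, hδ₁, hcontr⟩ := exists_newtonStep_contraction hN hζ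
  obtain ⟨δ₂, hδ₂, hinj⟩ := unique_scaledPoly_root hN hζ
  -- The last entry, combined with `norm_perturb_le`, gives `∑ |a_n| |zr a|^n ≤ κ`.
  set δ := min (min δ₁ δ₂) (κ / (N * 2 ^ N)) with hδdef
  have hδ : 0 < δ := lt_min (lt_min hδ₁ hδ₂) (by positivity)
  have hball : ∀ a : Fin (N - 2) → ℂ, (∀ i, ‖a i‖ < δ) → ∀ n,
      newtonSeq ζ a n ∈ Metric.closedBall ζ η := by
    intro a ha n
    have hc := hcontr a fun i => (ha i).trans_le ((min_le_left _ _).trans (min_le_left _ _))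
    induction n with
    | zero => exact Metric.mem_closedBall_self hη.le
    | succ n ih =>
      have h1 := hc.1 _ ih ζ (Metric.mem_closedBall_self hη.le)
      have h2 : ‖newtonSeq ζ a n - ζ‖ ≤ η := by simpa [dist_eq_norm] using ih
      have h3 := norm_add_le (newtonStep ζ a (newtonSeq ζ a n) - newtonStep ζ a ζ)
        (newtonStep ζ a ζ - ζ)
      rw [sub_add_sub_cancel] at h3
      rw [newtonSeq_succ, Metric.mem_closedBall, dist_eq_norm]
      linarith [hc.2]
  have hgeom : ∀ a : Fin (N - 2) → ℂ, (∀ i, ‖a i‖ < δ) → ∀ n,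
      dist (newtonSeq ζ a n) (newtonSeq ζ a (n + 1)) ≤ η * (1 / 2) ^ n := by
    intro a ha n
    have hc := hcontr a fun i => (ha i).trans_le ((min_le_left _ _).trans (min_le_left _ _))
    induction n with
    | zero =>
      rw [newtonSeq_succ, dist_comm, dist_eq_norm]
      have : newtonSeq ζ a 0 = ζ := rfl
      rw [this]
      linarith [hc.2]
    | succ n ih =>
      have h1 := hc.1 _ (hball a ha n) _ (hball a ha (n + 1))
      rw [← newtonSeq_succ, ← newtonSeq_succ, ← dist_eq_norm, ← dist_eq_norm] at h1
      rw [pow_succ]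
      linarith
  set zr : (Fin (N - 2) → ℂ) → ℂ := fun a => limUnder atTop (newtonSeq ζ a) with hzr
  have hlim : ∀ a : Fin (N - 2) → ℂ, (∀ i, ‖a i‖ < δ) →
      Tendsto (newtonSeq ζ a) atTop (𝓝 (zr a)) := fun a ha =>
    (cauchySeq_of_le_geometric _ _ (by norm_num) (hgeom a ha)).tendsto_limUnder
  have hroot : ∀ a : Fin (N - 2) → ℂ, (∀ i, ‖a i‖ < δ) → scaledPoly a (zr a) = 0 := by
    intro a ha
    have hcont : Continuous (newtonStep ζ a) := by
      unfold newtonStep scaledPoly perturb; fun_prop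
    have h1 := (hcont.tendsto (zr a)).comp (hlim a ha)
    have h2 := (tendsto_add_atTop_iff_nat 1).2 (hlim a ha)
    have h3 : newtonStep ζ a (zr a) = zr a := by
      refine tendsto_nhds_unique (h1.congr fun n => ?_) h2
      rw [newtonSeq_succ]; rfl
    rw [newtonStep] at h3
    have h4 : ζ / N * scaledPoly a (zr a) = 0 := by linear_combination h3
    exact (mul_eq_zero.1 h4).resolve_left (div_ne_zero hζ0 hNC)
  have hnear : ∀ a : Fin (N - 2) → ℂ, (∀ i, ‖a i‖ < δ) → ‖zr a - ζ‖ < 1 / N := by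
    intro a ha
    have := Metric.isClosed_closedBall.mem_of_tendsto (hlim a ha)
      (Eventually.of_forall (hball a ha))
    rw [Metric.mem_closedBall, dist_eq_norm] at this
    exact this.trans_lt hηN
  have hle : ∀ a : Fin (N - 2) → ℂ, (∀ i, ‖a i‖ < δ) → ‖zr a‖ ≤ 2 := by
    intro a ha
    have := norm_add_le (zr a - ζ) ζ
    rw [sub_add_cancel, hζ1] at this
    linarith [hnear a ha]
  refine ⟨δ, hδ, zr, hroot, hnear, fun a ha z hz hz0 => ?_, hle, fun a ha => ?_, ?_⟩
  · refine hinj a (fun i => (ha i).trans_le ((min_le_left _ _).trans (min_le_right _ _)))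
      ?_ ?_ (hz0.trans (hroot a ha).symm)
    · simpa [dist_eq_norm] using hz
    · simpa [dist_eq_norm] using hnear a ha
  · refine (norm_perturb_le (fun i => (ha i).trans_le (min_le_right _ _)) (by positivity)
      (hle a ha)).trans (le_of_eq ?_)
    field_simp
  · intro D a hD hdiff hbound
    refine TendstoLocallyUniformlyOn.differentiableOn (φ := atTop)
      (F := fun n τ => newtonSeq ζ (a τ) n) ?_
      (Eventually.of_forall fun n => differentiableOn_newtonSeq ζ hdiff n) hD
    refine TendstoUniformlyOn.tendstoLocallyUniformlyOn ?_
    rw [Metric.tendstoUniformlyOn_iff]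
    intro ε hε
    have h1 : Tendsto (fun n : ℕ => η * (1 / 2 : ℝ) ^ n / (1 - 1 / 2)) atTop
        (𝓝 (η * 0 / (1 - 1 / 2))) :=
      ((tendsto_pow_atTop_nhds_zero_of_lt_one (by norm_num) (by norm_num)).const_mul _).div_const _
    rw [mul_zero, zero_div] at h1
    filter_upwards [h1.eventually_lt_const hε] with n hn τ hτ
    rw [dist_comm]
    exact (dist_le_of_le_geometric_of_tendsto _ _ (by norm_num) (hgeom _ (hbound τ hτ))
      (hlim _ (hbound τ hτ)) n).trans_lt hn

end SeibergWitten

namespace SeibergWitten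

open Complex Set MeasureTheory Filter Topology

/-! ### The polynomial along the segment from `0` to its zero -/

/-- `z` is a zero of `1 + z ^ N - ∑ a_n z ^ n` and `∑ |a_n| |z| ^ n ≤ κ`. -/
structure Adapted {N : ℕ} (κ : ℝ) (a : Fin (N - 2) → ℂ) (z : ℂ) : Prop where
  root : scaledPoly a z = 0
  sum_le : ∑ i, ‖a i‖ * ‖z‖ ^ (i.val + 1) ≤ κ
  norm_le : ‖z‖ ≤ 2

theorem IsRootFun.adapted {N : ℕ} {ζ : ℂ} {κ δ : ℝ} {zr : (Fin (N - 2) → ℂ) → ℂ}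
    (h : IsRootFun N ζ κ δ zr) {a : Fin (N - 2) → ℂ} (ha : ∀ i, ‖a i‖ < δ) :
    Adapted κ a (zr a) := ⟨h.root a ha, h.sum_le a ha, h.norm_le a ha⟩

namespace Adapted

variable {N : ℕ} {κ : ℝ} {a : Fin (N - 2) → ℂ} {z : ℂ}

/-- Subtracting `t^N p(z) = 0` from `p(tz)` leaves `1 - t^N + ∑ a_n z^n (t^N - t^n)`, and `|t^N -
t^n| ≤ 1 - t^N` because `n < N`. The error is thus proportional to the main term right up to the
zero, which keeps `p` in the right half-plane along the segment. -/
theorem norm_sub_le (h : Adapted κ a z) {t : ℝ} (ht : t ∈ Icc (0 : ℝ) 1) :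
    ‖scaledPoly a (t * z) - ((1 - t ^ N : ℝ) : ℂ)‖ ≤ κ * (1 - t ^ N) := by
  have hroot := h.root
  have htN : t ^ N ≤ 1 := pow_le_one₀ ht.1 ht.2
  have e : scaledPoly a (t * z) - ((1 - t ^ N : ℝ) : ℂ) =
      ∑ i : Fin (N - 2), a i * z ^ (i.val + 1) * ((t ^ N - t ^ (i.val + 1) : ℝ) : ℂ) := by
    have h1 : ∑ i : Fin (N - 2), a i * z ^ (i.val + 1) * ((t ^ N - t ^ (i.val + 1) : ℝ) : ℂ) =
        t ^ N * perturb a z - perturb a (t * z) := by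
      rw [perturb, perturb, Finset.mul_sum, ← Finset.sum_sub_distrib]
      refine Finset.sum_congr rfl fun i _ => ?_
      push_cast
      ring
    rw [h1, scaledPoly]
    rw [scaledPoly] at hroot
    push_cast
    linear_combination (t : ℂ) ^ N * hroot
  rw [e]
  refine (norm_sum_le _ _).trans ?_
  calc ∑ i : Fin (N - 2), ‖a i * z ^ (i.val + 1) * ((t ^ N - t ^ (i.val + 1) : ℝ) : ℂ)‖
      ≤ ∑ i : Fin (N - 2), ‖a i‖ * ‖z‖ ^ (i.val + 1) * (1 - t ^ N) := by
        refine Finset.sum_le_sum fun i _ => ?_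
        rw [norm_mul, norm_mul, norm_pow, norm_real]
        gcongr
        have h1 : t ^ N ≤ t ^ (i.val + 1) :=
          pow_le_pow_of_le_one ht.1 ht.2 (by have := i.2; omega)
        have h2 : t ^ (i.val + 1) ≤ 1 := pow_le_one₀ ht.1 ht.2
        rw [Real.norm_eq_abs, abs_le]
        constructor <;> linarith
    _ = (∑ i : Fin (N - 2), ‖a i‖ * ‖z‖ ^ (i.val + 1)) * (1 - t ^ N) := by
        rw [Finset.sum_mul]
    _ ≤ κ * (1 - t ^ N) := by
        exact mul_le_mul_of_nonneg_right h.sum_le (by linarith)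

theorem norm_le_ray (h : Adapted κ a z) (hκ : 0 ≤ κ) {t : ℝ} (ht : t ∈ Icc (0 : ℝ) 1) :
    ‖scaledPoly a (t * z)‖ ≤ 1 + κ := by
  have htN : t ^ N ≤ 1 := pow_le_one₀ ht.1 ht.2
  have htN0 : 0 ≤ t ^ N := pow_nonneg ht.1 _
  have h1 := norm_add_le (scaledPoly a (t * z) - ((1 - t ^ N : ℝ) : ℂ)) ((1 - t ^ N : ℝ) : ℂ)
  rw [sub_add_cancel, norm_real, Real.norm_of_nonneg (by linarith)] at h1
  nlinarith [h.norm_sub_le ht]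

theorem re_ge (h : Adapted κ a z) {t : ℝ} (ht : t ∈ Icc (0 : ℝ) 1) :
    (1 - κ) * (1 - t ^ N) ≤ (scaledPoly a (t * z)).re := by
  have h1 := (abs_le.1 ((abs_re_le_norm _).trans (h.norm_sub_le ht))).1
  rw [sub_re, ofReal_re] at h1
  linarith

theorem re_nonneg (h : Adapted κ a z) (hκ : κ ≤ 1 / 2) {t : ℝ} (ht : t ∈ Icc (0 : ℝ) 1) :
    0 ≤ (scaledPoly a (t * z)).re := by
  have htN : t ^ N ≤ 1 := pow_le_one₀ ht.1 ht.2
  refine le_trans ?_ (h.re_ge ht)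
  exact mul_nonneg (by linarith) (by linarith)

theorem re_pos (h : Adapted κ a z) (hN : N ≠ 0) (hκ : κ ≤ 1 / 2) {t : ℝ}
    (ht : t ∈ Ico (0 : ℝ) 1) : 0 < (scaledPoly a (t * z)).re := by
  have htN : t ^ N < 1 := pow_lt_one₀ ht.1 ht.2 hN
  refine lt_of_lt_of_le ?_ (h.re_ge (Ico_subset_Icc_self ht))
  exact mul_pos (by linarith) (by linarith)

theorem mem_slitPlane (h : Adapted κ a z) (hN : N ≠ 0) (hκ : κ ≤ 1 / 2) {t : ℝ}
    (ht : t ∈ Ico (0 : ℝ) 1) : scaledPoly a (t * z) ∈ slitPlane :=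
  mem_slitPlane_iff.2 (Or.inl (h.re_pos hN hκ ht))

end Adapted

theorem continuous_scaledPoly {N : ℕ} (a : Fin (N - 2) → ℂ) : Continuous (scaledPoly a) := by
  unfold scaledPoly perturb; fun_prop

theorem continuous_scaledPoly_ray {N : ℕ} (a : Fin (N - 2) → ℂ) (z : ℂ) :
    Continuous fun t : ℝ => scaledPoly a (t * z) :=
  (continuous_scaledPoly a).comp (by fun_prop)

theorem Adapted.continuousOn_cpow {N : ℕ} {κ : ℝ} {a : Fin (N - 2) → ℂ} {z : ℂ}
    (h : Adapted κ a z) (hκ : κ ≤ 1 / 2) {s : ℂ} (hs : 0 < s.re) :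
    ContinuousOn (fun t : ℝ => scaledPoly a (t * z) ^ s) (Icc 0 1) := fun _ ht =>
  ((continuousAt_cpow_const_of_re_pos (Or.inl (h.re_nonneg hκ ht)) hs).comp
    (f := fun t : ℝ => scaledPoly a (t * z))
    (continuous_scaledPoly_ray a z).continuousAt).continuousWithinAt

theorem norm_cpow_le_of_norm_le {p s : ℂ} {B : ℝ} (hp : ‖p‖ ≤ B) (hs : 0 ≤ s.re) :
    ‖p ^ s‖ ≤ B ^ s.re * Real.exp (Real.pi * |s.im|) := by
  refine (norm_cpow_le p s).trans ?_
  rw [div_eq_mul_inv, ← Real.exp_neg]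
  gcongr
  · exact Real.rpow_nonneg ((norm_nonneg p).trans hp) _
  · refine (neg_le_abs _).trans ?_
    rw [abs_mul]
    gcongr
    exact abs_arg_le_pi p

/-! ### Integrals of powers of the polynomial along the segment -/

/-- `∫_0^z h p ^ s`, where `p = 1 + z ^ N - ∑ a_n z ^ n`. -/
noncomputable def moment {N : ℕ} (h : Polynomial ℂ) (s : ℂ) (a : Fin (N - 2) → ℂ) (z : ℂ) : ℂ :=
  ∫ t in (0 : ℝ)..1, z * h.eval (t * z) * scaledPoly a (t * z) ^ s

theorem continuous_eval_ray (h : Polynomial ℂ) (z : ℂ) :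
    Continuous fun t : ℝ => h.eval ((t : ℂ) * z) :=
  h.continuous.comp (by fun_prop)

theorem Adapted.continuousOn_integrand {N : ℕ} {κ : ℝ} {a : Fin (N - 2) → ℂ} {z : ℂ}
    (h : Adapted κ a z) (hκ : κ ≤ 1 / 2) (q : Polynomial ℂ) {s : ℂ} (hs : 0 < s.re) :
    ContinuousOn (fun t : ℝ => z * q.eval (t * z) * scaledPoly a (t * z) ^ s) (Icc 0 1) :=
  (continuousOn_const.mul (continuous_eval_ray q z).continuousOn).mul
    (h.continuousOn_cpow hκ hs)

theorem exists_bound_eval (q : Polynomial ℂ) : ∃ B, 0 ≤ B ∧ ∀ x : ℂ, ‖x‖ ≤ 2 → ‖q.eval x‖ ≤ B := by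
  obtain ⟨B, hB⟩ := (isCompact_closedBall (0 : ℂ) 2).exists_bound_of_continuousOn
    q.continuous.continuousOn
  refine ⟨B, (norm_nonneg _).trans (hB 0 (by simp)), fun x hx => hB x (by simpa using hx)⟩

theorem norm_ray_le {z : ℂ} (hz : ‖z‖ ≤ 2) {t : ℝ} (ht : t ∈ Icc (0 : ℝ) 1) :
    ‖(t : ℂ) * z‖ ≤ 2 := by
  rw [norm_mul, norm_real, Real.norm_of_nonneg ht.1]
  nlinarith [ht.2, norm_nonneg z, ht.1]

theorem Adapted.norm_integrand_le {N : ℕ} {κ : ℝ} {a : Fin (N - 2) → ℂ} {z : ℂ}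
    (h : Adapted κ a z) (hκ0 : 0 ≤ κ) {q : Polynomial ℂ} {B : ℝ}
    (hB : ∀ x : ℂ, ‖x‖ ≤ 2 → ‖q.eval x‖ ≤ B) {s : ℂ} (hs : 0 ≤ s.re) {t : ℝ}
    (ht : t ∈ Icc (0 : ℝ) 1) :
    ‖z * q.eval (t * z) * scaledPoly a (t * z) ^ s‖ ≤
      2 * B * ((1 + κ) ^ s.re * Real.exp (Real.pi * |s.im|)) := by
  rw [norm_mul, norm_mul]
  have h1 := norm_cpow_le_of_norm_le (h.norm_le_ray hκ0 ht) hs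
  have h2 := hB _ (norm_ray_le h.norm_le ht)
  have h3 := (norm_nonneg _).trans h2
  have h4 := h.norm_le
  gcongr

theorem Adapted.norm_moment_le {N : ℕ} {κ : ℝ} {a : Fin (N - 2) → ℂ} {z : ℂ}
    (h : Adapted κ a z) (hκ0 : 0 ≤ κ) {s : ℝ} (hs : 0 ≤ s) :
    ‖moment 1 s a z‖ ≤ 2 * (1 + κ) ^ s := by
  have := intervalIntegral.norm_integral_le_of_norm_le_const (a := 0) (b := 1)
    (f := fun t : ℝ => z * (1 : Polynomial ℂ).eval (t * z) * scaledPoly a (t * z) ^ (s : ℂ))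
    (C := 2 * 1 * ((1 + κ) ^ (s : ℂ).re * Real.exp (Real.pi * |(s : ℂ).im|))) (fun t ht => by
      rw [uIoc_of_le zero_le_one] at ht
      exact h.norm_integrand_le hκ0 (fun x _ => by simp) (by simpa using hs)
        (Ioc_subset_Icc_self ht))
  simpa [moment] using this

/-- Holomorphy in the exponent is needed for the identity theorem in `IsRootFun.coeff_eq`. -/
theorem Adapted.differentiableOn_moment_exponent {N : ℕ} (hN : N ≠ 0) {κ : ℝ}
    {a : Fin (N - 2) → ℂ} {z : ℂ} (h : Adapted κ a z) (hκ0 : 0 ≤ κ) (hκ : κ ≤ 1 / 2)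
    (q : Polynomial ℂ) : DifferentiableOn ℂ (fun s => moment q s a z) {s | 0 < s.re} := by
  obtain ⟨B, hB0, hB⟩ := exists_bound_eval q
  have hD : IsOpen {s : ℂ | 0 < s.re} := isOpen_lt continuous_const continuous_re
  refine differentiableOn_integral_of_locally_bounded hD zero_le_one (fun t ht => ?_)
    (fun s hs => (h.continuousOn_integrand hκ q hs).mono Ioo_subset_Icc_self) fun s₀ hs₀ => ?_
  · have h0 := slitPlane_ne_zero (h.mem_slitPlane hN hκ (Ioo_subset_Ico_self ht))
    exact DifferentiableOn.const_mul (fun s _ =>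
      ((hasDerivAt_id s).const_cpow (Or.inl h0)).differentiableAt.differentiableWithinAt) _
  · have hc : Continuous fun s : ℂ => 2 * B * ((1 + κ) ^ s.re * Real.exp (Real.pi * |s.im|)) := by
      have : ∀ s : ℂ, 1 + κ ≠ 0 ∨ 0 ≤ s.re := fun _ => Or.inl (by linarith)
      have h2 : Continuous fun s : ℂ => (1 + κ) ^ s.re :=
        Real.continuous_const_rpow (by linarith) |>.comp continuous_re
      have h3 : Continuous fun s : ℂ => |s.im| := continuous_im.abs
      fun_prop
    refine ⟨2 * B * ((1 + κ) ^ s₀.re * Real.exp (Real.pi * |s₀.im|)) + 1, ?_⟩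
    filter_upwards [hD.mem_nhds hs₀, hc.continuousAt.eventually_lt_const (lt_add_one _)]
      with s hs hs2 t ht
    exact (h.norm_integrand_le hκ0 hB (le_of_lt hs) (Ioo_subset_Icc_self ht)).trans hs2.le

section Family

variable {N : ℕ} {ζ : ℂ} {κ δ : ℝ} {zr : (Fin (N - 2) → ℂ) → ℂ} {D : Set ℂ}
  {a : ℂ → Fin (N - 2) → ℂ}

theorem IsRootFun.differentiableOn_integrand (hr : IsRootFun N ζ κ δ zr) (hN : N ≠ 0)
    (hκ : κ ≤ 1 / 2) (hD : IsOpen D) (ha : ∀ i, DifferentiableOn ℂ (fun τ => a τ i) D)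
    (hδ : ∀ τ ∈ D, ∀ i, ‖a τ i‖ < δ) (q : Polynomial ℂ) (s : ℂ) {t : ℝ}
    (ht : t ∈ Ioo (0 : ℝ) 1) :
    DifferentiableOn ℂ (fun τ => zr (a τ) * q.eval (t * zr (a τ)) *
      scaledPoly (a τ) (t * zr (a τ)) ^ s) D := by
  have hz := hr.differentiableOn D a hD ha hδ
  have h1 : DifferentiableOn ℂ (fun τ => scaledPoly (a τ) (t * zr (a τ))) D := by
    simp only [scaledPoly, perturb]
    exact (((hz.const_mul _).pow N).const_add 1).sub
      (DifferentiableOn.fun_sum fun i _ => (ha i).mul ((hz.const_mul _).pow _))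
  have h2 : DifferentiableOn ℂ (fun τ => q.eval (t * zr (a τ))) D :=
    q.differentiable.comp_differentiableOn (hz.const_mul _)
  refine (hz.mul h2).mul fun τ hτ => ?_
  exact (h1 τ hτ).cpow_const
    ((hr.adapted (hδ τ hτ)).mem_slitPlane hN hκ (Ioo_subset_Ico_self ht))

theorem IsRootFun.bounded_integrand (hr : IsRootFun N ζ κ δ zr) (hκ0 : 0 ≤ κ)
    (hD : IsOpen D) (hδ : ∀ τ ∈ D, ∀ i, ‖a τ i‖ < δ) (q : Polynomial ℂ) {s : ℂ} (hs : 0 ≤ s.re) :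
    ∀ τ₀ ∈ D, ∃ B, ∀ᶠ τ in 𝓝 τ₀, ∀ t ∈ Ioo (0 : ℝ) 1, ‖zr (a τ) * q.eval (t * zr (a τ)) *
      scaledPoly (a τ) (t * zr (a τ)) ^ s‖ ≤ B := by
  intro τ₀ hτ₀
  obtain ⟨B, hB0, hB⟩ := exists_bound_eval q
  refine ⟨2 * B * ((1 + κ) ^ s.re * Real.exp (Real.pi * |s.im|)), ?_⟩
  filter_upwards [hD.mem_nhds hτ₀] with τ hτ t ht
  exact (hr.adapted (hδ τ hτ)).norm_integrand_le hκ0 hB hs (Ioo_subset_Icc_self ht)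

theorem IsRootFun.differentiableOn_moment (hr : IsRootFun N ζ κ δ zr) (hN : N ≠ 0)
    (hκ0 : 0 ≤ κ) (hκ : κ ≤ 1 / 2) (hD : IsOpen D)
    (ha : ∀ i, DifferentiableOn ℂ (fun τ => a τ i) D)
    (hδ : ∀ τ ∈ D, ∀ i, ‖a τ i‖ < δ) (q : Polynomial ℂ) {s : ℂ} (hs : 0 < s.re) :
    DifferentiableOn ℂ (fun τ => moment q s (a τ) (zr (a τ))) D :=
  differentiableOn_integral_of_locally_bounded hD zero_le_one
    (fun _ ht => hr.differentiableOn_integrand hN hκ hD ha hδ q s ht)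
    (fun τ hτ => ((hr.adapted (hδ τ hτ)).continuousOn_integrand hκ q hs).mono Ioo_subset_Icc_self)
    (hr.bounded_integrand hκ0 hD hδ q hs.le)

end Family

/-- `∑ a_n X ^ n`. -/
noncomputable def perturbPoly {N : ℕ} (a : Fin (N - 2) → ℂ) : Polynomial ℂ :=
  ∑ i : Fin (N - 2), Polynomial.C (a i) * Polynomial.X ^ (i.val + 1)

theorem eval_perturbPoly {N : ℕ} (a : Fin (N - 2) → ℂ) (z : ℂ) :
    (perturbPoly a).eval z = perturb a z := by
  simp [perturbPoly, perturb, Polynomial.eval_finsetSum]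

theorem perturb_smul {N : ℕ} (a : Fin (N - 2) → ℂ) (τ z : ℂ) :
    perturb (τ • a) z = τ * perturb a z := by
  simp [perturb, Finset.mul_sum, mul_assoc]

theorem perturb'_smul {N : ℕ} (a : Fin (N - 2) → ℂ) (τ z : ℂ) :
    perturb' (τ • a) z = τ * perturb' a z := by
  simp [perturb', Finset.mul_sum, mul_assoc]

theorem hasDerivAt_ray (z : ℂ) (t : ℝ) : HasDerivAt (fun t : ℝ => (t : ℂ) * z) z t := by
  simpa using (hasDerivAt_id t).ofReal_comp.mul_const z

/-- The endpoint moves with `τ`, but its contribution is `z'` times the integral of the derivative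
of `t q(tz) p^s`, which vanishes because `p` is zero at the end. Only the explicit dependence of `p`
on `τ` remains. The condition `1 < Re s` keeps `p^(s - 1)` continuous up to the end. -/
theorem IsRootFun.hasDerivAt_moment {N : ℕ} {ζ : ℂ} {κ δ : ℝ} {zr : (Fin (N - 2) → ℂ) → ℂ}
    {D : Set ℂ} {a : Fin (N - 2) → ℂ} (hr : IsRootFun N ζ κ δ zr) (hN : N ≠ 0)
    (hκ0 : 0 ≤ κ) (hκ : κ ≤ 1 / 2) (hD : IsOpen D)
    (hδ : ∀ τ ∈ D, ∀ i, ‖(τ • a) i‖ < δ) (q : Polynomial ℂ) {s : ℂ} (hs : 1 < s.re)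
    {τ : ℂ} (hτ : τ ∈ D) :
    HasDerivAt (fun τ => moment q s (τ • a) (zr (τ • a)))
      (-s * moment (q * perturbPoly a) (s - 1) (τ • a) (zr (τ • a))) τ := by
  have ha : ∀ i, DifferentiableOn ℂ (fun τ : ℂ => (τ • a) i) D := fun i => by
    simp only [Pi.smul_apply, smul_eq_mul]; fun_prop
  have hs0 : 0 < s.re := by linarith
  have hs1 : 0 < (s - 1).re := by rw [sub_re, one_re]; linarith
  have had := hr.adapted (hδ τ hτ)
  have main := hasDerivAt_integral_of_locally_bounded hD zero_le_one
    (fun _ ht => hr.differentiableOn_integrand hN hκ hD ha hδ q s ht)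
    (fun τ hτ => ((hr.adapted (hδ τ hτ)).continuousOn_integrand hκ q hs0).mono Ioo_subset_Icc_self)
    (hr.bounded_integrand hκ0 hD hδ q hs0.le) hτ
  refine main.congr_deriv ?_
  have hz := ((hr.differentiableOn D _ hD ha hδ).differentiableAt (hD.mem_nhds hτ)).hasDerivAt
  set z' := deriv (fun τ => zr (τ • a)) τ with hz'
  set z := zr (τ • a) with hzdef
  set P : ℝ → ℂ := fun t => scaledPoly (τ • a) (t * z) with hP
  set P' : ℝ → ℂ := fun t => N * (t * z) ^ (N - 1) - perturb' (τ • a) (t * z) with hP'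
  -- This is the derivative in `t` of `t q(tz) p(tz)^s`.
  set S' : ℝ → ℂ := fun t => q.eval (t * z) * P t ^ s +
    t * (q.derivative.eval (t * z) * z) * P t ^ s +
    t * q.eval (t * z) * (s * P t ^ (s - 1) * (P' t * z)) with hS'
  have hPc : ContinuousOn (fun t => P t ^ s) (Icc 0 1) := had.continuousOn_cpow hκ hs0
  have hPc1 : ContinuousOn (fun t => P t ^ (s - 1)) (Icc 0 1) := had.continuousOn_cpow hκ hs1
  have hqc := (continuous_eval_ray q z).continuousOn (s := Icc 0 1)
  have hq'c := (continuous_eval_ray q.derivative z).continuousOn (s := Icc 0 1)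
  have hP'c : Continuous P' := by
    simp only [hP', perturb']; fun_prop
  have htc : ContinuousOn (fun t : ℝ => (t : ℂ)) (Icc 0 1) := continuous_ofReal.continuousOn
  have hS'c : ContinuousOn S' (Icc 0 1) := by
    refine ((hqc.mul hPc).add ((htc.mul (hq'c.mul continuousOn_const)).mul hPc)).add ?_
    exact (htc.mul hqc).mul ((continuousOn_const.mul hPc1).mul
      (hP'c.continuousOn.mul continuousOn_const))
  have hPder : ∀ t : ℝ, HasDerivAt P (P' t * z) t := fun t =>
    HasDerivAt.comp (h₂ := scaledPoly (τ • a)) (h := fun t : ℝ => (t : ℂ) * z) t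
      (hasDerivAt_scaledPoly (τ • a) (t * z)) (hasDerivAt_ray z t)
  have hqder : ∀ t : ℝ, HasDerivAt (fun t : ℝ => q.eval ((t : ℂ) * z))
      (q.derivative.eval (t * z) * z) t := fun t =>
    HasDerivAt.comp (h₂ := fun x => q.eval x) (h := fun t : ℝ => (t : ℂ) * z) t
      (q.hasDerivAt (t * z)) (hasDerivAt_ray z t)
  have hS : ∀ t ∈ Ioo (0 : ℝ) 1,
      HasDerivAt (fun t : ℝ => t * q.eval (t * z) * P t ^ s) (S' t) t := by
    intro t ht
    have h1 : HasDerivAt (fun t : ℝ => (t : ℂ)) 1 t := by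
      simpa using (hasDerivAt_id t).ofReal_comp
    have h2 := (h1.mul (hqder t)).mul ((hasDerivAt_id (P t)).cpow_const (c := s)
      (had.mem_slitPlane hN hκ (Ioo_subset_Ico_self ht)) |>.comp t (hPder t))
    refine h2.congr_deriv ?_
    simp only [hS', Function.comp, id, Pi.mul_apply]
    ring
  have hint : ∫ t in (0 : ℝ)..1, S' t = 0 := by
    rw [intervalIntegral.integral_eq_sub_of_hasDerivAt_of_le zero_le_one
      ((htc.mul hqc).mul hPc) hS (hS'c.intervalIntegrable_of_Icc zero_le_one)]
    have h0 : s ≠ 0 := fun h => by rw [h] at hs0; simp at hs0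
    have h1 : P 1 = 0 := by simp only [hP, ofReal_one, one_mul]; exact had.root
    simp [h1, h0]
  have hderiv : ∀ t ∈ Ioo (0 : ℝ) 1, deriv (fun τ : ℂ => zr (τ • a) * q.eval (t * zr (τ • a)) *
      scaledPoly (τ • a) (t * zr (τ • a)) ^ s) τ =
      z' * S' t - s * (z * (q * perturbPoly a).eval (t * z) * P t ^ (s - 1)) := by
    intro t ht
    have hx : HasDerivAt (fun τ : ℂ => (t : ℂ) * zr (τ • a)) (t * z') τ := hz.const_mul _
    have hq1 : HasDerivAt (fun τ : ℂ => q.eval ((t : ℂ) * zr (τ • a)))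
        (q.derivative.eval (t * z) * (t * z')) τ :=
      HasDerivAt.comp (h₂ := fun x => q.eval x) (h := fun τ : ℂ => (t : ℂ) * zr (τ • a)) τ
        (q.hasDerivAt (t * z)) hx
    have hg1 : HasDerivAt (fun τ : ℂ => perturb a ((t : ℂ) * zr (τ • a)))
        (perturb' a (t * z) * (t * z')) τ :=
      HasDerivAt.comp (h₂ := perturb a) (h := fun τ : ℂ => (t : ℂ) * zr (τ • a)) τ
        (hasDerivAt_perturb a (t * z)) hx
    have hp1 : HasDerivAt (fun τ : ℂ => scaledPoly (τ • a) ((t : ℂ) * zr (τ • a)))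
        (P' t * (t * z') - perturb a (t * z)) τ := by
      simp only [scaledPoly, perturb_smul]
      refine (((hx.pow N).const_add 1).sub ((hasDerivAt_id τ).mul hg1)).congr_deriv ?_
      simp only [hP', perturb'_smul, id]
      ring
    have h2 := (hz.mul hq1).mul (hp1.cpow_const (c := s)
      (had.mem_slitPlane hN hκ (Ioo_subset_Ico_self ht)))
    refine h2.deriv.trans ?_
    simp only [hS', Polynomial.eval_mul, eval_perturbPoly, hP, Pi.mul_apply, ← hzdef]
    ring
  have hc2 := had.continuousOn_integrand hκ (q * perturbPoly a) hs1
  rw [moment, intervalIntegral.integral_of_le zero_le_one, integral_Ioc_eq_integral_Ioo,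
    setIntegral_congr_fun measurableSet_Ioo hderiv, ← integral_Ioc_eq_integral_Ioo,
    ← intervalIntegral.integral_of_le zero_le_one, intervalIntegral.integral_sub,
    intervalIntegral.integral_const_mul, intervalIntegral.integral_const_mul, hint]
  · ring
  · exact (hS'c.intervalIntegrable_of_Icc zero_le_one).const_mul _
  · exact (hc2.intervalIntegrable_of_Icc zero_le_one).const_mul _

end SeibergWitten

namespace SeibergWitten

open Complex Set MeasureTheory Filter Topology

/-! ### Taylor coefficients in the moduli -/

/-- The integral of `p ^ s` along the segment, with the moduli scaled by `τ`. -/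
noncomputable def scaledMoment {N : ℕ} (zr : (Fin (N - 2) → ℂ) → ℂ) (a : Fin (N - 2) → ℂ) (s τ : ℂ) :
    ℂ := moment 1 s (τ • a) (zr (τ • a))

section

variable {N : ℕ} {ζ : ℂ} {κ δ : ℝ} {zr : (Fin (N - 2) → ℂ) → ℂ} {a : Fin (N - 2) → ℂ}

/-- The margin `δ / 3` lets `τ` range over a disc that contains the circle `|τ| = 2`, on which the
Cauchy estimates are taken; the moduli of interest sit at `τ = 1`. -/
theorem norm_smul_lt_of_mem_ball (ha : ∀ i, ‖a i‖ < δ / 3) :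
    ∀ τ ∈ Metric.ball (0 : ℂ) 3, ∀ i, ‖(τ • a) i‖ < δ := by
  intro τ hτ i
  have h1 : ‖τ‖ < 3 := by simpa using hτ
  rw [Pi.smul_apply, smul_eq_mul, norm_mul]
  have := ha i
  nlinarith [norm_nonneg (a i), norm_nonneg τ]

theorem IsRootFun.differentiableOn_scaledMoment (hr : IsRootFun N ζ κ δ zr) (hN : N ≠ 0)
    (hκ0 : 0 ≤ κ) (hκ : κ ≤ 1 / 2) (ha : ∀ i, ‖a i‖ < δ / 3) {s : ℂ} (hs : 0 < s.re) :
    DifferentiableOn ℂ (scaledMoment zr a s) (Metric.ball 0 3) :=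
  hr.differentiableOn_moment hN hκ0 hκ Metric.isOpen_ball
    (fun i => by simp only [Pi.smul_apply, smul_eq_mul]; fun_prop)
    (norm_smul_lt_of_mem_ball ha) 1 hs

theorem closedBall_two_subset : Metric.closedBall (0 : ℂ) 2 ⊆ Metric.ball 0 3 :=
  Metric.closedBall_subset_ball (by norm_num)

theorem IsRootFun.diffContOnCl_scaledMoment (hr : IsRootFun N ζ κ δ zr) (hN : N ≠ 0)
    (hκ0 : 0 ≤ κ) (hκ : κ ≤ 1 / 2) (ha : ∀ i, ‖a i‖ < δ / 3) {s : ℂ} (hs : 0 < s.re) :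
    DiffContOnCl ℂ (scaledMoment zr a s) (Metric.ball 0 2) := by
  refine DifferentiableOn.diffContOnCl ?_
  rw [closure_ball _ two_ne_zero]
  exact (hr.differentiableOn_scaledMoment hN hκ0 hκ ha hs).mono closedBall_two_subset

theorem IsRootFun.hasSum_scaledMoment (hr : IsRootFun N ζ κ δ zr) (hN : N ≠ 0)
    (hκ0 : 0 ≤ κ) (hκ : κ ≤ 1 / 2) (ha : ∀ i, ‖a i‖ < δ / 3) {s : ℂ} (hs : 0 < s.re) :
    HasSum (fun M : ℕ => iteratedDeriv M (scaledMoment zr a s) 0 / M.factorial)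
      (moment 1 s a (zr a)) := by
  have h := hasSum_taylorSeries_on_ball (z := 1)
    (hr.differentiableOn_scaledMoment hN hκ0 hκ ha hs) (by simp)
  rw [scaledMoment, one_smul] at h
  refine hasSum_of_eq h fun M => ?_
  simp [div_eq_inv_mul]

/-- Cauchy's estimate on `|τ| = 2` yields geometric decay in `M`. The exponent enters only through
`(1 + κ)^s`, which will be compensated by powers of `v / 2` when `s = k + 1/2`. -/
theorem IsRootFun.norm_coeff_le (hr : IsRootFun N ζ κ δ zr) (hN : N ≠ 0)
    (hκ0 : 0 ≤ κ) (hκ : κ ≤ 1 / 2) (ha : ∀ i, ‖a i‖ < δ / 3) {s : ℝ} (hs : 0 < s) (M : ℕ) :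
    ‖iteratedDeriv M (scaledMoment zr a s) 0 / M.factorial‖ ≤
      2 * (1 + κ) ^ s * (1 / 2) ^ M := by
  have h := norm_iteratedDeriv_le_of_forall_mem_sphere_norm_le M two_pos
    (hr.diffContOnCl_scaledMoment (s := s) hN hκ0 hκ ha (by simpa)) (C := 2 * (1 + κ) ^ s)
    fun τ hτ => (hr.adapted (norm_smul_lt_of_mem_ball ha τ
      (closedBall_two_subset (Metric.sphere_subset_closedBall hτ)))).norm_moment_le hκ0 hs.le
  have hM : (0 : ℝ) < M.factorial := by exact_mod_cast M.factorial_pos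
  rw [norm_div, norm_natCast, div_le_iff₀ hM, one_div, inv_pow]
  refine h.trans (le_of_eq ?_)
  field_simp

/-- Cauchy's formula writes the coefficient as an integral over `|τ| = 2` of moments, each
holomorphic in `s`. No differentiation under the moment integral is involved, so all `s` with `0 <
Re s` are admitted. -/
theorem IsRootFun.differentiableOn_coeff (hr : IsRootFun N ζ κ δ zr) (hN : N ≠ 0)
    (hκ0 : 0 ≤ κ) (hκ : κ ≤ 1 / 2) (ha : ∀ i, ‖a i‖ < δ / 3) (M : ℕ) :
    DifferentiableOn ℂ (fun s => iteratedDeriv M (scaledMoment zr a s) 0 / M.factorial)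
      {s | 0 < s.re} := by
  have hD : IsOpen {s : ℂ | 0 < s.re} := isOpen_lt continuous_const continuous_re
  have hmem : ∀ θ : ℝ, circleMap 0 2 θ ∈ Metric.ball (0 : ℂ) 3 := fun θ =>
    closedBall_two_subset (Metric.sphere_subset_closedBall (circleMap_mem_sphere 0 two_pos.le θ))
  have hnorm : ∀ θ : ℝ, ‖circleMap 0 2 θ‖ = 2 := fun θ => by simp
  have hne : ∀ θ : ℝ, circleMap 0 2 θ ≠ 0 := fun θ h => by
    have := hnorm θ; rw [h, norm_zero] at this; norm_num at this
  have hadapt := fun θ => hr.adapted (norm_smul_lt_of_mem_ball ha _ (hmem θ))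
  have key : DifferentiableOn ℂ (fun s => ∫ θ in (0 : ℝ)..2 * Real.pi,
      deriv (circleMap 0 2) θ • ((1 / (circleMap 0 2 θ - 0) ^ (M + 1)) •
        scaledMoment zr a s (circleMap 0 2 θ))) {s | 0 < s.re} := by
    refine differentiableOn_integral_of_locally_bounded hD Real.two_pi_pos.le
      (fun θ _ => ?_) (fun s hs => ?_) fun s₀ hs₀ => ?_
    · simp only [smul_eq_mul]
      exact ((((hadapt θ).differentiableOn_moment_exponent hN hκ0 hκ 1).const_mul _).const_mul _)
    · have hc : ContinuousOn (fun θ : ℝ => scaledMoment zr a s (circleMap 0 2 θ))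
          (Ioo 0 (2 * Real.pi)) :=
        (hr.differentiableOn_scaledMoment hN hκ0 hκ ha hs).continuousOn.comp
          (continuous_circleMap 0 2).continuousOn fun θ _ => hmem θ
      simp only [deriv_circleMap, smul_eq_mul]
      refine ContinuousOn.mul ?_ (ContinuousOn.mul ?_ hc)
      · exact ((continuous_circleMap 0 2).mul continuous_const).continuousOn
      · refine ContinuousOn.div continuousOn_const
          (((continuous_circleMap 0 2).sub continuous_const).pow _).continuousOn fun θ _ => ?_
        rw [sub_zero]
        exact pow_ne_zero _ (hne θ)
    · have hb : ∀ᶠ s : ℂ in 𝓝 s₀, s.re < s₀.re + 1 ∧ |s.im| < |s₀.im| + 1 :=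
        (continuous_re.continuousAt.eventually_lt_const (lt_add_one _)).and
          (continuous_im.abs.continuousAt.eventually_lt_const (lt_add_one _))
      refine ⟨2 * (1 / 2 ^ (M + 1) * (2 * 1 * ((1 + κ) ^ (s₀.re + 1) *
        Real.exp (Real.pi * (|s₀.im| + 1))))), ?_⟩
      filter_upwards [hD.mem_nhds hs₀, hb] with s hs hs2 θ _
      have h1 : ‖scaledMoment zr a s (circleMap 0 2 θ)‖ ≤ 2 * 1 * ((1 + κ) ^ s.re *
          Real.exp (Real.pi * |s.im|)) := by
        have := intervalIntegral.norm_integral_le_of_norm_le_const (a := 0) (b := 1)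
          (C := 2 * 1 * ((1 + κ) ^ s.re * Real.exp (Real.pi * |s.im|))) (fun t ht => by
            rw [uIoc_of_le zero_le_one] at ht
            exact (hadapt θ).norm_integrand_le hκ0 (q := 1) (B := 1) (s := s)
              (fun x _ => by simp) (le_of_lt hs) (Ioc_subset_Icc_self ht))
        simpa [scaledMoment, moment] using this
      rw [norm_smul, norm_smul, deriv_circleMap, norm_mul, norm_I, mul_one, hnorm, norm_div,
        norm_one, sub_zero, norm_pow, hnorm]
      gcongr
      refine h1.trans ?_
      gcongr
      · linarith
      · exact hs2.1.le
      · exact hs2.2.le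
  refine (key.const_mul ((2 * Real.pi * I)⁻¹ : ℂ)).congr fun s hs => ?_
  have h := (hr.diffContOnCl_scaledMoment hN hκ0 hκ ha
    hs).circleIntegral_one_div_sub_center_pow_smul two_pos M
  rw [circleIntegral] at h
  rw [h, smul_eq_mul]
  have := two_pi_I_ne_zero
  field_simp

/-- Each derivative lowers the exponent by one and brings down a factor; the quotient of Gamma
values is the resulting falling factorial. The hypothesis `M < Re σ` keeps each differentiation
within the range of `IsRootFun.hasDerivAt_moment`. -/
theorem IsRootFun.iteratedDeriv_scaledMoment (hr : IsRootFun N ζ κ δ zr) (hN : N ≠ 0)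
    (hκ0 : 0 ≤ κ) (hκ : κ ≤ 1 / 2) (ha : ∀ i, ‖a i‖ < δ / 3) {σ : ℂ} (M : ℕ) (hσ : M < σ.re) :
    ∀ τ ∈ Metric.ball (0 : ℂ) 3, iteratedDeriv M (scaledMoment zr a σ) τ =
      (-1) ^ M * (Gamma (σ + 1) / Gamma (σ + 1 - M)) *
        moment (perturbPoly a ^ M) (σ - M) (τ • a) (zr (τ • a)) := by
  induction M with
  | zero =>
    intro τ _
    have : Gamma (σ + 1) ≠ 0 := Gamma_ne_zero_of_re_pos (by
      rw [add_re, one_re]; norm_num at hσ; linarith)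
    simp [scaledMoment, this]
  | succ M ih =>
    intro τ hτ
    push_cast at hσ
    rw [iteratedDeriv_succ, Filter.EventuallyEq.deriv_eq
      (Filter.eventuallyEq_of_mem (Metric.isOpen_ball.mem_nhds hτ) (ih (by linarith)))]
    have h := (hr.hasDerivAt_moment (s := σ - M) hN hκ0 hκ Metric.isOpen_ball
      (norm_smul_lt_of_mem_ball ha) (perturbPoly a ^ M)
      (by rw [sub_re, natCast_re]; linarith) hτ).const_mul
        ((-1) ^ M * (Gamma (σ + 1) / Gamma (σ + 1 - M)))
    rw [h.deriv]
    have h1 : σ - M ≠ 0 := fun h => by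
      have := congrArg re h
      rw [sub_re, natCast_re, zero_re] at this
      linarith
    rw [show σ + 1 - M = σ - M + 1 by ring, Gamma_add_one _ h1,
      show σ + 1 - (M + 1 : ℕ) = σ - M by push_cast; ring,
      show σ - (M + 1 : ℕ) = σ - M - 1 by push_cast; ring, pow_succ (-1 : ℂ), pow_succ (perturbPoly a)]
    field_simp

end

theorem perturb_pow {N : ℕ} (a : Fin (N - 2) → ℂ) (z : ℂ) (M : ℕ) :
    perturb a z ^ M = ∑ l ∈ Finset.univ.piAntidiag M,
      M.factorial * (∏ i, a i ^ l i / (l i).factorial) * z ^ (∑ i, (i.val + 1) * l i) := by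
  rw [perturb, Finset.sum_pow_eq_sum_piAntidiag]
  refine Finset.sum_congr rfl fun l hl => ?_
  have hM : ∑ i, l i = M := (Finset.mem_piAntidiag.1 hl).1
  have h1 : ((∏ i, (l i).factorial : ℕ) : ℂ) * (Nat.multinomial Finset.univ l : ℂ) =
      M.factorial := by
    rw [← hM]
    exact_mod_cast Nat.multinomial_spec Finset.univ l
  have h2 : ((∏ i, (l i).factorial : ℕ) : ℂ) ≠ 0 :=
    Nat.cast_ne_zero.2 (Finset.prod_ne_zero_iff.2 fun i _ => Nat.factorial_ne_zero _)
  simp only [mul_pow, Finset.prod_mul_distrib, Finset.prod_div_distrib, ← pow_mul]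
  rw [Finset.prod_pow_eq_pow_sum, ← h1]
  push_cast at h2 ⊢
  field_simp

/-- At zero moduli `p` is `1 - t^N` along the segment, so after the multinomial expansion every term
is a Beta integral in `t^N`. -/
theorem moment_zero {N : ℕ} (hN : N ≠ 0) {ζ : ℂ} (hζ : ζ ^ N = -1) (a : Fin (N - 2) → ℂ) (M : ℕ)
    {σ : ℝ} (hσ : 0 < σ) :
    moment (perturbPoly a ^ M) σ (0 : Fin (N - 2) → ℂ) ζ =
      ∑ l ∈ Finset.univ.piAntidiag M, M.factorial * (∏ i, a i ^ l i / (l i).factorial) *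
        ζ ^ sumL l * (Gamma ((sumL l : ℂ) / N) * Gamma (σ + 1) /
          (N * Gamma ((sumL l : ℂ) / N + (σ + 1)))) := by
  have hNR : (0 : ℝ) < N := by exact_mod_cast Nat.pos_of_ne_zero hN
  have hL : ∀ l : Fin (N - 2) → ℕ, ∫ t in (0 : ℝ)..1,
      t ^ (∑ i, (i.val + 1) * l i) * (1 - t ^ N) ^ σ =
      Real.Gamma ((sumL l : ℝ) / N) * Real.Gamma (σ + 1) /
        (N * Real.Gamma ((sumL l : ℝ) / N + (σ + 1))) := by
    intro l
    have hLpos : (0 : ℝ) < sumL l / N := by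
      have : (0 : ℝ) < sumL l := by rw [sumL]; positivity
      positivity
    rw [← integral_beta_pow hNR hLpos (by linarith)]
    refine intervalIntegral.integral_congr fun t ht => ?_
    simp only [add_sub_cancel_right, Real.rpow_natCast]
    rw [mul_div_cancel₀ _ hNR.ne', sumL, Nat.cast_add, Nat.cast_one, add_sub_cancel_left,
      Real.rpow_natCast]
  have e : ∀ t ∈ uIcc (0 : ℝ) 1, ζ * (perturbPoly a ^ M).eval (t * ζ) *
      scaledPoly (0 : Fin (N - 2) → ℂ) (t * ζ) ^ (σ : ℂ) =
      ∑ l ∈ Finset.univ.piAntidiag M, M.factorial * (∏ i, a i ^ l i / (l i).factorial) *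
        ζ ^ sumL l * ((t ^ (∑ i, (i.val + 1) * l i) * (1 - t ^ N) ^ σ : ℝ) : ℂ) := by
    intro t ht
    rw [uIcc_of_le zero_le_one] at ht
    have h0 : scaledPoly (0 : Fin (N - 2) → ℂ) (t * ζ) = ((1 - t ^ N : ℝ) : ℂ) := by
      simp [scaledPoly, perturb, mul_pow, hζ]; ring
    rw [h0, ← ofReal_cpow (sub_nonneg.2 (pow_le_one₀ ht.1 ht.2)), Polynomial.eval_pow,
      eval_perturbPoly, perturb_pow, Finset.mul_sum, Finset.sum_mul]
    refine Finset.sum_congr rfl fun l _ => ?_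
    rw [sumL]
    push_cast
    ring
  rw [moment, intervalIntegral.integral_congr e, intervalIntegral.integral_finsetSum]
  · refine Finset.sum_congr rfl fun l _ => ?_
    rw [intervalIntegral.integral_const_mul, intervalIntegral.integral_ofReal, hL]
    push_cast
    rw [← Gamma_ofReal, ← Gamma_ofReal, ← Gamma_ofReal]
    push_cast
    rfl
  · intro l _
    refine ContinuousOn.intervalIntegrable ?_
    refine (continuous_const.mul (continuous_ofReal.comp ?_)).continuousOn
    have : ∀ t : ℝ, 1 - t ^ N ≠ 0 ∨ 0 ≤ σ := fun _ => Or.inr hσ.le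
    exact (continuous_pow _).mul ((continuous_const.sub (continuous_pow _)).rpow_const this)

theorem IsRootFun.zero {N : ℕ} (hN : N ≠ 0) {ζ : ℂ} (hζ : ζ ^ N = -1) {κ δ : ℝ} (hδ : 0 < δ)
    {zr : (Fin (N - 2) → ℂ) → ℂ} (hr : IsRootFun N ζ κ δ zr) : zr 0 = ζ := by
  refine (hr.unique 0 (by simpa using fun _ => hδ) ζ ?_ ?_).symm
  · rw [sub_self, norm_zero]
    have : (0 : ℝ) < N := by exact_mod_cast Nat.pos_of_ne_zero hN
    positivity
  · simp [scaledPoly, perturb, hζ]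

/-- The Taylor coefficients of the integral of `p ^ s` in the moduli. -/
theorem IsRootFun.coeff_eq {N : ℕ} (hN : N ≠ 0) {ζ : ℂ} (hζ : ζ ^ N = -1) {κ δ : ℝ} (hδ : 0 < δ)
    {zr : (Fin (N - 2) → ℂ) → ℂ} {a : Fin (N - 2) → ℂ} (hr : IsRootFun N ζ κ δ zr)
    (hκ0 : 0 ≤ κ) (hκ : κ ≤ 1 / 2) (ha : ∀ i, ‖a i‖ < δ / 3) (M : ℕ) {s : ℂ} (hs : 0 < s.re) :
    iteratedDeriv M (scaledMoment zr a s) 0 / M.factorial =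
      (-1) ^ M / N * ∑ l ∈ Finset.univ.piAntidiag M, (∏ i, a i ^ l i / (l i).factorial) *
        ζ ^ sumL l * Gamma ((sumL l : ℂ) / N) *
          (Gamma (s + 1) * (Gamma (s + 1 + (sumL l : ℂ) / N - M))⁻¹) := by
  have hD : IsOpen {s : ℂ | 0 < s.re} := isOpen_lt continuous_const continuous_re
  have hconn : IsPreconnected {s : ℂ | 0 < s.re} := (convex_halfSpace_re_gt 0).isPreconnected
  have hR : DifferentiableOn ℂ (fun s : ℂ => (-1) ^ M / N * ∑ l ∈ Finset.univ.piAntidiag M,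
      (∏ i : Fin (N - 2), a i ^ l i / ((l i).factorial : ℂ)) *
        ζ ^ sumL l * Gamma ((sumL l : ℂ) / N) *
          (Gamma (s + 1) * (Gamma (s + 1 + (sumL l : ℂ) / N - M))⁻¹)) {s | 0 < s.re} := by
    refine DifferentiableOn.const_mul (DifferentiableOn.fun_sum fun l _ =>
      DifferentiableOn.const_mul (DifferentiableOn.mul (fun s hs => ?_) ?_) _) _
    · refine DifferentiableAt.differentiableWithinAt ?_
      refine (differentiableAt_Gamma (s + 1) fun m h => ?_).comp s (by fun_prop)
      have := congrArg re h
      simp only [add_re, one_re, neg_re, natCast_re] at this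
      have h1 : (0 : ℝ) ≤ m := m.cast_nonneg
      have h2 : 0 < s.re := hs
      linarith
    · exact (differentiable_one_div_Gamma.comp
        (show Differentiable ℂ fun s : ℂ => s + 1 + (sumL l : ℂ) / N - M by
          fun_prop)).differentiableOn
  have hE := ((hr.differentiableOn_coeff hN hκ0 hκ ha
    M).analyticOnNhd hD).eqOn_of_preconnected_of_frequently_eq (hR.analyticOnNhd hD) hconn
      (z₀ := ((M + 1 : ℝ) : ℂ)) (by simp; positivity) ?_
  · exact hE hs
  -- The two sides are compared at the points `M + 1 + 1/(n + 1)`, where `M`-fold differentiation is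
  -- allowed; they accumulate at `M + 1`, inside the half-plane.
  · have hseq : Tendsto (fun n : ℕ => ((M + 1 + 1 / ((n : ℝ) + 1) : ℝ) : ℂ)) atTop
        (𝓝[≠] ((M + 1 : ℝ) : ℂ)) := by
      refine tendsto_nhdsWithin_iff.2 ⟨?_, Eventually.of_forall fun n => ?_⟩
      · have h1 := (tendsto_one_div_add_atTop_nhds_zero_nat (𝕜 := ℝ)).const_add ((M : ℝ) + 1)
        rw [add_zero] at h1
        exact (continuous_ofReal.tendsto _).comp h1
      · have : (0 : ℝ) < 1 / ((n : ℝ) + 1) := by positivity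
        rw [mem_compl_iff, mem_singleton_iff, ofReal_inj]
        linarith
    refine hseq.frequently (Frequently.of_forall fun n => ?_)
    have hpos : (0 : ℝ) < 1 / ((n : ℝ) + 1) := by positivity
    set σ : ℝ := M + 1 + 1 / ((n : ℝ) + 1) with hσ
    rw [hr.iteratedDeriv_scaledMoment hN hκ0 hκ ha M (by rw [ofReal_re, hσ]; linarith) 0
      (by simp), zero_smul, hr.zero hN hζ hδ, show (σ : ℂ) - M = ((σ - M : ℝ) : ℂ) by push_cast; rfl,
      moment_zero hN hζ a M (by rw [hσ]; linarith), Finset.mul_sum, Finset.mul_sum, Finset.sum_div]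
    refine Finset.sum_congr rfl fun l _ => ?_
    have hG : Gamma ((σ : ℂ) + 1 - M) ≠ 0 := Gamma_ne_zero_of_re_pos (by
      simp only [sub_re, add_re, ofReal_re, one_re, natCast_re]; linarith)
    have hM : (M.factorial : ℂ) ≠ 0 := Nat.cast_ne_zero.2 M.factorial_ne_zero
    push_cast
    rw [show (σ : ℂ) - M + 1 = σ + 1 - M by ring,
      show (sumL l : ℂ) / N + ((σ : ℂ) + 1 - M) = σ + 1 + sumL l / N - M by ring]
    field_simp

end SeibergWitten

namespace SeibergWitten

open Complex Set MeasureTheory Filter Topology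

/-! ### The binomial expansion of the integral of `λ` -/

/-- The derivative of `p` along the segment from `0` to `z`. -/
noncomputable def rayDeriv {N : ℕ} (a : Fin (N - 2) → ℂ) (z : ℂ) (t : ℝ) : ℂ :=
  (N * (t * z) ^ (N - 1) - perturb' a (t * z)) * z

theorem hasDerivAt_scaledPoly_ray {N : ℕ} (a : Fin (N - 2) → ℂ) (z : ℂ) (t : ℝ) :
    HasDerivAt (fun t : ℝ => scaledPoly a (t * z)) (rayDeriv a z t) t :=
  HasDerivAt.comp (h₂ := scaledPoly a) (h := fun t : ℝ => (t : ℂ) * z) t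
    (hasDerivAt_scaledPoly a (t * z)) (hasDerivAt_ray z t)

theorem continuous_rayDeriv {N : ℕ} (a : Fin (N - 2) → ℂ) (z : ℂ) :
    Continuous (rayDeriv a z) := by
  unfold rayDeriv perturb'; fun_prop

/-- The factor `z t p' / √p` of the integrand. -/
noncomputable def rayKernel {N : ℕ} (a : Fin (N - 2) → ℂ) (z : ℂ) (t : ℝ) : ℂ :=
  z * t * rayDeriv a z t * scaledPoly a (t * z) ^ (-(1 / 2) : ℂ)

section

variable {N : ℕ} {κ : ℝ} {a : Fin (N - 2) → ℂ} {z : ℂ}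

theorem Adapted.continuousOn_cpow_Ico (h : Adapted κ a z) (hN : N ≠ 0) (hκ : κ ≤ 1 / 2) (s : ℂ) :
    ContinuousOn (fun t : ℝ => scaledPoly a (t * z) ^ s) (Ico 0 1) := fun _ ht =>
  ((continuousAt_cpow_const (h.mem_slitPlane hN hκ ht)).comp
    (f := fun t : ℝ => scaledPoly a (t * z))
    (continuous_scaledPoly_ray a z).continuousAt).continuousWithinAt

theorem Adapted.continuousOn_rayKernel (h : Adapted κ a z) (hN : N ≠ 0) (hκ : κ ≤ 1 / 2) :
    ContinuousOn (rayKernel a z) (Ico 0 1) := by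
  refine ContinuousOn.mul ?_ (h.continuousOn_cpow_Ico hN hκ _)
  have := continuous_rayDeriv a z
  exact (by fun_prop : Continuous fun t : ℝ => z * t * rayDeriv a z t).continuousOn

theorem intervalIntegrable_of_continuousOn_Ico {f : ℝ → ℂ} {g : ℝ → ℝ}
    (hf : ContinuousOn f (Ico 0 1)) (hg : IntervalIntegrable g volume 0 1)
    (hfg : ∀ t ∈ Ico (0 : ℝ) 1, ‖f t‖ ≤ g t) : IntervalIntegrable f volume 0 1 := by
  rw [intervalIntegrable_iff_integrableOn_Ico_of_le zero_le_one] at hg ⊢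
  refine Integrable.mono' hg (hf.aestronglyMeasurable measurableSet_Ico) ?_
  exact (ae_restrict_iff' measurableSet_Ico).2 (Eventually.of_forall hfg)

/-- The bound `|p| ≥ Re p ≥ (1 - κ)(1 - t^N) ≥ (1 - t)/2` limits the singularity at the branch point
to `(1 - t)^(-1/2)`. -/
theorem Adapted.intervalIntegrable_rayKernel (h : Adapted κ a z) (hN : N ≠ 0)
    (hκ : κ ≤ 1 / 2) : IntervalIntegrable (rayKernel a z) volume 0 1 := by
  have hc := continuous_rayDeriv a z
  obtain ⟨B, hB⟩ := isCompact_Icc.exists_bound_of_continuousOn (s := Icc (0 : ℝ) 1)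
    (f := fun t : ℝ => z * t * rayDeriv a z t)
    (by fun_prop : Continuous fun t : ℝ => z * t * rayDeriv a z t).continuousOn
  have hB0 : 0 ≤ B := (norm_nonneg _).trans (hB 0 (by simp))
  have hg := intervalIntegrable_beta (p := 1) (q := 1 / 2) one_pos one_half_pos
  refine intervalIntegrable_of_continuousOn_Ico (h.continuousOn_rayKernel hN hκ)
    (hg.const_mul (B * (1 / 2) ^ (-(1 / 2) : ℝ))) fun t ht => ?_
  have ht1 : 0 < 1 - t := by linarith [ht.2]
  have htN : t ^ N ≤ t := pow_le_of_le_one ht.1 ht.2.le hN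
  have hP : 1 / 2 * (1 - t) ≤ ‖scaledPoly a (t * z)‖ := by
    have h1 := h.re_ge (Ico_subset_Icc_self ht)
    have h2 := re_le_norm (scaledPoly a (t * z))
    nlinarith
  rw [rayKernel, norm_mul, sub_self, Real.rpow_zero, one_mul]
  have h3 : ‖scaledPoly a (t * z) ^ (-(1 / 2) : ℂ)‖ ≤
      (1 / 2 : ℝ) ^ (-(1 / 2) : ℝ) * (1 - t) ^ (1 / 2 - 1 : ℝ) := by
    have e : (-(1 / 2) : ℂ) = ((-(1 / 2) : ℝ) : ℂ) := by push_cast; ring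
    rw [e, norm_cpow_real, show (1 / 2 - 1 : ℝ) = -(1 / 2) by norm_num,
      ← Real.mul_rpow (by norm_num) ht1.le]
    exact Real.rpow_le_rpow_of_nonpos (by positivity) hP (by norm_num)
  rw [mul_assoc B]
  exact mul_le_mul (hB t (Ico_subset_Icc_self ht)) h3 (norm_nonneg _) hB0

/-- Integration by parts against `z t p^(k + 1/2)`, which vanishes at both ends: at `0` because of
`t`, at the zero because of `p`. -/
theorem Adapted.integral_rayKernel_mul_pow (h : Adapted κ a z) (hN : N ≠ 0) (hκ : κ ≤ 1 / 2)
    (k : ℕ) : ∫ t in (0 : ℝ)..1, rayKernel a z t * scaledPoly a (t * z) ^ k =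
      -(1 / ((k : ℂ) + 1 / 2)) * moment 1 (k + 1 / 2) a z := by
  set s : ℂ := k + 1 / 2 with hs
  have hsre : 0 < s.re := by
    simp only [hs, add_re, natCast_re]; norm_num; positivity
  have hs0 : s ≠ 0 := fun h => by rw [h] at hsre; simp at hsre
  have hP : ContinuousOn (fun t : ℝ => scaledPoly a (t * z) ^ s) (Icc 0 1) :=
    h.continuousOn_cpow hκ hsre
  have hi1 : IntervalIntegrable (fun t => rayKernel a z t * scaledPoly a (t * z) ^ k) volume 0 1 :=
    (h.intervalIntegrable_rayKernel hN hκ).mul_continuousOn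
      ((continuous_scaledPoly_ray a z).pow k).continuousOn
  have hi2 : IntervalIntegrable (fun t : ℝ => z * scaledPoly a (t * z) ^ s) volume 0 1 :=
    (continuousOn_const.mul hP).intervalIntegrable_of_Icc zero_le_one
  have hder : ∀ t ∈ Ioo (0 : ℝ) 1, HasDerivAt (fun t : ℝ => z * t * scaledPoly a (t * z) ^ s)
      (z * scaledPoly a (t * z) ^ s + s * (rayKernel a z t * scaledPoly a (t * z) ^ k)) t := by
    intro t ht
    have hmem := h.mem_slitPlane hN hκ (Ioo_subset_Ico_self ht)
    have h1 : HasDerivAt (fun t : ℝ => z * (t : ℂ)) z t := by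
      simpa using (hasDerivAt_id t).ofReal_comp.const_mul z
    have h2 := h1.mul ((hasDerivAt_id (scaledPoly a (t * z))).cpow_const (c := s) hmem |>.comp t
      (hasDerivAt_scaledPoly_ray a z t))
    refine h2.congr_deriv ?_
    simp only [Function.comp, id, rayKernel]
    have e : s - 1 = -(1 / 2) + (k : ℂ) := by rw [hs]; ring
    rw [e, cpow_add (-(1 / 2)) (k : ℂ) (slitPlane_ne_zero hmem), cpow_natCast]
    ring
  have hF := intervalIntegral.integral_eq_sub_of_hasDerivAt_of_le zero_le_one
    ((by fun_prop : Continuous fun t : ℝ => z * (t : ℂ)).continuousOn.mul hP) hder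
    (hi2.add (hi1.const_mul s))
  rw [intervalIntegral.integral_add hi2 (hi1.const_mul s),
    intervalIntegral.integral_const_mul s] at hF
  have h1 : scaledPoly a (((1 : ℝ) : ℂ) * z) = 0 := by rw [ofReal_one, one_mul]; exact h.root
  dsimp only [Pi.mul_apply] at hF
  simp only [h1, zero_cpow hs0, ofReal_zero, mul_zero, zero_mul, sub_self] at hF
  have hm : moment 1 s a z = ∫ t in (0 : ℝ)..1, z * scaledPoly a (t * z) ^ s := by
    simp [moment]
  rw [← hm] at hF
  rw [eq_neg_of_add_eq_zero_left hF]
  generalize (∫ t in (0 : ℝ)..1, rayKernel a z t * scaledPoly a (t * z) ^ k) = x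
  field_simp

theorem Adapted.norm_lt_one (h : Adapted κ a z) (hκ0 : 0 ≤ κ) {v : ℂ} (hv : ‖v‖ * (1 + κ) < 2)
    {t : ℝ} (ht : t ∈ Icc (0 : ℝ) 1) : ‖v / 2 * scaledPoly a (t * z)‖ < 1 := by
  rw [norm_mul, norm_div, Complex.norm_two]
  have := mul_le_mul_of_nonneg_left (h.norm_le_ray hκ0 ht) (norm_nonneg v)
  linarith

theorem one_sub_mem_slitPlane {w : ℂ} (hw : ‖w‖ < 1) : 1 - w ∈ slitPlane := by
  refine mem_slitPlane_iff.2 (Or.inl ?_)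
  have := re_le_norm w
  rw [sub_re, one_re]
  linarith

theorem Adapted.intervalIntegrable_rayKernel_mul (h : Adapted κ a z) (hN : N ≠ 0) (hκ0 : 0 ≤ κ)
    (hκ : κ ≤ 1 / 2) {v : ℂ} (hv : ‖v‖ * (1 + κ) < 2) :
    IntervalIntegrable (fun t : ℝ => rayKernel a z t *
      (1 - v / 2 * scaledPoly a (t * z)) ^ (-(1 / 2) : ℂ)) volume 0 1 := by
  refine (h.intervalIntegrable_rayKernel hN hκ).mul_continuousOn fun t ht => ?_
  rw [uIcc_of_le zero_le_one] at ht
  refine ContinuousAt.continuousWithinAt ?_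
  exact (continuousAt_cpow_const (one_sub_mem_slitPlane (h.norm_lt_one hκ0 hv ht))).comp
    (f := fun t : ℝ => 1 - v / 2 * scaledPoly a (t * z))
    (continuous_const.sub (continuous_const.mul (continuous_scaledPoly_ray a z))).continuousAt

/-- The binomial series is integrated term by term; on the segment `|v p / 2|` is at most `‖v‖ (1 +
κ) / 2 < 1`, which provides the dominating geometric factor. -/
theorem Adapted.hasSum_integral (h : Adapted κ a z) (hN : N ≠ 0) (hκ0 : 0 ≤ κ)
    (hκ : κ ≤ 1 / 2) {v : ℂ} (hv : ‖v‖ * (1 + κ) < 2) :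
    HasSum (fun k : ℕ => -((ascPochhammer ℂ k).eval (1 / 2) /
        (k.factorial * ((k : ℂ) + 1 / 2)) * (v / 2) ^ k * moment 1 (k + 1 / 2) a z))
      (∫ t in (0 : ℝ)..1, rayKernel a z t *
        (1 - v / 2 * scaledPoly a (t * z)) ^ (-(1 / 2) : ℂ)) := by
  have hI : uIoc (0 : ℝ) 1 = Ioc 0 1 := uIoc_of_le zero_le_one
  have hfi := h.intervalIntegrable_rayKernel hN hκ
  set q : ℝ := ‖v‖ * (1 + κ) / 2 with hq
  have hq0 : 0 ≤ q := by positivity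
  have hq1 : q < 1 := by rw [hq]; linarith
  set w : ℕ → ℂ := fun k => (ascPochhammer ℂ k).eval (1 / 2) / k.factorial with hw
  have hws : Summable fun k => ‖w k‖ * q ^ k := by
    have := ((hasSum_binomial_complex (1 / 2) (x := q)
      (by rwa [norm_real, Real.norm_of_nonneg hq0])).summable).norm
    refine this.congr fun k => ?_
    rw [norm_mul, norm_pow, norm_real, Real.norm_of_nonneg hq0]
  have key : HasSum (fun k => ∫ t in (0 : ℝ)..1, rayKernel a z t *
        (w k * (v / 2 * scaledPoly a (t * z)) ^ k))
      (∫ t in (0 : ℝ)..1, rayKernel a z t *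
        (1 - v / 2 * scaledPoly a (t * z)) ^ (-(1 / 2) : ℂ)) := by
    refine intervalIntegral.hasSum_integral_of_dominated_convergence
      (fun k t => ‖rayKernel a z t‖ * (‖w k‖ * q ^ k)) (fun k => ?_) (fun k => ?_) ?_ ?_ ?_
    · exact (hfi.def'.aestronglyMeasurable).mul (Continuous.aestronglyMeasurable
        (continuous_const.mul ((continuous_const.mul (continuous_scaledPoly_ray a z)).pow k)))
    · refine Filter.Eventually.of_forall fun t ht => ?_
      rw [hI] at ht
      rw [norm_mul (rayKernel a z t), norm_mul (w k), norm_pow]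
      have : ‖v / 2 * scaledPoly a (t * z)‖ ≤ q := by
        rw [norm_mul, norm_div, Complex.norm_two, hq]
        have := mul_le_mul_of_nonneg_left (h.norm_le_ray hκ0 (Ioc_subset_Icc_self ht))
          (norm_nonneg v)
        linarith
      gcongr
    · exact Filter.Eventually.of_forall fun t _ => hws.mul_left _
    · simp_rw [tsum_mul_left]
      exact hfi.norm.mul_const _
    · refine Filter.Eventually.of_forall fun t ht => ?_
      rw [hI] at ht
      exact (hasSum_binomial_complex (1 / 2)
        (h.norm_lt_one hκ0 hv (Ioc_subset_Icc_self ht))).mul_left _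
  refine hasSum_of_eq key fun k => ?_
  have e : ∫ t in (0 : ℝ)..1, rayKernel a z t * (w k * (v / 2 * scaledPoly a (t * z)) ^ k) =
      w k * (v / 2) ^ k * (-(1 / ((k : ℂ) + 1 / 2)) * moment 1 (k + 1 / 2) a z) := by
    rw [← h.integral_rayKernel_mul_pow hN hκ, ← intervalIntegral.integral_const_mul]
    congr 1
    ext t
    rw [mul_pow]
    ring
  rw [e, hw, ← div_div]
  ring

end

end SeibergWitten

namespace SeibergWitten

open Complex Set MeasureTheory Filter Topology

/-! ### The rescaled moduli and the lift of the segment -/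

/-- The rescaled moduli `v ^ (n / N - 1) u_n`. -/
noncomputable def scaledModuli {N : ℕ} (v : ℂ) (u : Fin (N - 2) → ℂ) (i : Fin (N - 2)) : ℂ :=
  u i * (v ^ (1 / (N : ℂ))) ^ (i.val + 1) / v

theorem cpow_one_div_pow {N : ℕ} (hN : N ≠ 0) (v : ℂ) : (v ^ (1 / (N : ℂ))) ^ N = v := by
  rw [one_div, cpow_nat_inv_pow v hN]

theorem cpow_half_sq (x : ℂ) : (x ^ (1 / 2 : ℂ)) ^ 2 = x := by
  have := cpow_one_div_pow two_ne_zero x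
  exact_mod_cast this

theorem norm_cpow_one_div (N : ℕ) (v : ℂ) : ‖v ^ (1 / (N : ℂ))‖ = ‖v‖ ^ (1 / (N : ℝ)) := by
  rw [← norm_cpow_real]; push_cast; rfl

theorem norm_scaledModuli {N : ℕ} {v : ℂ} (hv : v ≠ 0) (u : Fin (N - 2) → ℂ) (i : Fin (N - 2)) :
    ‖scaledModuli v u i‖ = ‖u i‖ / ‖v‖ ^ (1 - ((i.val : ℝ) + 1) / N) := by
  have hv0 : 0 < ‖v‖ := norm_pos_iff.2 hv
  rw [scaledModuli, norm_div, norm_mul, norm_pow, norm_cpow_one_div, Real.rpow_sub hv0,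
    Real.rpow_one, ← Real.rpow_mul_natCast hv0.le]
  push_cast
  rw [show 1 / (N : ℝ) * (i.val + 1) = ((i.val : ℝ) + 1) / N by ring]
  have : 0 < ‖v‖ ^ (((i.val : ℝ) + 1) / N) := Real.rpow_pos_of_pos hv0 _
  field_simp

theorem norm_scaledModuli_lt {N : ℕ} {ρ δ : ℝ} {u : Fin (N - 2) → ℂ} {v : ℂ}
    (h : v ∈ scalingDomain N ρ δ u) (i : Fin (N - 2)) : ‖scaledModuli v u i‖ < δ := by
  have hv := slitPlane_ne_zero h.1
  rw [norm_scaledModuli hv, div_lt_iff₀ (Real.rpow_pos_of_pos (norm_pos_iff.2 hv) _)]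
  exact h.2.2 i

/-- This is the scaling that removes the fractional powers: it gives `A² - 1 = -v p (2 - v p)`. -/
theorem eval_curvePoly {N : ℕ} (hN : N ≠ 0) {v : ℂ} (hv : v ≠ 0) (u : Fin (N - 2) → ℂ) (z : ℂ) :
    (curvePoly N (1 - v) u).eval (v ^ (1 / (N : ℂ)) * z) =
      -1 + v * scaledPoly (scaledModuli v u) z := by
  have h : ∑ i, v * (scaledModuli v u i * z ^ (i.val + 1)) =
      ∑ i, u i * (v ^ (1 / (N : ℂ)) * z) ^ (i.val + 1) := by
    refine Finset.sum_congr rfl fun i _ => ?_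
    rw [scaledModuli, mul_pow]
    field_simp
  simp only [curvePoly, Polynomial.eval_sub, Polynomial.eval_pow, Polynomial.eval_X,
    Polynomial.eval_C, Polynomial.eval_finsetSum, Polynomial.eval_mul, scaledPoly, perturb,
    mul_sub, Finset.mul_sum, h]
  rw [mul_pow, cpow_one_div_pow hN]
  ring

theorem eval_derivative_curvePoly {N : ℕ} (hN : N ≠ 0) {v : ℂ} (hv : v ≠ 0)
    (u : Fin (N - 2) → ℂ) (z : ℂ) (t : ℝ) :
    (curvePoly N (1 - v) u).derivative.eval ((t : ℂ) * (v ^ (1 / (N : ℂ)) * z)) *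
      (v ^ (1 / (N : ℂ)) * z) = v * rayDeriv (scaledModuli v u) z t := by
  set c := v ^ (1 / (N : ℂ)) with hc
  have h1 : HasDerivAt (fun t : ℝ => (curvePoly N (1 - v) u).eval ((t : ℂ) * (c * z)))
      ((curvePoly N (1 - v) u).derivative.eval ((t : ℂ) * (c * z)) * (c * z)) t :=
    HasDerivAt.comp (h₂ := fun x => (curvePoly N (1 - v) u).eval x)
      (h := fun t : ℝ => (t : ℂ) * (c * z)) t (Polynomial.hasDerivAt _ _)
      (hasDerivAt_ray (c * z) t)
  have h2 : HasDerivAt (fun t : ℝ => -1 + v * scaledPoly (scaledModuli v u) (t * z))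
      (v * rayDeriv (scaledModuli v u) z t) t :=
    ((hasDerivAt_scaledPoly_ray _ z t).const_mul v).const_add (-1)
  refine h1.unique (h2.congr_of_eventuallyEq (Eventually.of_forall fun t => ?_))
  simp only
  rw [← eval_curvePoly hN hv, ← hc]
  congr 1
  ring

theorem two_mul_cpow {x : ℂ} (hx : x ≠ 0) (s : ℂ) : (2 * x) ^ s = 2 ^ s * x ^ s := by
  have h := log_ofReal_mul (r := 2) two_pos hx
  rw [cpow_def_of_ne_zero (mul_ne_zero two_ne_zero hx), cpow_def_of_ne_zero two_ne_zero,
    cpow_def_of_ne_zero hx, ← Complex.exp_add, ← add_mul]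
  have h2 : Complex.log 2 = Real.log 2 := by rw [ofReal_log two_pos.le]; norm_num
  rw [h2, ← h]
  norm_num

/-- The lift of the segment from `0` to `z`. -/
noncomputable def segmentLift {N : ℕ} (v : ℂ) (a : Fin (N - 2) → ℂ) (z : ℂ) (t : ℝ) : ℂ :=
  -I * v ^ (1 / 2 : ℂ) * scaledPoly a (t * z) ^ (1 / 2 : ℂ) *
    (2 - v * scaledPoly a (t * z)) ^ (1 / 2 : ℂ)

theorem two_sub_eq (x v : ℂ) : 2 - v * x = 2 * (1 - v / 2 * x) := by ring

section

variable {N : ℕ} {κ : ℝ} {v : ℂ} {u : Fin (N - 2) → ℂ} {z : ℂ}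

theorem scaledPoly_at_zero (hN : N ≠ 0) (a : Fin (N - 2) → ℂ) : scaledPoly a 0 = 1 := by
  simp [scaledPoly, perturb, hN]

/-- Along the segment `p` has nonnegative real part and `2 - v p` has positive real part, so neither
principal square root meets its cut. The product of the roots is continuous and starts at `basePoint
v`. -/
theorem Adapted.isLift (h : Adapted κ (scaledModuli v u) z) (hN : N ≠ 0) (hκ0 : 0 ≤ κ)
    (hκ : κ ≤ 1 / 2) (hv0 : v ≠ 0) (hv : ‖v‖ * (1 + κ) < 2) :
    IsLift (curvePoly N (1 - v) u) (v ^ (1 / (N : ℂ)) * z) (basePoint v)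
      (segmentLift v (scaledModuli v u) z) := by
  have hne : ∀ t ∈ Icc (0 : ℝ) 1, 1 - v / 2 * scaledPoly (scaledModuli v u) (t * z) ∈ slitPlane :=
    fun t ht => one_sub_mem_slitPlane (h.norm_lt_one hκ0 hv ht)
  refine ⟨?_, ?_, fun t ht => ?_, fun t ht => ?_⟩
  · refine (continuousOn_const.mul (h.continuousOn_cpow hκ (by norm_num))).mul fun t ht => ?_
    have h1 : 2 - v * scaledPoly (scaledModuli v u) (t * z) ∈ slitPlane := by
      have h2 := (re_le_norm _).trans_lt (h.norm_lt_one hκ0 hv ht)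
      rw [two_sub_eq]
      refine mem_slitPlane_iff.2 (Or.inl ?_)
      rw [mul_re, re_ofNat, im_ofNat, zero_mul, sub_zero, sub_re, one_re]
      linarith
    exact ((continuousAt_cpow_const h1).comp
      (f := fun t : ℝ => 2 - v * scaledPoly (scaledModuli v u) (t * z))
      (continuous_const.sub (continuous_const.mul
        (continuous_scaledPoly_ray _ z))).continuousAt).continuousWithinAt
  · simp [segmentLift, basePoint, scaledPoly_at_zero hN]
  · rw [segmentLift, mul_pow, mul_pow, mul_pow, cpow_half_sq, cpow_half_sq, cpow_half_sq, mul_left_comm,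
      eval_curvePoly hN hv0, neg_sq, I_sq]
    ring
  · have h1 := slitPlane_ne_zero (h.mem_slitPlane hN hκ ht)
    have h2 : 2 - v * scaledPoly (scaledModuli v u) (t * z) ≠ 0 := by
      rw [two_sub_eq]
      exact mul_ne_zero two_ne_zero (slitPlane_ne_zero (hne t (Ico_subset_Icc_self ht)))
    rw [segmentLift]
    refine mul_ne_zero (mul_ne_zero (mul_ne_zero (neg_ne_zero.2 I_ne_zero) ?_) ?_) ?_ <;>
    exact fun hx => by rw [cpow_eq_zero_iff] at hx; exact absurd hx.1 (by assumption)

theorem Adapted.pullback_eq (h : Adapted κ (scaledModuli v u) z) (hN : N ≠ 0) (hκ0 : 0 ≤ κ)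
    (hκ : κ ≤ 1 / 2) (hv0 : v ≠ 0) (hv : ‖v‖ * (1 + κ) < 2) {t : ℝ} (ht : t ∈ Ico (0 : ℝ) 1) :
    pullbackDifferential (curvePoly N (1 - v) u) (v ^ (1 / (N : ℂ)) * z)
      (segmentLift v (scaledModuli v u) z) t =
      I * (v ^ (1 / (N : ℂ)) * v ^ (1 / 2 : ℂ) / 2 ^ (1 / 2 : ℂ)) *
        (rayKernel (scaledModuli v u) z t *
          (1 - v / 2 * scaledPoly (scaledModuli v u) (t * z)) ^ (-(1 / 2) : ℂ)) := by
  have h1 := slitPlane_ne_zero (h.mem_slitPlane hN hκ ht)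
  have h2 := slitPlane_ne_zero (one_sub_mem_slitPlane
    (h.norm_lt_one hκ0 hv (Ico_subset_Icc_self ht)))
  have hd := eval_derivative_curvePoly hN hv0 u z t
  have hsq := cpow_half_sq v
  rw [pullbackDifferential, div_mul_eq_mul_div, mul_assoc _ (Polynomial.eval _ _), hd,
    segmentLift, rayKernel, two_sub_eq, two_mul_cpow h2, cpow_neg, cpow_neg]
  have n1 : scaledPoly (scaledModuli v u) (t * z) ^ (1 / 2 : ℂ) ≠ 0 := fun hx =>
    h1 ((cpow_eq_zero_iff _ _).1 hx).1
  have n2 : (1 - v / 2 * scaledPoly (scaledModuli v u) (t * z)) ^ (1 / 2 : ℂ) ≠ 0 := fun hx =>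
    h2 ((cpow_eq_zero_iff _ _).1 hx).1
  have n3 : v ^ (1 / 2 : ℂ) ≠ 0 := fun hx => hv0 ((cpow_eq_zero_iff _ _).1 hx).1
  have n4 : (2 : ℂ) ^ (1 / 2 : ℂ) ≠ 0 := fun hx => two_ne_zero ((cpow_eq_zero_iff _ _).1 hx).1
  generalize scaledPoly (scaledModuli v u) (t * z) ^ (1 / 2 : ℂ) = p at *
  generalize (1 - v / 2 * scaledPoly (scaledModuli v u) (t * z)) ^ (1 / 2 : ℂ) = q at *
  generalize v ^ (1 / 2 : ℂ) = w at *
  generalize (2 : ℂ) ^ (1 / 2 : ℂ) = s at *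
  have hI := I_ne_zero
  have hI2 := I_sq
  rw [← hsq]
  field_simp
  rw [hI2]
  ring

theorem Adapted.intervalIntegrable_pullback (h : Adapted κ (scaledModuli v u) z) (hN : N ≠ 0)
    (hκ0 : 0 ≤ κ) (hκ : κ ≤ 1 / 2) (hv0 : v ≠ 0) (hv : ‖v‖ * (1 + κ) < 2) :
    IntervalIntegrable (pullbackDifferential (curvePoly N (1 - v) u) (v ^ (1 / (N : ℂ)) * z)
      (segmentLift v (scaledModuli v u) z)) volume 0 1 := by
  have h1 := (h.intervalIntegrable_rayKernel_mul hN hκ0 hκ hv).const_mul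
    (I * (v ^ (1 / (N : ℂ)) * v ^ (1 / 2 : ℂ) / 2 ^ (1 / 2 : ℂ)))
  rw [intervalIntegrable_iff_integrableOn_Ico_of_le zero_le_one] at h1 ⊢
  exact h1.congr_fun (fun t ht => (h.pullback_eq hN hκ0 hκ hv0 hv ht).symm) measurableSet_Ico

theorem Adapted.abelianIntegral_eq (h : Adapted κ (scaledModuli v u) z) (hN : N ≠ 0)
    (hκ0 : 0 ≤ κ) (hκ : κ ≤ 1 / 2) (hv0 : v ≠ 0) (hv : ‖v‖ * (1 + κ) < 2) :
    abelianIntegral (curvePoly N (1 - v) u) (v ^ (1 / (N : ℂ)) * z) (basePoint v) =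
      I * (v ^ (1 / (N : ℂ)) * v ^ (1 / 2 : ℂ) / 2 ^ (1 / 2 : ℂ)) *
        ∫ t in (0 : ℝ)..1, rayKernel (scaledModuli v u) z t *
          (1 - v / 2 * scaledPoly (scaledModuli v u) (t * z)) ^ (-(1 / 2) : ℂ) := by
  have hl := h.isLift hN hκ0 hκ hv0 hv
  -- The chosen lift agrees with the explicit one away from `t = 1`, by uniqueness; the endpoint
  -- does not affect the integral.
  have heq := (Classical.epsilon_spec (p := IsLift (curvePoly N (1 - v) u)
    (v ^ (1 / (N : ℂ)) * z) (basePoint v)) ⟨_, hl⟩).eqOn hl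
  rw [abelianIntegral, ← intervalIntegral.integral_const_mul,
    intervalIntegral.integral_of_le zero_le_one, intervalIntegral.integral_of_le zero_le_one,
    ← integral_Ico_eq_integral_Ioc, ← integral_Ico_eq_integral_Ioc]
  refine setIntegral_congr_fun measurableSet_Ico fun t ht => ?_
  rw [← h.pullback_eq hN hκ0 hκ hv0 hv ht]
  simp only [pullbackDifferential, heq ht]

end

/-! ### The small branch point -/

theorem isSmallBranchPoint_iff {N : ℕ} (hN : N ≠ 0) {ζ v : ℂ} (hv : v ≠ 0)
    {u : Fin (N - 2) → ℂ} {κ δ : ℝ} {zr : (Fin (N - 2) → ℂ) → ℂ} (hr : IsRootFun N ζ κ δ zr)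
    (ha : ∀ i, ‖scaledModuli v u i‖ < δ) (x : ℂ) :
    IsSmallBranchPoint N ζ v u x ↔ x = v ^ (1 / (N : ℂ)) * zr (scaledModuli v u) := by
  have hc : v ^ (1 / (N : ℂ)) ≠ 0 := fun hx => hv ((cpow_eq_zero_iff _ _).1 hx).1
  have hc0 : 0 < ‖v ^ (1 / (N : ℂ))‖ := norm_pos_iff.2 hc
  have key : ∀ z, IsSmallBranchPoint N ζ v u (v ^ (1 / (N : ℂ)) * z) ↔
      scaledPoly (scaledModuli v u) z = 0 ∧ ‖z - ζ‖ < 1 / N := fun z => by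
    rw [IsSmallBranchPoint, eval_curvePoly hN hv, ← mul_sub, norm_mul,
      mul_lt_mul_iff_right₀ hc0]
    simp [hv]
  constructor
  · intro hx
    obtain ⟨z, rfl⟩ : ∃ z, x = v ^ (1 / (N : ℂ)) * z := ⟨x / v ^ (1 / (N : ℂ)), by field_simp⟩
    obtain ⟨h1, h2⟩ := (key z).1 hx
    rw [hr.unique _ ha z h2 h1]
  · rintro rfl
    exact (key _).2 ⟨hr.root _ ha, hr.near _ ha⟩

section

variable {N : ℕ} {ζ v : ℂ} {u : Fin (N - 2) → ℂ} {κ δ : ℝ} {zr : (Fin (N - 2) → ℂ) → ℂ}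

theorem smallBranchPoint_eq (hN : N ≠ 0) (hv : v ≠ 0) (hr : IsRootFun N ζ κ δ zr)
    (ha : ∀ i, ‖scaledModuli v u i‖ < δ) :
    smallBranchPoint N ζ v u = v ^ (1 / (N : ℂ)) * zr (scaledModuli v u) :=
  (isSmallBranchPoint_iff hN hv hr ha _).1 (Classical.epsilon_spec
    (p := IsSmallBranchPoint N ζ v u) ⟨_, (isSmallBranchPoint_iff hN hv hr ha _).2 rfl⟩)

theorem rWellDefined (hN : N ≠ 0) (hv0 : v ≠ 0) (hr : IsRootFun N ζ κ δ zr)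
    (ha : ∀ i, ‖scaledModuli v u i‖ < δ) (hκ0 : 0 ≤ κ) (hκ : κ ≤ 1 / 2)
    (hv : ‖v‖ * (1 + κ) < 2) : RWellDefined N ζ v u := by
  refine ⟨⟨_, (isSmallBranchPoint_iff hN hv0 hr ha _).2 rfl,
    fun x hx => (isSmallBranchPoint_iff hN hv0 hr ha _).1 hx⟩, ?_⟩
  rw [smallBranchPoint_eq hN hv0 hr ha]
  exact ⟨_, (hr.adapted ha).isLift hN hκ0 hκ hv0 hv,
    (hr.adapted ha).intervalIntegrable_pullback hN hκ0 hκ hv0 hv⟩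

/-- The expansion of `R(ζ)` in powers of `v` at fixed rescaled moduli. -/
theorem hasSum_R (hN : N ≠ 0) (hv0 : v ≠ 0) (hr : IsRootFun N ζ κ δ zr)
    (ha : ∀ i, ‖scaledModuli v u i‖ < δ) (hκ0 : 0 ≤ κ) (hκ : κ ≤ 1 / 2)
    (hv : ‖v‖ * (1 + κ) < 2) :
    HasSum (fun k : ℕ => -(v ^ (1 / (N : ℂ)) * v ^ (1 / 2 : ℂ) / (2 ^ (1 / 2 : ℂ) * Real.pi)) *
        ((ascPochhammer ℂ k).eval (1 / 2) / (k.factorial * ((k : ℂ) + 1 / 2)) * (v / 2) ^ k *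
          moment 1 (k + 1 / 2) (scaledModuli v u) (zr (scaledModuli v u))))
      (R N ζ v u) := by
  have h := hr.adapted ha
  have e : R N ζ v u = v ^ (1 / (N : ℂ)) * v ^ (1 / 2 : ℂ) / (2 ^ (1 / 2 : ℂ) * Real.pi) *
      ∫ t in (0 : ℝ)..1, rayKernel (scaledModuli v u) (zr (scaledModuli v u)) t *
        (1 - v / 2 * scaledPoly (scaledModuli v u) (t * zr (scaledModuli v u))) ^
          (-(1 / 2) : ℂ) := by
    rw [R, smallBranchPoint_eq hN hv0 hr ha, h.abelianIntegral_eq hN hκ0 hκ hv0 hv]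
    rw [mul_assoc I, mul_div_mul_left _ _ I_ne_zero, ← div_div _ _ (Real.pi : ℂ)]
    ring
  rw [e]
  exact hasSum_of_eq ((h.hasSum_integral hN hκ0 hκ hv).mul_left _) fun k => by ring

end

end SeibergWitten

namespace SeibergWitten

open Complex Set MeasureTheory Filter Topology

/-! ### Holomorphy of `R(ζ)` -/

theorem isOpen_scalingDomain {N : ℕ} (ρ δ : ℝ) (u : Fin (N - 2) → ℂ) :
    IsOpen (scalingDomain N ρ δ u) := by
  have h : scalingDomain N ρ δ u = slitPlane ∩ ({v | ‖v‖ < ρ} ∩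
      ⋂ i : Fin (N - 2), {v | ‖u i‖ < δ * ‖v‖ ^ (1 - ((i.val : ℝ) + 1) / N)}) := by
    ext v
    simp [scalingDomain]
    tauto
  rw [h]
  refine isOpen_slitPlane.inter ((isOpen_lt continuous_norm continuous_const).inter
    (isOpen_iInter_of_finite fun i => isOpen_lt continuous_const (continuous_const.mul ?_)))
  refine continuous_norm.rpow_const fun v => Or.inr ?_
  have hi := i.2
  have hN : (0 : ℝ) < N := by exact_mod_cast (by omega)
  rw [sub_nonneg, div_le_one hN]
  exact_mod_cast (by omega : i.val + 1 ≤ N)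

theorem differentiableOn_cpow_slitPlane (s : ℂ) :
    DifferentiableOn ℂ (fun v : ℂ => v ^ s) slitPlane := fun _ hv =>
  (differentiableAt_id.cpow_const hv).differentiableWithinAt

theorem differentiableOn_scaledModuli {N : ℕ} (u : Fin (N - 2) → ℂ) (i : Fin (N - 2)) :
    DifferentiableOn ℂ (fun v => scaledModuli v u i) slitPlane := by
  unfold scaledModuli
  refine DifferentiableOn.div (((differentiableOn_cpow_slitPlane _).pow _).const_mul _)
    differentiableOn_id fun v hv => slitPlane_ne_zero hv

/-- The coefficients of the expansion of `R(ζ)`. -/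
noncomputable def periodCoeff (k : ℕ) : ℂ :=
  (ascPochhammer ℂ k).eval (1 / 2) / (k.factorial * ((k : ℂ) + 1 / 2))

theorem summable_norm_periodCoeff {q : ℝ} (hq0 : 0 ≤ q) (hq1 : q < 1) :
    Summable fun k => ‖periodCoeff k‖ * q ^ k := by
  have h := ((hasSum_binomial_complex (1 / 2) (x := q)
    (by rwa [norm_real, Real.norm_of_nonneg hq0])).summable).norm
  refine Summable.of_nonneg_of_le (fun k => by positivity) (fun k => ?_) (h.mul_left 2)
  rw [periodCoeff, ← div_div, norm_div, norm_mul, norm_pow, norm_real, Real.norm_of_nonneg hq0]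
  have h2 : (1 : ℝ) / 2 ≤ ‖(k : ℂ) + 1 / 2‖ := by
    have := re_le_norm ((k : ℂ) + 1 / 2)
    have h3 : ((k : ℂ) + 1 / 2).re = k + 1 / 2 := by
      simp only [add_re, natCast_re]; norm_num
    rw [h3] at this
    have h4 : (0 : ℝ) ≤ k := Nat.cast_nonneg k
    linarith
  rw [div_mul_eq_mul_div, div_le_iff₀ (by linarith)]
  have h3 : 0 ≤ ‖(ascPochhammer ℂ k).eval (1 / 2) / (k.factorial : ℂ)‖ * q ^ k := by positivity
  nlinarith

theorem add_half_re_pos (k : ℕ) : 0 < ((k : ℂ) + 1 / 2).re := by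
  simp only [add_re, natCast_re]; norm_num; positivity

theorem Adapted.norm_term_le {N : ℕ} {κ : ℝ} {a : Fin (N - 2) → ℂ} {z : ℂ}
    (h : Adapted κ a z) (hκ0 : 0 ≤ κ) (k : ℕ) {v : ℂ} {ρ : ℝ} (hv : ‖v‖ ≤ ρ) :
    ‖periodCoeff k * (v / 2) ^ k * moment 1 (k + 1 / 2) a z‖ ≤
      2 * (1 + κ) ^ (1 / 2 : ℝ) * (‖periodCoeff k‖ * (ρ * (1 + κ) / 2) ^ k) := by
  have h1 := h.norm_moment_le hκ0 (s := (k : ℝ) + 1 / 2) (by positivity)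
  push_cast at h1
  rw [Real.rpow_add (by linarith), Real.rpow_natCast] at h1
  have hρ := (norm_nonneg v).trans hv
  rw [norm_mul, norm_mul, norm_pow, norm_div, Complex.norm_two]
  calc ‖periodCoeff k‖ * (‖v‖ / 2) ^ k * ‖moment 1 (k + 1 / 2) a z‖
      ≤ ‖periodCoeff k‖ * (ρ / 2) ^ k * (2 * ((1 + κ) ^ k * (1 + κ) ^ (1 / 2 : ℝ))) := by
        gcongr
    _ = _ := by
        rw [mul_div_right_comm, mul_pow]
        ring

/-- Holomorphy is read off from the series of `hasSum_R`, a locally uniform limit of holomorphic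
terms. This avoids differentiating an integrand that is singular at a moving branch point. -/
theorem differentiableOn_R {N : ℕ} (hN : N ≠ 0) {ζ : ℂ} {u : Fin (N - 2) → ℂ} {κ δ ρ : ℝ}
    {zr : (Fin (N - 2) → ℂ) → ℂ} (hr : IsRootFun N ζ κ δ zr) (hκ0 : 0 ≤ κ) (hκ : κ ≤ 1 / 2)
    (hρ0 : 0 ≤ ρ) (hρ : ρ * (1 + κ) < 2) :
    DifferentiableOn ℂ (fun v => R N ζ v u) (scalingDomain N ρ δ u) := by
  have hopen := isOpen_scalingDomain ρ δ u
  have hsub : scalingDomain N ρ δ u ⊆ slitPlane := fun v hv => hv.1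
  have ha : ∀ v ∈ scalingDomain N ρ δ u, ∀ i, ‖scaledModuli v u i‖ < δ :=
    fun v hv => norm_scaledModuli_lt hv
  have hsum : DifferentiableOn ℂ (fun v => ∑' k : ℕ, periodCoeff k * (v / 2) ^ k *
      moment 1 (k + 1 / 2) (scaledModuli v u) (zr (scaledModuli v u)))
      (scalingDomain N ρ δ u) := by
    refine differentiableOn_tsum_of_summable_norm (u := fun k =>
      2 * (1 + κ) ^ (1 / 2 : ℝ) * (‖periodCoeff k‖ * (ρ * (1 + κ) / 2) ^ k))
      ((summable_norm_periodCoeff (by positivity) (by linarith)).mul_left _) (fun k => ?_) hopen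
      fun k v hv => (hr.adapted (ha v hv)).norm_term_le hκ0 k hv.2.1.le
    refine DifferentiableOn.mul (by fun_prop) ?_
    exact hr.differentiableOn_moment hN hκ0 hκ hopen
      (fun i => (differentiableOn_scaledModuli u i).mono hsub) ha 1 (add_half_re_pos k)
  have hpref : DifferentiableOn ℂ (fun v : ℂ =>
      -(v ^ (1 / (N : ℂ)) * v ^ (1 / 2 : ℂ) / (2 ^ (1 / 2 : ℂ) * Real.pi)))
      (scalingDomain N ρ δ u) :=
    ((((differentiableOn_cpow_slitPlane _).mul
      (differentiableOn_cpow_slitPlane _)).div_const _).neg).mono hsub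
  refine (hpref.mul hsum).congr fun v hv => ?_
  have h := hasSum_R hN (slitPlane_ne_zero hv.1) hr (ha v hv) hκ0 hκ (by
    nlinarith [hv.2.1])
  rw [← h.tsum_eq, tsum_mul_left]
  rfl

end SeibergWitten

namespace SeibergWitten

open Complex Set MeasureTheory Filter Topology

/-! ### The terms of the expansion of `Q(ζ)` -/

theorem sin_mul_Gamma {s : ℝ} (hs : ∀ n : ℕ, s ≠ -n) :
    Real.sin (Real.pi * s) * Real.Gamma s = Real.pi * (Real.Gamma (1 - s))⁻¹ := by
  have h := Real.Gamma_mul_Gamma_one_sub s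
  have h0 := Real.Gamma_ne_zero hs
  by_cases hsin : Real.sin (Real.pi * s) = 0
  · rw [hsin, div_zero, mul_eq_zero, or_iff_right h0] at h
    rw [hsin, h, zero_mul, inv_zero, mul_zero]
  · have h1 : Real.Gamma (1 - s) ≠ 0 := fun h1 => by
      rw [h1, mul_zero, eq_comm, div_eq_zero_iff, or_iff_left hsin] at h
      exact Real.pi_ne_zero h
    rw [eq_div_iff hsin] at h
    field_simp
    linear_combination h

/-- For `s = ζ^N = -1` the two hypergeometric factors of `Y` are `f₃` and `f₄`. Reflection replaces
`cos(πα) Γ(α + 1/2)` and `sin(πα) Γ(α)` by `π / Γ(1/2 - α)` and `π / Γ(1 - α)`, and the result is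
the combination found in `hSol_eq`. -/
theorem Y_neg_one_eq {α : ℝ} (h1 : ∀ n : ℕ, α ≠ -n) (h2 : ∀ n : ℕ, α + 1 / 2 ≠ -n) {v : ℂ}
    (hv : v ∈ Metric.ball (1 : ℂ) 1) :
    Y (-1) α (1 - v) = Real.pi * √Real.pi * hSol α v := by
  have e1 := sin_mul_Gamma h1
  have e2 := sin_mul_Gamma h2
  rw [mul_add, show Real.pi * (1 / 2) = Real.pi / 2 by ring, Real.sin_add_pi_div_two,
    show 1 - (α + 1 / 2) = 1 / 2 - α by ring] at e2
  have hs : (√Real.pi : ℂ) ^ 2 = Real.pi := by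
    rw [← ofReal_pow, Real.sq_sqrt Real.pi_pos.le]
  have e3 : Y (-1) α (1 - v) =
      (((Real.cos (Real.pi * α) * Real.Gamma (α + 1 / 2)) ^ 2 : ℝ) : ℂ) * f₃ α v +
      (((Real.sin (Real.pi * α) * Real.Gamma α) ^ 2 : ℝ) : ℂ) * f₄ α v := by
    rw [Y, f₃, f₄, mul_pow, mul_pow]
    ring
  rw [e3, e1, e2, hSol_eq α hv]
  push_cast
  rw [← Gamma_ofReal, ← Gamma_ofReal]
  push_cast
  linear_combination -((Gamma (1 / 2 - α))⁻¹ ^ 2 * f₃ α v + (Gamma (1 - α))⁻¹ ^ 2 * f₄ α v) *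
    Real.pi * hs

theorem two_alpha {N : ℕ} (hN : N ≠ 0) (l : Fin (N - 2) → ℕ) :
    2 * alpha l = sumM l - sumL l / N := by
  have : (N : ℝ) ≠ 0 := by exact_mod_cast hN
  rw [alpha]
  field_simp

theorem two_alpha_ofReal {N : ℕ} (hN : N ≠ 0) (l : Fin (N - 2) → ℕ) :
    2 * (alpha l : ℂ) = sumM l - sumL l / N := by
  have h := congrArg ofReal (two_alpha hN l)
  push_cast at h
  exact h

theorem sumL_zero {N : ℕ} : sumL (0 : Fin (N - 2) → ℕ) = 1 := by simp [sumL]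

theorem sumM_zero {N : ℕ} : sumM (0 : Fin (N - 2) → ℕ) = 0 := by simp [sumM]

theorem alpha_zero {N : ℕ} : alpha (0 : Fin (N - 2) → ℕ) = -(1 / (2 * N)) := by
  rw [alpha, sumL_zero, sumM_zero]
  push_cast
  ring

/-- The weights are at most `N - 2`, so `N M - ∑ j l_j ≥ 2M ≥ 2`. Consequently `alpha l` is negative
only for `l = 0`. -/
theorem sumL_lt {N : ℕ} {l : Fin (N - 2) → ℕ} (hl : l ≠ 0) : sumL l + 1 ≤ N * sumM l := by
  obtain ⟨j, hj⟩ := Function.ne_iff.1 hl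
  have h1 : ∑ i, ((i.val + 1) * l i + 2 * l i) ≤ ∑ i, N * l i := by
    refine Finset.sum_le_sum fun i _ => ?_
    rw [← add_mul]
    have := i.2
    exact Nat.mul_le_mul_right _ (by omega)
  rw [Finset.sum_add_distrib, ← Finset.mul_sum, ← Finset.mul_sum] at h1
  have h2 : l j ≤ ∑ i, l i := Finset.single_le_sum (fun _ _ => Nat.zero_le _) (Finset.mem_univ j)
  have h3 : l j ≠ 0 := hj
  rw [sumL, sumM]
  omega

theorem alpha_ge {N : ℕ} (hN : N ≠ 0) {l : Fin (N - 2) → ℕ} (hl : l ≠ 0) :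
    1 / (2 * N) ≤ alpha l := by
  have hN0 : (0 : ℝ) < N := by exact_mod_cast Nat.pos_of_ne_zero hN
  have h : (sumL l : ℝ) + 1 ≤ N * sumM l := by exact_mod_cast sumL_lt hl
  rw [alpha]
  gcongr
  linarith

theorem alpha_gt {N : ℕ} (hN : 3 ≤ N) (l : Fin (N - 2) → ℕ) : -(1 / 2) < alpha l := by
  have hN0 : (3 : ℝ) ≤ N := by exact_mod_cast hN
  by_cases hl : l = 0
  · rw [hl, alpha_zero, neg_lt_neg_iff]
    exact one_div_lt_one_div_of_lt two_pos (by linarith)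
  · have := alpha_ge (by omega) hl
    have h : (0 : ℝ) < 1 / (2 * N) := by positivity
    linarith

theorem alpha_ne_neg_nat {N : ℕ} (hN : 3 ≤ N) (l : Fin (N - 2) → ℕ) (n : ℕ) : alpha l ≠ -n := by
  have hN0 : (3 : ℝ) ≤ N := by exact_mod_cast hN
  intro h
  have h1 := alpha_gt hN l
  have h2 : (n : ℝ) < 1 := by linarith
  have h3 : n = 0 := by exact_mod_cast Nat.lt_one_iff.1 (by exact_mod_cast h2)
  rw [h3, Nat.cast_zero, neg_zero] at h
  have h4 : (0 : ℝ) < 1 / (2 * N) := by positivity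
  by_cases hl : l = 0
  · rw [hl, alpha_zero] at h
    linarith
  · have := alpha_ge (by omega) hl
    linarith

theorem alpha_add_half_ne_neg_nat {N : ℕ} (hN : 3 ≤ N) (l : Fin (N - 2) → ℕ) (n : ℕ) :
    alpha l + 1 / 2 ≠ -n := by
  have h1 := alpha_gt hN l
  have h2 : (0 : ℝ) ≤ n := Nat.cast_nonneg n
  linarith

theorem Gamma_one_half : Gamma (1 / 2) = √Real.pi := by
  rw [← Real.Gamma_one_half_eq, ← Gamma_ofReal]
  push_cast
  rfl

/-- The Gamma factor of the Beta integral cancels `1/(k + 1/2)` and supplies a second Pochhammer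
symbol, as the coefficients of `regF (1/2)` require. -/
theorem periodCoeff_mul_Gamma (k : ℕ) :
    periodCoeff k * Gamma ((k : ℂ) + 1 / 2 + 1) =
      √Real.pi * ((ascPochhammer ℂ k).eval (1 / 2) ^ 2 / k.factorial) := by
  have h0 : (k : ℂ) + 1 / 2 ≠ 0 := fun h => by
    have := add_half_re_pos k
    rw [h] at this
    simp at this
  have h1 := inv_Gamma_eq_ascPochhammer (1 / 2) k
  have h2 : Gamma (1 / 2 : ℂ) ≠ 0 := Gamma_ne_zero_of_re_pos (by norm_num)
  have h3 : Gamma (1 / 2 + (k : ℂ)) ≠ 0 := Gamma_ne_zero_of_re_pos (by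
    rw [add_comm]; exact add_half_re_pos k)
  have h4 : Gamma (1 / 2 + (k : ℂ)) = (ascPochhammer ℂ k).eval (1 / 2) * Gamma (1 / 2) := by
    rw [← div_eq_mul_inv, eq_div_iff h3, inv_mul_eq_iff_eq_mul₀ h2] at h1
    rw [h1, mul_comm]
  rw [Gamma_add_one _ h0, add_comm (k : ℂ), h4, Gamma_one_half, periodCoeff]
  rw [add_comm] at h0
  rw [add_comm (k : ℂ), ← div_div, div_mul_eq_mul_div, mul_left_comm, ← div_mul_eq_mul_div,
    div_self h0]
  ring

theorem prod_scaledModuli {N : ℕ} (v : ℂ) (u : Fin (N - 2) → ℂ) (l : Fin (N - 2) → ℕ) :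
    v ^ (1 / (N : ℂ)) * ∏ i, scaledModuli v u i ^ l i / ((l i).factorial : ℂ) =
      (v ^ (1 / (N : ℂ))) ^ sumL l / v ^ sumM l * ∏ i, u i ^ l i / ((l i).factorial : ℂ) := by
  have h : ∏ i, scaledModuli v u i ^ l i / ((l i).factorial : ℂ) =
      (v ^ (1 / (N : ℂ))) ^ (∑ i, (i.val + 1) * l i) / v ^ sumM l *
        ∏ i, u i ^ l i / ((l i).factorial : ℂ) := by
    rw [← Finset.prod_pow_eq_pow_sum, sumM, ← Finset.prod_pow_eq_pow_sum,
      ← Finset.prod_div_distrib, ← Finset.prod_mul_distrib]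
    refine Finset.prod_congr rfl fun i _ => ?_
    rw [scaledModuli, div_pow, mul_pow, ← pow_mul]
    ring
  rw [h, sumL, pow_add, pow_one]
  ring

/-- The powers of `v` from the prefactor and from the rescaled moduli combine to exponent `1/2 + L/N
- M`, the exponent of `hSol` at `v = 0`. -/
theorem cpow_combine {N : ℕ} (hN : N ≠ 0) {v : ℂ} (hv : v ≠ 0) (l : Fin (N - 2) → ℕ) :
    v ^ (1 / 2 : ℂ) * ((v ^ (1 / (N : ℂ))) ^ sumL l / v ^ sumM l) =
      v ^ (1 / 2 - 2 * (alpha l : ℂ)) := by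
  rw [two_alpha_ofReal hN, ← cpow_nat_mul, ← cpow_natCast, ← cpow_sub _ _ hv, ← cpow_add _ _ hv]
  congr 1
  ring

/-- Resummation of the terms of multi-index `l`. -/
theorem hasSum_QTerm {N : ℕ} (hN : 3 ≤ N) {ζ : ℂ} (hζ : ζ ^ N = -1) {v : ℂ}
    (hv : v ∈ Metric.ball (1 : ℂ) 1) (u : Fin (N - 2) → ℂ) (l : Fin (N - 2) → ℕ) :
    HasSum (fun k : ℕ => -(v ^ (1 / (N : ℂ)) * v ^ (1 / 2 : ℂ) / (2 ^ (1 / 2 : ℂ) * Real.pi)) *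
      (periodCoeff k * (v / 2) ^ k * ((-1) ^ sumM l / N *
        ((∏ i, scaledModuli v u i ^ l i / ((l i).factorial : ℂ)) * ζ ^ sumL l *
          Gamma ((sumL l : ℂ) / N) * (Gamma ((k : ℂ) + 1 / 2 + 1) *
            (Gamma ((k : ℂ) + 1 / 2 + 1 + (sumL l : ℂ) / N - sumM l))⁻¹)))))
      (QTerm N ζ (1 - v) u l) := by
  have hN0 : N ≠ 0 := by omega
  have hNC : (N : ℂ) ≠ 0 := by exact_mod_cast hN0
  have hv1 : ‖v - 1‖ < 1 := by simpa [dist_eq_norm] using hv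
  have hv0 : v ≠ 0 := slitPlane_ne_zero (mem_slitPlane_of_norm_sub_one_lt hv1)
  have hv2 := norm_lt_two_of_norm_sub_one_lt hv1
  have h2α : (2 : ℂ) * alpha l = sumM l - sumL l / N := two_alpha_ofReal hN0 l
  set C : ℂ := -((v ^ (1 / 2 : ℂ) * ((v ^ (1 / (N : ℂ))) ^ sumL l / v ^ sumM l)) /
    (2 ^ (1 / 2 : ℂ) * Real.pi)) * (√Real.pi * ((-1) ^ sumM l / N *
      ((∏ i, u i ^ l i / ((l i).factorial : ℂ)) * ζ ^ sumL l * Gamma ((sumL l : ℂ) / N)))) with hC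
  have hC' : QTerm N ζ (1 - v) u l =
      C * regF (1 / 2) (3 / 2 - 2 * (alpha l : ℂ)) (v / 2) := by
    have hpow : (((2 : ℝ) ^ ((sumM l : ℝ) - (sumL l : ℝ) / N) : ℝ) : ℂ) =
        2 ^ (2 * (alpha l : ℂ)) := by
      rw [← two_alpha hN0, ofReal_cpow two_pos.le]
      push_cast
      rfl
    have hζ' : ζ ^ (N * sumM l + sumL l + N) = -((-1) ^ sumM l * ζ ^ sumL l) := by
      rw [pow_add, pow_add, pow_mul, hζ]
      ring
    have hs : (√Real.pi : ℂ) ^ 2 = Real.pi := by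
      rw [← ofReal_pow, Real.sq_sqrt Real.pi_pos.le]
    have hpi : (Real.pi : ℂ) ≠ 0 := by exact_mod_cast Real.pi_ne_zero
    have h2 : (2 : ℂ) ^ (1 / 2 : ℂ) ≠ 0 := fun hx => two_ne_zero ((cpow_eq_zero_iff _ _).1 hx).1
    have h2' : (2 : ℂ) ^ (2 * (alpha l : ℂ)) ≠ 0 :=
      fun hx => two_ne_zero ((cpow_eq_zero_iff _ _).1 hx).1
    have hsq := cpow_half_sq 2
    have hG : ((Real.Gamma ((sumL l : ℝ) / N) : ℝ) : ℂ) = Gamma ((sumL l : ℂ) / N) := by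
      rw [← Gamma_ofReal]; push_cast; rfl
    rw [QTerm, hζ, Y_neg_one_eq (alpha_ne_neg_nat hN l) (alpha_add_half_ne_neg_nat hN l) hv,
      hSol, two_mul_cpow hv0, cpow_sub _ _ two_ne_zero, hζ', hG, hC, cpow_combine hN0 hv0]
    push_cast [hpow]
    generalize (2 : ℂ) ^ (2 * (alpha l : ℂ)) = y at *
    generalize (2 : ℂ) ^ (1 / 2 : ℂ) = x at *
    generalize v ^ (1 / 2 - 2 * (alpha l : ℂ)) = w at *
    generalize regF (1 / 2) (3 / 2 - 2 * (alpha l : ℂ)) (v / 2) = F at *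
    generalize Gamma ((sumL l : ℂ) / N) = G at *
    generalize ∏ i, u i ^ l i / ((l i).factorial : ℂ) = U at *
    field_simp
    linear_combination (-(ζ ^ sumL l * G * w * F * U)) * hsq
  rw [hC']
  refine hasSum_of_eq ((hasSum_regF (1 / 2) (3 / 2 - 2 * (alpha l : ℂ))
    (norm_half_lt hv2)).mul_left C) fun k => ?_
  have e : (k : ℂ) + 1 / 2 + 1 + (sumL l : ℂ) / N - sumM l =
      3 / 2 - 2 * (alpha l : ℂ) + k := by rw [h2α]; ring
  have hp := prod_scaledModuli v u l
  have hg := periodCoeff_mul_Gamma k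
  rw [e, regCoeff, hC]
  generalize v ^ (1 / (N : ℂ)) = c at *
  generalize ∏ i, scaledModuli v u i ^ l i / ((l i).factorial : ℂ) = p at *
  generalize c ^ sumL l / v ^ sumM l = K at *
  generalize ∏ i, u i ^ l i / ((l i).factorial : ℂ) = U at *
  generalize Gamma ((k : ℂ) + 1 / 2 + 1) = g at *
  have e2 : √Real.pi * ((ascPochhammer ℂ k).eval (1 / 2) ^ 2 / (k.factorial *
      Gamma (3 / 2 - 2 * (alpha l : ℂ) + k))) = periodCoeff k * g *
        (Gamma (3 / 2 - 2 * (alpha l : ℂ) + k))⁻¹ := by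
    rw [hg]; ring
  set T := -(v ^ (1 / 2 : ℂ) / (2 ^ (1 / 2 : ℂ) * Real.pi)) * (v / 2) ^ k * ((-1) ^ sumM l / N) *
    ζ ^ sumL l * Gamma ((sumL l : ℂ) / N) with hT
  linear_combination T * (periodCoeff k * g * (Gamma (3 / 2 - 2 * (alpha l : ℂ) + k))⁻¹) * hp -
    T * K * U * e2

/-! ### Exchange of the two summations and equality of `Q(ζ)` and `R(ζ)` -/

theorem mem_piAntidiag_iff_sumM {N : ℕ} (l : Fin (N - 2) → ℕ) (M : ℕ) :
    l ∈ Finset.univ.piAntidiag M ↔ sumM l = M := by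
  simp [Finset.mem_piAntidiag, sumM]

theorem hasSum_swap {F : ℕ → ℕ → ℂ} {g h : ℕ → ℂ} {s : ℂ}
    (hF : Summable fun x : ℕ × ℕ => F x.1 x.2) (hrow : ∀ k, HasSum (F k) (g k))
    (hg : HasSum g s) (hcol : ∀ M, HasSum (fun k => F k M) (h M)) : HasSum h s := by
  have h1 : HasSum (fun x : ℕ × ℕ => F x.1 x.2) s := by
    rw [hg.unique (hF.hasSum.prod_fiberwise hrow)]
    exact hF.hasSum
  exact ((Equiv.prodComm ℕ ℕ).hasSum_iff.2 h1).prod_fiberwise hcol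

theorem summable_double {N : ℕ} (hN : N ≠ 0) {ζ : ℂ} {a : Fin (N - 2) → ℂ} {κ δ : ℝ}
    {zr : (Fin (N - 2) → ℂ) → ℂ} (hr : IsRootFun N ζ κ δ zr) (ha : ∀ i, ‖a i‖ < δ / 3)
    (hκ0 : 0 ≤ κ) (hκ : κ ≤ 1 / 2) {v : ℂ} (hv : ‖v‖ * (1 + κ) < 2) (A : ℂ) :
    Summable fun x : ℕ × ℕ => A * (periodCoeff x.1 * (v / 2) ^ x.1 *
      (iteratedDeriv x.2 (scaledMoment zr a ((x.1 : ℂ) + 1 / 2)) 0 / x.2.factorial)) := by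
  have hq : ‖v‖ * (1 + κ) / 2 < 1 := by linarith
  have hq0 : 0 ≤ ‖v‖ * (1 + κ) / 2 := by positivity
  have h1 := (summable_norm_periodCoeff hq0 hq).mul_of_nonneg
    (summable_geometric_of_lt_one (by norm_num) (by norm_num : (1 / 2 : ℝ) < 1))
    (fun k => by positivity) (fun M => by positivity)
  refine Summable.of_norm_bounded (h1.mul_left (‖A‖ * (2 * (1 + κ) ^ (1 / 2 : ℝ))))
    fun x => ?_
  have h2 := hr.norm_coeff_le hN hκ0 hκ ha (s := (x.1 : ℝ) + 1 / 2) (by positivity) x.2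
  push_cast at h2
  rw [Real.rpow_add (by linarith), Real.rpow_natCast] at h2
  rw [norm_mul, norm_mul, norm_mul, norm_pow, norm_div v, Complex.norm_two]
  calc _ ≤ ‖A‖ * (‖periodCoeff x.1‖ * (‖v‖ / 2) ^ x.1 *
        (2 * ((1 + κ) ^ x.1 * (1 + κ) ^ (1 / 2 : ℝ)) * (1 / 2) ^ x.2)) := by gcongr
    _ = _ := by
      rw [mul_div_right_comm, mul_pow]
      ring

/-- The expansion of `R(ζ)` in total degree of the moduli. -/
theorem hasSum_sum_QTerm {N : ℕ} (hN : 3 ≤ N) {ζ : ℂ} (hζ : ζ ^ N = -1) {v : ℂ}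
    (hv : v ∈ Metric.ball (1 : ℂ) 1) {u : Fin (N - 2) → ℂ} {κ δ : ℝ} (hδ : 0 < δ)
    {zr : (Fin (N - 2) → ℂ) → ℂ} (hr : IsRootFun N ζ κ δ zr)
    (ha : ∀ i, ‖scaledModuli v u i‖ < δ / 3) (hκ0 : 0 ≤ κ) (hκ : κ ≤ 1 / 2)
    (hvκ : ‖v‖ * (1 + κ) < 2) :
    HasSum (fun M : ℕ => ∑ l ∈ Finset.univ.piAntidiag M, QTerm N ζ (1 - v) u l)
      (R N ζ v u) := by
  have hN0 : N ≠ 0 := by omega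
  have hv1 : ‖v - 1‖ < 1 := by simpa [dist_eq_norm] using hv
  have hv0 : v ≠ 0 := slitPlane_ne_zero (mem_slitPlane_of_norm_sub_one_lt hv1)
  have ha' : ∀ i, ‖scaledModuli v u i‖ < δ := fun i => (ha i).trans (by linarith)
  refine hasSum_swap (summable_double hN0 hr ha hκ0 hκ hvκ _) (fun k =>
    ((hr.hasSum_scaledMoment hN0 hκ0 hκ ha (add_half_re_pos k)).mul_left _).mul_left _)
    (hasSum_R hN0 hv0 hr ha' hκ0 hκ hvκ) fun M => ?_
  refine hasSum_of_eq (hasSum_sum fun l _ => hasSum_QTerm hN hζ hv u l) fun k => ?_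
  rw [hr.coeff_eq hN0 hζ hδ hκ0 hκ ha M (add_half_re_pos k), Finset.mul_sum, Finset.mul_sum,
    Finset.mul_sum]
  refine Finset.sum_congr rfl fun l hl => ?_
  rw [(mem_piAntidiag_iff_sumM l M).1 hl, periodCoeff]

/-- The expansion of `R` is grouped by total degree. Summability over all multi-indices, obtained
independently, allows `Q` to be grouped in the same way. -/
theorem Q_eq_R {N : ℕ} (hN : 3 ≤ N) {ζ : ℂ} (hζ : ζ ^ N = -1) {v : ℂ}
    (hv : v ∈ Metric.ball (1 : ℂ) 1) {u : Fin (N - 2) → ℂ} {κ δ : ℝ} (hδ : 0 < δ)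
    {zr : (Fin (N - 2) → ℂ) → ℂ} (hr : IsRootFun N ζ κ δ zr)
    (ha : ∀ i, ‖scaledModuli v u i‖ < δ / 3) (hκ0 : 0 ≤ κ) (hκ : κ ≤ 1 / 2)
    (hvκ : ‖v‖ * (1 + κ) < 2) (hQ : Summable (QTerm N ζ (1 - v) u)) :
    Q N ζ (1 - v) u = R N ζ v u := by
  refine (hQ.hasSum.tsum_fiberwise sumM).unique ?_
  refine hasSum_of_eq (hasSum_sum_QTerm hN hζ hv hδ hr ha hκ0 hκ hvκ) fun M => ?_
  have hset : (sumM ⁻¹' {M} : Set (Fin (N - 2) → ℕ)) =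
      ((Finset.univ.piAntidiag M : Finset (Fin (N - 2) → ℕ)) : Set (Fin (N - 2) → ℕ)) := by
    ext l
    rw [Finset.mem_coe, mem_piAntidiag_iff_sumM, mem_preimage, mem_singleton_iff]
  rw [hset, Finset.tsum_subtype']

end SeibergWitten

namespace SeibergWitten

open Complex Set MeasureTheory Filter Topology

/-! ### Estimates of the Gamma function -/

/-- Both `a + 1` and `b + 1` lie between `1` and `a + b + 1`. Log-convexity with `Γ(1) = 1` bounds
their Gamma values by powers of `Γ(a + b + 1)` whose exponents add up to one. -/
theorem Gamma_add_one_mul_Gamma_add_one_le {a b : ℝ} (ha : 0 < a) (hb : 0 < b) :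
    Real.Gamma (a + 1) * Real.Gamma (b + 1) ≤ Real.Gamma (a + b + 1) := by
  have hab : 0 < a + b := by positivity
  have h1 := Real.Gamma_mul_add_mul_le_rpow_Gamma_mul_rpow_Gamma (s := 1) (t := a + b + 1)
    (a := b / (a + b)) (b := a / (a + b)) one_pos (by positivity) (by positivity) (by positivity)
    (by field_simp; ring)
  have h2 := Real.Gamma_mul_add_mul_le_rpow_Gamma_mul_rpow_Gamma (s := 1) (t := a + b + 1)
    (a := a / (a + b)) (b := b / (a + b)) one_pos (by positivity) (by positivity) (by positivity)
    (by field_simp)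
  rw [Real.Gamma_one, Real.one_rpow, one_mul] at h1 h2
  rw [show b / (a + b) * 1 + a / (a + b) * (a + b + 1) = a + 1 by field_simp; ring] at h1
  rw [show a / (a + b) * 1 + b / (a + b) * (a + b + 1) = b + 1 by field_simp; ring] at h2
  have hG : 0 < Real.Gamma (a + b + 1) := Real.Gamma_pos_of_pos (by positivity)
  refine (mul_le_mul h1 h2 (Real.Gamma_pos_of_pos (by positivity)).le
    (Real.rpow_nonneg hG.le _)).trans (le_of_eq ?_)
  rw [← Real.rpow_add hG, ← add_div, div_self hab.ne', Real.rpow_one]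

theorem Gamma_mul_Gamma_le {a b c : ℝ} {M : ℕ} (hc : 0 < c) (ha : 1 / c ≤ a) (hb : 1 / c ≤ b)
    (hM : a + b = M) : Real.Gamma a * Real.Gamma b ≤ c ^ 2 * M.factorial := by
  have hc1 : 0 < 1 / c := by positivity
  have ha0 : 0 < a := hc1.trans_le ha
  have hb0 : 0 < b := hc1.trans_le hb
  have h1 := Gamma_add_one_mul_Gamma_add_one_le ha0 hb0
  rw [hM, Real.Gamma_nat_eq_factorial, Real.Gamma_add_one ha0.ne', Real.Gamma_add_one hb0.ne']
    at h1
  have hGa := Real.Gamma_pos_of_pos ha0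
  have hGb := Real.Gamma_pos_of_pos hb0
  have ha1 : 1 ≤ c * a := by rw [div_le_iff₀ hc] at ha; linarith
  have hb1 : 1 ≤ c * b := by rw [div_le_iff₀ hc] at hb; linarith
  calc Real.Gamma a * Real.Gamma b
      ≤ (c * a) * (c * b) * (Real.Gamma a * Real.Gamma b) := by
        refine le_mul_of_one_le_left (by positivity) ?_
        nlinarith
    _ = c ^ 2 * (a * Real.Gamma a * (b * Real.Gamma b)) := by ring
    _ ≤ c ^ 2 * M.factorial := by gcongr

/-- Convexity at the midpoint of `x + 1/2` and `x + 3/2` bounds `Γ(x)` by `2c Γ(x + 1/2)`; the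
duplication formula then evaluates `Γ(x) Γ(x + 1/2)`. -/
theorem Gamma_sq_mul_le {x c : ℝ} (hc : 1 ≤ c) (hx : 1 / (2 * c) ≤ x) :
    Real.Gamma x ^ 2 * 4 ^ x ≤ 4 * c * √Real.pi * Real.Gamma (2 * x) := by
  have hx0 : 0 < x := lt_of_lt_of_le (by positivity) hx
  have hG := Real.Gamma_pos_of_pos hx0
  have hGh : 0 < Real.Gamma (x + 1 / 2) := Real.Gamma_pos_of_pos (by positivity)
  have h1 := Real.convexOn_Gamma.2
    (by rw [mem_Ioi]; positivity : x + 1 / 2 ∈ Ioi 0)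
    (by rw [mem_Ioi]; positivity : x + 1 / 2 + 1 ∈ Ioi 0)
    one_half_pos.le one_half_pos.le (add_halves (1 : ℝ))
  simp only [smul_eq_mul] at h1
  rw [Real.Gamma_add_one (by positivity : x + 1 / 2 ≠ 0),
    show 1 / 2 * (x + 1 / 2) + 1 / 2 * (x + 1 / 2 + 1) = x + 1 by ring,
    Real.Gamma_add_one hx0.ne'] at h1
  have hcx : 1 ≤ 2 * c * x := by rw [div_le_iff₀ (by positivity)] at hx; linarith
  have h2 : Real.Gamma x ≤ 2 * c * Real.Gamma (x + 1 / 2) := by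
    refine le_of_mul_le_mul_left (h1.trans ?_) hx0
    have : 1 / 2 * (1 + (x + 1 / 2)) ≤ x * (2 * c) := by nlinarith
    nlinarith
  have h3 := Real.Gamma_mul_Gamma_add_half x
  have h4 : (2 : ℝ) ^ (1 - 2 * x) * 4 ^ x = 2 := by
    rw [show (4 : ℝ) = 2 ^ (2 : ℝ) by norm_num, ← Real.rpow_mul two_pos.le,
      ← Real.rpow_add two_pos]
    norm_num
  calc Real.Gamma x ^ 2 * 4 ^ x ≤ Real.Gamma x * (2 * c * Real.Gamma (x + 1 / 2)) * 4 ^ x := by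
        rw [sq]; gcongr
    _ = 2 * c * (Real.Gamma x * Real.Gamma (x + 1 / 2)) * 4 ^ x := by ring
    _ = 2 * c * √Real.pi * Real.Gamma (2 * x) * (2 ^ (1 - 2 * x) * 4 ^ x) := by rw [h3]; ring
    _ = _ := by rw [h4]; ring

theorem abs_inv_Gamma_le {x : ℝ} (hx : 0 < x) : |(Real.Gamma (1 - x))⁻¹| ≤
    Real.Gamma x / Real.pi := by
  have h := sin_mul_Gamma (s := x) fun n hn => by
    have : (0 : ℝ) ≤ n := Nat.cast_nonneg n
    linarith
  have hG := Real.Gamma_pos_of_pos hx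
  have e : (Real.Gamma (1 - x))⁻¹ = Real.sin (Real.pi * x) * (Real.Gamma x / Real.pi) := by
    field_simp at h ⊢
    linarith
  rw [e, abs_mul, abs_of_nonneg (by positivity : 0 ≤ Real.Gamma x / Real.pi)]
  exact mul_le_of_le_one_left (by positivity) (Real.abs_sin_le_one _)

/-! ### Estimates of the hypergeometric functions -/

/-- The majorant of the Taylor expansion of `hSol α` at `v = 1`. -/
noncomputable def hMajorant (α r : ℝ) (k : ℕ) : ℝ :=
  (k.factorial : ℝ)⁻¹ * r ^ k * (2 ^ k * (√Real.pi * |(Real.Gamma (1 - (α + k / 2)))⁻¹| ^ 2))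

theorem norm_taylor_hSol (α : ℝ) (w : ℂ) (k : ℕ) : ‖((k.factorial : ℂ)⁻¹ * w ^ k) *
    (2 ^ k * (√Real.pi * (Gamma (1 - (α + k / 2)))⁻¹ ^ 2))‖ = hMajorant α ‖w‖ k := by
  have h : Gamma (1 - ((α : ℂ) + k / 2)) = (Real.Gamma (1 - (α + k / 2)) : ℝ) := by
    rw [← Gamma_ofReal]; push_cast; rfl
  rw [h, ← ofReal_inv, hMajorant]
  simp [abs_of_nonneg (Real.sqrt_nonneg _)]

theorem summable_hMajorant (α : ℝ) {r : ℝ} (hr : r ∈ Ico (0 : ℝ) 1) :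
    Summable (hMajorant α r) := by
  have h := (hasSum_hSol α (v := 1 + r) (by
    simpa [dist_eq_norm, abs_of_nonneg hr.1] using hr.2)).summable.norm
  refine h.congr fun k => ?_
  rw [norm_taylor_hSol, add_sub_cancel_left, norm_real, Real.norm_of_nonneg hr.1]

theorem hMajorant_nonneg (α : ℝ) {r : ℝ} (hr : 0 ≤ r) (k : ℕ) : 0 ≤ hMajorant α r k := by
  unfold hMajorant; positivity

theorem norm_hSol_le (α : ℝ) {r : ℝ} (hr : r < 1) {v : ℂ} (hv : v ∈ Metric.ball (1 : ℂ) r) :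
    ‖hSol α v‖ ≤ ∑' k, hMajorant α r k := by
  have hv1 : ‖v - 1‖ < r := by simpa [dist_eq_norm] using hv
  have hr0 : 0 ≤ r := (norm_nonneg _).trans hv1.le
  refine (hasSum_hSol α (Metric.ball_subset_ball hr.le hv)).norm_le_of_bounded
    (summable_hMajorant α ⟨hr0, hr⟩).hasSum fun k => ?_
  rw [norm_taylor_hSol, hMajorant, hMajorant]
  gcongr

/-- With `x = α + k/2`, reflection and `Gamma_sq_mul_le` replace `1/Γ(1 - x)²` by a multiple of
`Γ(2α + k)`. The majorant then becomes a binomial series, with a constant uniform in `α`. -/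
theorem tsum_hMajorant_le {α c r : ℝ} (hc : 1 ≤ c) (hα : 1 / (2 * c) ≤ α)
    (hr : r ∈ Ico (0 : ℝ) 1) : ∑' k, hMajorant α r k ≤
      4 * c / Real.pi * (4 ^ (-α) * Real.Gamma (2 * α) * (1 - r) ^ (-(2 * α))) := by
  have hα0 : 0 < α := lt_of_lt_of_le (by positivity) hα
  have hs := hasSum_binomial_real (2 * α) (x := r) (by rw [abs_of_nonneg hr.1]; exact hr.2)
  have hs' := hs.mul_left (4 * c / Real.pi * (4 ^ (-α) * Real.Gamma (2 * α)))
  rw [mul_assoc] at hs'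
  refine hasSum_le (fun k => ?_) (summable_hMajorant α hr).hasSum hs'
  set x : ℝ := α + k / 2 with hx
  have hk : (0 : ℝ) ≤ k / 2 := by positivity
  have hx0 : 0 < x := by rw [hx]; linarith
  have h1 := abs_inv_Gamma_le hx0
  have h2 := Gamma_sq_mul_le hc (hα.trans (by rw [hx]; linarith : α ≤ x))
  have h3 : Real.Gamma (2 * x) = (ascPochhammer ℝ k).eval (2 * α) * Real.Gamma (2 * α) := by
    rw [← Gamma_add_nat (by positivity), hx]
    congr 1
    ring
  have h4 : (4 : ℝ) ^ x = 2 ^ k / 4 ^ (-α) := by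
    rw [hx, Real.rpow_add (by norm_num), Real.rpow_neg (by norm_num), div_inv_eq_mul,
      show (4 : ℝ) ^ ((k : ℝ) / 2) = 2 ^ k by
        rw [show (4 : ℝ) = 2 ^ (2 : ℝ) by norm_num, ← Real.rpow_mul two_pos.le,
          ← Real.rpow_natCast]
        congr 1
        ring]
    ring
  have h40 : (0 : ℝ) < 4 ^ (-α) := by positivity
  rw [h3, h4] at h2
  have h5 : 2 ^ k * Real.Gamma x ^ 2 ≤ 4 * c * √Real.pi *
      ((ascPochhammer ℝ k).eval (2 * α) * Real.Gamma (2 * α)) * 4 ^ (-α) := by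
    rw [mul_div_assoc', div_le_iff₀ h40] at h2
    linarith
  have hpi := Real.sq_sqrt Real.pi_pos.le
  have hr0 := hr.1
  calc hMajorant α r k ≤ (k.factorial : ℝ)⁻¹ * r ^ k *
        (2 ^ k * (√Real.pi * (Real.Gamma x / Real.pi) ^ 2)) := by
        rw [hMajorant]; gcongr
    _ = (k.factorial : ℝ)⁻¹ * r ^ k * (√Real.pi / Real.pi ^ 2) * (2 ^ k * Real.Gamma x ^ 2) := by
        ring
    _ ≤ (k.factorial : ℝ)⁻¹ * r ^ k * (√Real.pi / Real.pi ^ 2) * (4 * c * √Real.pi *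
      ((ascPochhammer ℝ k).eval (2 * α) * Real.Gamma (2 * α)) * 4 ^ (-α)) := by gcongr
    _ = _ := by
        generalize (4 : ℝ) ^ (-α) = y
        have ht := (Real.sqrt_pos.2 Real.pi_pos).ne'
        have h6 := Real.pi_ne_zero
        field_simp
        rw [hpi]

/-! ### Convergence of the expansion of `Q(ζ)` -/

/-- The majorant of the term of multi-index `l`. -/
noncomputable def QMajorant {N : ℕ} (r : ℝ) (u : Fin (N - 2) → ℂ) (l : Fin (N - 2) → ℕ) : ℝ :=
  √Real.pi / (2 * Real.pi * N) * (4 ^ alpha l * Real.Gamma (sumL l / N) *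
    ∑' k, hMajorant (alpha l) r k) * ∏ i, ‖u i‖ ^ l i / (l i).factorial

theorem norm_QTerm_le {N : ℕ} (hN : 3 ≤ N) {ζ : ℂ} (hζ : ζ ^ N = -1) {r : ℝ} (hr : r < 1)
    {v : ℂ} (hv : v ∈ Metric.ball (1 : ℂ) r) (u : Fin (N - 2) → ℂ) (l : Fin (N - 2) → ℕ) :
    ‖QTerm N ζ (1 - v) u l‖ ≤ QMajorant r u l := by
  have hN0 : N ≠ 0 := by omega
  have hNR : (0 : ℝ) < N := by exact_mod_cast Nat.pos_of_ne_zero hN0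
  have hζ1 := norm_eq_one_of_pow_eq_neg_one hN0 hζ
  have hL : 0 < Real.Gamma (sumL l / N) := Real.Gamma_pos_of_pos (by
    have : 0 < sumL l := by rw [sumL]; omega
    positivity)
  have h := norm_hSol_le (alpha l) hr hv
  have h4 : (2 : ℝ) ^ ((sumM l : ℝ) - (sumL l : ℝ) / N) = 4 ^ alpha l := by
    rw [← two_alpha hN0, Real.rpow_mul two_pos.le]
    norm_num
  rw [QTerm, hζ, Y_neg_one_eq (alpha_ne_neg_nat hN l) (alpha_add_half_ne_neg_nat hN l)
    (Metric.ball_subset_ball hr.le hv), h4]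
  simp only [norm_mul, norm_pow, hζ1, one_pow, mul_one, norm_real, norm_prod, norm_div,
    norm_natCast, Real.norm_natCast, Real.norm_ofNat]
  rw [Real.norm_of_nonneg (by positivity), Real.norm_of_nonneg hL.le,
    Real.norm_of_nonneg Real.pi_pos.le, Real.norm_of_nonneg (Real.sqrt_nonneg _)]
  calc _ ≤ 4 ^ alpha l / (2 * Real.pi ^ 2 * N) * Real.Gamma (sumL l / N) *
        (Real.pi * √Real.pi * ∑' k, hMajorant (alpha l) r k) *
          ∏ i, ‖u i‖ ^ l i / (l i).factorial := by gcongr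
    _ = _ := by
      have := Real.pi_pos
      rw [QMajorant]
      field_simp

/-- The multinomial majorant. -/
noncomputable def multiMajorant {n : ℕ} (x : Fin n → ℝ) (l : Fin n → ℕ) : ℝ :=
  ((∑ i, l i).factorial : ℝ) * ∏ i, x i ^ l i / (l i).factorial

theorem multiMajorant_nonneg {n : ℕ} {x : Fin n → ℝ} (hx : ∀ i, 0 ≤ x i) (l : Fin n → ℕ) :
    0 ≤ multiMajorant x l :=
  mul_nonneg (Nat.cast_nonneg _) (Finset.prod_nonneg fun i _ =>
    div_nonneg (pow_nonneg (hx i) _) (Nat.cast_nonneg _))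

theorem sum_multiMajorant {n : ℕ} (x : Fin n → ℝ) (M : ℕ) :
    ∑ l ∈ Finset.univ.piAntidiag M, multiMajorant x l = (∑ i, x i) ^ M := by
  rw [Finset.sum_pow_eq_sum_piAntidiag]
  refine Finset.sum_congr rfl fun l _ => ?_
  have h1 : ((∏ i, (l i).factorial : ℕ) : ℝ) * (Nat.multinomial Finset.univ l : ℝ) =
      (∑ i, l i).factorial := by
    exact_mod_cast Nat.multinomial_spec Finset.univ l
  have h2 : ((∏ i, (l i).factorial : ℕ) : ℝ) ≠ 0 :=
    Nat.cast_ne_zero.2 (Finset.prod_ne_zero_iff.2 fun i _ => Nat.factorial_ne_zero _)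
  rw [multiMajorant, ← h1, Finset.prod_div_distrib]
  push_cast at h2 ⊢
  field_simp

theorem summable_multiMajorant {n : ℕ} {x : Fin n → ℝ} (hx : ∀ i, 0 ≤ x i)
    (hx1 : ∑ i, x i < 1) : Summable (multiMajorant x) := by
  have hX0 : 0 ≤ ∑ i, x i := Finset.sum_nonneg fun i _ => hx i
  have hg := summable_geometric_of_lt_one hX0 hx1
  have hsub : ∀ (s : Finset (Fin n → ℕ)) (M : ℕ),
      ∑ l ∈ s with ∑ i, l i = M, multiMajorant x l ≤ (∑ i, x i) ^ M := fun s M => by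
    rw [← sum_multiMajorant]
    refine Finset.sum_le_sum_of_subset_of_nonneg (fun l hl => ?_)
      fun l _ _ => multiMajorant_nonneg hx l
    simpa using (Finset.mem_filter.1 hl).2
  refine summable_of_sum_le (c := ∑' M : ℕ, (∑ i, x i) ^ M)
    (fun l => multiMajorant_nonneg hx l) fun s => ?_
  have h1 := Finset.sum_fiberwise_of_maps_to (s := s) (t := s.image fun l => ∑ i, l i)
    (g := fun l => ∑ i, l i) (fun l hl => Finset.mem_image_of_mem _ hl) (multiMajorant x)
  rw [← h1]
  exact (Finset.sum_le_sum fun M _ => hsub s M).trans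
    (hg.sum_le_tsum _ fun M _ => pow_nonneg hX0 M)

theorem multiMajorant_div {n : ℕ} (x : Fin n → ℝ) (c : ℝ) (l : Fin n → ℕ) :
    multiMajorant (fun i => x i / c) l =
      ((∑ i, l i).factorial : ℝ) / c ^ (∑ i, l i) * ∏ i, x i ^ l i / (l i).factorial := by
  rw [multiMajorant, ← Finset.prod_pow_eq_pow_sum, div_mul_eq_mul_div, mul_div_assoc,
    ← Finset.prod_div_distrib]
  congr 1
  refine Finset.prod_congr rfl fun i _ => ?_
  rw [div_pow]
  ring

/-- The powers of `4` cancel. Since `L/N + 2α = M`, the two Gamma values are together at most `N²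
M!`, and `2α ≤ M` bounds the power of `1 - r`. What remains is a multinomial series. -/
theorem QMajorant_le {N : ℕ} (hN : 3 ≤ N) {r : ℝ} (hr : r ∈ Ico (0 : ℝ) 1)
    (u : Fin (N - 2) → ℂ) {l : Fin (N - 2) → ℕ} (hl : l ≠ 0) :
    QMajorant r u l ≤ √Real.pi / (2 * Real.pi * N) * (4 * N / Real.pi * N ^ 2) *
      multiMajorant (fun i => ‖u i‖ / (1 - r)) l := by
  have hN0 : N ≠ 0 := by omega
  have hN1 : (1 : ℝ) ≤ N := by exact_mod_cast (by omega : 1 ≤ N)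
  have hr1 : 0 < 1 - r := by linarith [hr.2]
  have hα := alpha_ge hN0 hl
  have h2α := two_alpha hN0 l
  have hL : 1 / (N : ℝ) ≤ sumL l / N := by
    have : (1 : ℝ) ≤ sumL l := by exact_mod_cast (by rw [sumL]; omega : 1 ≤ sumL l)
    gcongr
  have hL0 : 0 < (sumL l : ℝ) / N := lt_of_lt_of_le (by positivity) hL
  have hG := Gamma_mul_Gamma_le (a := sumL l / N) (b := 2 * alpha l) (M := sumM l)
    (by linarith : (0 : ℝ) < N) hL (by
      have : 1 / (N : ℝ) = 2 * (1 / (2 * N)) := by field_simp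
      linarith) (by linarith)
  have hGL := Real.Gamma_pos_of_pos hL0
  have h1 := tsum_hMajorant_le hN1 hα hr
  have h2 : (1 - r) ^ (-(2 * alpha l)) ≤ 1 / (1 - r) ^ sumM l := by
    rw [one_div, ← Real.rpow_natCast, ← Real.rpow_neg hr1.le]
    exact Real.rpow_le_rpow_of_exponent_ge hr1 (by linarith [hr.1]) (by linarith)
  have h4 : (4 : ℝ) ^ alpha l * 4 ^ (-alpha l) = 1 := by
    rw [← Real.rpow_add (by norm_num), add_neg_cancel, Real.rpow_zero]
  have hP : 0 ≤ ∏ i, ‖u i‖ ^ l i / ((l i).factorial : ℝ) :=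
    Finset.prod_nonneg fun i _ => by positivity
  have hpi := Real.pi_pos
  rw [QMajorant, multiMajorant_div, ← sumM]
  calc _ ≤ √Real.pi / (2 * Real.pi * N) * (4 ^ alpha l * Real.Gamma (sumL l / N) *
        (4 * N / Real.pi * (4 ^ (-alpha l) * Real.Gamma (2 * alpha l) *
          (1 - r) ^ (-(2 * alpha l))))) * ∏ i, ‖u i‖ ^ l i / (l i).factorial := by gcongr
    _ = √Real.pi / (2 * Real.pi * N) * (4 * N / Real.pi *
        (4 ^ alpha l * 4 ^ (-alpha l)) * (Real.Gamma (sumL l / N) * Real.Gamma (2 * alpha l)) *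
          (1 - r) ^ (-(2 * alpha l))) * ∏ i, ‖u i‖ ^ l i / (l i).factorial := by ring
    _ ≤ √Real.pi / (2 * Real.pi * N) * (4 * N / Real.pi * 1 * (N ^ 2 * (sumM l).factorial) *
        (1 / (1 - r) ^ sumM l)) * ∏ i, ‖u i‖ ^ l i / (l i).factorial := by
        rw [h4]; gcongr
    _ = _ := by ring

theorem summable_QMajorant {N : ℕ} (hN : 3 ≤ N) {r : ℝ} (hr : r ∈ Ico (0 : ℝ) 1)
    {u : Fin (N - 2) → ℂ} (hu : ∀ i, ‖u i‖ < (1 - r) / N) : Summable (QMajorant r u) := by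
  have hN0 : (0 : ℝ) < N := by exact_mod_cast (by omega : 0 < N)
  have hr1 : 0 < 1 - r := by linarith [hr.2]
  have hx : ∀ i, 0 ≤ ‖u i‖ / (1 - r) := fun i => by positivity
  have hsum : ∑ i, ‖u i‖ / (1 - r) < 1 := by
    have h1 : ∑ i, ‖u i‖ / (1 - r) ≤ ∑ _i : Fin (N - 2), 1 / (N : ℝ) :=
      Finset.sum_le_sum fun i _ => by
        rw [div_le_div_iff₀ hr1 hN0]
        have := hu i
        rw [lt_div_iff₀ hN0] at this
        linarith
    refine h1.trans_lt ?_
    rw [Finset.sum_const, Finset.card_univ, Fintype.card_fin, nsmul_eq_mul, mul_one_div,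
      div_lt_one hN0]
    exact_mod_cast (by omega : N - 2 < N)
  have hnn : ∀ l, 0 ≤ QMajorant r u l := fun l => by
    have hL : 0 ≤ Real.Gamma (sumL l / N) := Real.Gamma_nonneg_of_nonneg (by positivity)
    have hH : 0 ≤ ∑' k, hMajorant (alpha l) r k :=
      tsum_nonneg fun k => hMajorant_nonneg _ hr.1 k
    have hP : 0 ≤ ∏ i, ‖u i‖ ^ l i / ((l i).factorial : ℝ) :=
      Finset.prod_nonneg fun i _ => by positivity
    have hpi := Real.pi_pos
    rw [QMajorant]
    positivity
  have hpi := Real.pi_pos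
  set K : ℝ := √Real.pi / (2 * Real.pi * N) * (4 * N / Real.pi * N ^ 2) with hK
  have hK0 : 0 ≤ K := by positivity
  refine Summable.of_nonneg_of_le hnn (fun l => ?_)
    -- At `l = 0`, where `alpha l` is negative and the estimate fails, the comparison term equals
    -- `1`; adding `QMajorant r u 0` to the constant covers this index.
    ((summable_multiMajorant hx hsum).mul_left (K + QMajorant r u 0))
  have hB := multiMajorant_nonneg hx l
  rw [add_mul]
  by_cases hl : l = 0
  · have h1 : multiMajorant (fun i => ‖u i‖ / (1 - r)) (0 : Fin (N - 2) → ℕ) = 1 := by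
      simp [multiMajorant]
    rw [hl, h1, mul_one, mul_one]
    linarith
  · exact (QMajorant_le hN hr u hl).trans (le_add_of_nonneg_right (mul_nonneg (hnn 0) hB))

section

variable {N : ℕ} {ζ : ℂ} {r : ℝ} {u : Fin (N - 2) → ℂ}

theorem summable_QTerm (hN : 3 ≤ N) (hζ : ζ ^ N = -1) (hr : r ∈ Ico (0 : ℝ) 1)
    (hu : ∀ i, ‖u i‖ < (1 - r) / N) {v : ℂ} (hv : v ∈ Metric.ball (1 : ℂ) r) :
    Summable (QTerm N ζ (1 - v) u) :=
  Summable.of_norm_bounded (summable_QMajorant hN hr hu)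
    fun l => norm_QTerm_le hN hζ hr.2 hv u l

theorem differentiableOn_Q (hN : 3 ≤ N) (hζ : ζ ^ N = -1) (hr : r ∈ Ico (0 : ℝ) 1)
    (hu : ∀ i, ‖u i‖ < (1 - r) / N) :
    DifferentiableOn ℂ (fun v => Q N ζ (1 - v) u) (Metric.ball 1 r) := by
  refine differentiableOn_tsum_of_summable_norm (summable_QMajorant hN hr hu) (fun l => ?_)
    Metric.isOpen_ball fun l v hv => norm_QTerm_le hN hζ hr.2 hv u l
  have hh : DifferentiableOn ℂ (fun v => Y (ζ ^ N) (alpha l) (1 - v)) (Metric.ball 1 r) := by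
    have h1 : DifferentiableOn ℂ (fun v => Real.pi * √Real.pi * hSol (alpha l) v)
        (Metric.ball 1 r) := fun v hv => by
      have hv' : ‖v - 1‖ < 1 := by
        have : ‖v - 1‖ < r := by simpa [dist_eq_norm] using hv
        exact this.trans hr.2
      exact (((hasDerivAt_hSol (alpha l) (norm_lt_two_of_norm_sub_one_lt hv')
        (mem_slitPlane_of_norm_sub_one_lt hv')).differentiableAt).const_mul
          _).differentiableWithinAt
    refine h1.congr fun v hv => ?_
    rw [hζ, Y_neg_one_eq (alpha_ne_neg_nat hN l) (alpha_add_half_ne_neg_nat hN l)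
      (Metric.ball_subset_ball hr.2.le hv)]
  unfold QTerm
  exact (hh.const_mul _).mul_const _

end

end SeibergWitten

namespace SeibergWitten

open Complex Set MeasureTheory Filter Topology

/-! ### Connectedness of the domains -/

/-- A set that contains with each point the arc and the segment joining it to `1` is connected. -/
theorem isConnected_of_arc {S : Set ℂ} (h1 : (1 : ℂ) ∈ S)
    (harc : ∀ x ∈ S, ∀ τ ∈ Icc (0 : ℝ) 1, (‖x‖ : ℂ) * exp ((τ * arg x : ℝ) * I) ∈ S)
    (hrad : ∀ x ∈ S, ∀ t ∈ uIcc 1 ‖x‖, (t : ℂ) ∈ S) : IsConnected S := by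
  refine ⟨⟨1, h1⟩, isPreconnected_of_forall 1 fun x hx => ?_⟩
  refine ⟨(fun τ : ℝ => (‖x‖ : ℂ) * exp ((τ * arg x : ℝ) * I)) '' Icc 0 1 ∪
    (fun t : ℝ => (t : ℂ)) '' uIcc 1 ‖x‖, ?_, ?_, ?_, ?_⟩
  · rintro _ (⟨τ, hτ, rfl⟩ | ⟨t, ht, rfl⟩)
    · exact harc x hx τ hτ
    · exact hrad x hx t ht
  · exact Or.inr ⟨1, left_mem_uIcc, ofReal_one⟩
  · refine Or.inl ⟨1, right_mem_Icc.2 zero_le_one, ?_⟩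
    simp only [one_mul]
    exact norm_mul_exp_arg_mul_I x
  · refine IsPreconnected.union (‖x‖ : ℂ) ⟨0, left_mem_Icc.2 zero_le_one, by simp⟩
      ⟨‖x‖, right_mem_uIcc, rfl⟩ (isPreconnected_Icc.image _ ?_) (isPreconnected_uIcc.image _ ?_)
    · exact (by fun_prop : Continuous fun τ : ℝ =>
        (‖x‖ : ℂ) * exp ((τ * arg x : ℝ) * I)).continuousOn
    · exact continuous_ofReal.continuousOn

theorem norm_arc (x : ℂ) (φ : ℝ) : ‖(‖x‖ : ℂ) * exp (φ * I)‖ = ‖x‖ := by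
  rw [norm_mul, norm_exp_ofReal_mul_I, norm_real, norm_norm, mul_one]

theorem arc_mem_slitPlane {x : ℂ} (hx : x ∈ slitPlane) {τ : ℝ} (hτ : τ ∈ Icc (0 : ℝ) 1) :
    (‖x‖ : ℂ) * exp ((τ * arg x : ℝ) * I) ∈ slitPlane := by
  have hx0 : 0 < ‖x‖ := norm_pos_iff.2 (slitPlane_ne_zero hx)
  have harg := (mem_slitPlane_iff_arg.1 hx).1
  have h1 : |τ * arg x| < Real.pi := by
    rw [abs_mul, abs_of_nonneg hτ.1]
    refine lt_of_le_of_lt (mul_le_of_le_one_left (abs_nonneg _) hτ.2) ?_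
    rw [abs_lt]
    exact ⟨neg_pi_lt_arg x, lt_of_le_of_ne (arg_le_pi x) harg⟩
  rw [abs_lt] at h1
  rw [mem_slitPlane_iff_arg, exp_mul_I, arg_mul_cos_add_sin_mul_I hx0 ⟨h1.1, h1.2.le⟩,
    ← exp_mul_I]
  refine ⟨h1.2.ne, mul_ne_zero (ofReal_ne_zero.2 hx0.ne') (exp_ne_zero _)⟩

theorem norm_sub_one_sq (z : ℂ) : ‖z - 1‖ ^ 2 = ‖z‖ ^ 2 - 2 * z.re + 1 := by
  rw [Complex.sq_norm, Complex.sq_norm, normSq_apply, normSq_apply, sub_re, sub_im, one_re, one_im]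
  ring

/-- At fixed modulus the distance to `1` decreases as the cosine of the argument grows, and moving
the argument towards `0` increases that cosine. -/
theorem norm_arc_sub_one_le (x : ℂ) {τ : ℝ} (hτ : τ ∈ Icc (0 : ℝ) 1) :
    ‖(‖x‖ : ℂ) * exp ((τ * arg x : ℝ) * I) - 1‖ ≤ ‖x - 1‖ := by
  refine le_of_sq_le_sq ?_ (norm_nonneg _)
  rw [norm_sub_one_sq, norm_sub_one_sq, norm_arc, re_ofReal_mul, exp_ofReal_mul_I_re,
    ← norm_mul_cos_arg x]
  have h : Real.cos (arg x) ≤ Real.cos (τ * arg x) := by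
    rw [← Real.cos_abs, ← Real.cos_abs (τ * arg x)]
    refine Real.cos_le_cos_of_nonneg_of_le_pi (abs_nonneg _) (abs_arg_le_pi x) ?_
    rw [abs_mul, abs_of_nonneg hτ.1]
    exact mul_le_of_le_one_left (abs_nonneg _) hτ.2
  have := mul_le_mul_of_nonneg_left h (norm_nonneg x)
  linarith

theorem norm_sub_one_le_of_mem_uIcc {x : ℂ} {t : ℝ} (ht : t ∈ uIcc 1 ‖x‖) :
    ‖(t : ℂ) - 1‖ ≤ ‖x - 1‖ := by
  have h1 : |t - 1| ≤ |‖x‖ - 1| := by simpa [abs_sub_comm] using abs_sub_left_of_mem_uIcc ht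
  have h2 := abs_norm_sub_norm_le x 1
  rw [norm_one] at h2
  rw [← ofReal_one, ← ofReal_sub, norm_real]
  exact h1.trans h2

section

variable {N : ℕ} {ρ δ : ℝ} {u : Fin (N - 2) → ℂ}

theorem one_mem_scalingDomain (hρ : 1 < ρ) (hu : ∀ i, ‖u i‖ < δ) :
    (1 : ℂ) ∈ scalingDomain N ρ δ u :=
  ⟨one_mem_slitPlane, by simpa using hρ, fun i => by simpa using hu i⟩

theorem arc_mem_scalingDomain {x : ℂ} (hx : x ∈ scalingDomain N ρ δ u) {τ : ℝ}
    (hτ : τ ∈ Icc (0 : ℝ) 1) :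
    (‖x‖ : ℂ) * exp ((τ * arg x : ℝ) * I) ∈ scalingDomain N ρ δ u := by
  refine ⟨arc_mem_slitPlane hx.1 hτ, ?_, ?_⟩
  · rw [norm_arc]; exact hx.2.1
  · rw [norm_arc]; exact hx.2.2

/-- The bounds on the moduli relax as the radius grows, because the exponents are nonnegative. It is
enough that they hold at the smaller of the two radii `1` and `‖x‖`. -/
theorem radius_mem_scalingDomain (hρ : 1 < ρ) (hu : ∀ i, ‖u i‖ < δ) {x : ℂ}
    (hx : x ∈ scalingDomain N ρ δ u) {t : ℝ} (ht : t ∈ uIcc 1 ‖x‖) :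
    (t : ℂ) ∈ scalingDomain N ρ δ u := by
  have hx0 : 0 < ‖x‖ := norm_pos_iff.2 (slitPlane_ne_zero hx.1)
  have ht0 : 0 < t := (lt_min one_pos hx0).trans_le ht.1
  have hn : ‖(t : ℂ)‖ = t := by rw [norm_real, Real.norm_of_nonneg ht0.le]
  refine ⟨ofReal_mem_slitPlane.2 ht0, ?_, fun i => ?_⟩
  · rw [hn]
    exact ht.2.trans_lt (max_lt hρ hx.2.1)
  · rw [hn]
    have hi := i.2
    have hN : (0 : ℝ) < N := by exact_mod_cast (by omega)
    have he : 0 ≤ 1 - ((i.val : ℝ) + 1) / N := by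
      rw [sub_nonneg, div_le_one hN]
      exact_mod_cast (by omega : i.val + 1 ≤ N)
    have hδ : 0 ≤ δ := (norm_nonneg _).trans (hu i).le
    rcases le_total 1 ‖x‖ with h | h
    · have h1 : 1 ≤ t := by simpa [h] using ht.1
      exact (hu i).trans_le (le_mul_of_one_le_right hδ (Real.one_le_rpow h1 he))
    · have h1 : ‖x‖ ≤ t := by simpa [h] using ht.1
      refine (hx.2.2 i).trans_le ?_
      gcongr

theorem isConnected_scalingDomain (hρ : 1 < ρ) (hu : ∀ i, ‖u i‖ < δ) :
    IsConnected (scalingDomain N ρ δ u) :=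
  isConnected_of_arc (one_mem_scalingDomain hρ hu) (fun _ hx _ => arc_mem_scalingDomain hx)
    fun _ hx _ => radius_mem_scalingDomain hρ hu hx

theorem isConnected_ball_inter_scalingDomain {r : ℝ} (hr : 0 < r) (hρ : 1 < ρ)
    (hu : ∀ i, ‖u i‖ < δ) : IsConnected (Metric.ball (1 : ℂ) r ∩ scalingDomain N ρ δ u) := by
  refine isConnected_of_arc ⟨Metric.mem_ball_self hr, one_mem_scalingDomain hρ hu⟩
    (fun x hx τ hτ => ⟨?_, arc_mem_scalingDomain hx.2 hτ⟩)
    fun x hx t ht => ⟨?_, radius_mem_scalingDomain hρ hu hx.2 ht⟩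
  · rw [mem_ball_iff_norm]
    exact (norm_arc_sub_one_le x hτ).trans_lt (mem_ball_iff_norm.1 hx.1)
  · rw [mem_ball_iff_norm]
    exact (norm_sub_one_le_of_mem_uIcc ht).trans_lt (mem_ball_iff_norm.1 hx.1)

end

/-! ### Assembly of the analytic continuation -/

theorem scalingDomain_mono {N : ℕ} {ρ δ δ' : ℝ} (h : δ ≤ δ') (u : Fin (N - 2) → ℂ) :
    scalingDomain N ρ δ u ⊆ scalingDomain N ρ δ' u := fun v hv =>
  ⟨hv.1, hv.2.1, fun i => (hv.2.2 i).trans_le (by gcongr)⟩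

theorem exists_analyticContinuation {N : ℕ} (hN : 3 ≤ N) {ζ : ℂ} (hζ : ζ ^ N = -1) {ρ r : ℝ}
    (hρ : ρ ∈ Ioo (1 : ℝ) 2) (hr : r ∈ Ioo (0 : ℝ) 1) :
    ∃ δ > 0, ∀ u : Fin (N - 2) → ℂ, (∀ i, ‖u i‖ < δ) →
      (∀ v ∈ Metric.ball (1 : ℂ) r, Summable (QTerm N ζ (1 - v) u)) ∧
      (∀ v ∈ scalingDomain N ρ δ u, RWellDefined N ζ v u) ∧
      IsAnalyticContinuation (fun v => Q N ζ (1 - v) u) (Metric.ball 1 r)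
        (fun v => R N ζ v u) (scalingDomain N ρ δ u) := by
  have hN0 : N ≠ 0 := by omega
  have hNR : (0 : ℝ) < N := by exact_mod_cast Nat.pos_of_ne_zero hN0
  have hr' : r ∈ Ico (0 : ℝ) 1 := Ioo_subset_Ico_self hr
  -- For `ρ < 2` this choice gives `ρ (1 + κ) < 2`, because `(2 - ρ)(4 - ρ) > 0`.
  set κ : ℝ := (2 - ρ) / 4 with hκdef
  have hκ0 : 0 < κ := by rw [hκdef]; linarith [hρ.2]
  have hκ : κ ≤ 1 / 2 := by rw [hκdef]; linarith [hρ.1]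
  have hρκ : ρ * (1 + κ) < 2 := by rw [hκdef]; nlinarith [hρ.1, hρ.2]
  have hρ0 : 0 ≤ ρ := by linarith [hρ.1]
  obtain ⟨δ', hδ', zr, hzr⟩ := exists_isRootFun hN hζ hκ0
  have hr1 : 0 < (1 - r) / N := div_pos (by linarith [hr.2]) hNR
  -- The first entry leaves the margin for the Cauchy estimates in the rescaled moduli; the second
  -- makes the multinomial majorant of `Q(ζ)` converge on the disc of radius `r`.
  refine ⟨min (δ' / 3) ((1 - r) / N), lt_min (by positivity) hr1, fun u hu => ?_⟩
  set δ := min (δ' / 3) ((1 - r) / N) with hδ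
  have hδle : δ ≤ δ' / 3 := min_le_left _ _
  have huQ : ∀ i, ‖u i‖ < (1 - r) / N := fun i => (hu i).trans_le (min_le_right _ _)
  have ha : ∀ v ∈ scalingDomain N ρ δ u, ∀ i, ‖scaledModuli v u i‖ < δ' / 3 :=
    fun v hv i => (norm_scaledModuli_lt hv i).trans_le hδle
  have hvκ : ∀ v ∈ scalingDomain N ρ δ u, ‖v‖ * (1 + κ) < 2 := fun v hv =>
    lt_of_le_of_lt (mul_le_mul_of_nonneg_right hv.2.1.le (by positivity)) hρκ
  have hsum : ∀ v ∈ Metric.ball (1 : ℂ) r, Summable (QTerm N ζ (1 - v) u) :=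
    fun v hv => summable_QTerm hN hζ hr' huQ hv
  refine ⟨hsum, fun v hv => rWellDefined hN0 (slitPlane_ne_zero hv.1) hzr
    (fun i => (ha v hv i).trans (by linarith)) hκ0.le hκ (hvκ v hv), ?_⟩
  exact
    { isOpen_left := Metric.isOpen_ball
      isConnected_left := (convex_ball _ _).isConnected (Metric.nonempty_ball.2 hr.1)
      isOpen_right := isOpen_scalingDomain ρ δ u
      isConnected_right := isConnected_scalingDomain hρ.1 hu
      isConnected_inter := isConnected_ball_inter_scalingDomain hr.1 hρ.1 hu
      analytic_left := (differentiableOn_Q hN hζ hr' huQ).analyticOnNhd Metric.isOpen_ball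
      analytic_right := ((differentiableOn_R hN0 hzr hκ0.le hκ hρ0 hρκ).mono
        (scalingDomain_mono (by linarith) u)).analyticOnNhd (isOpen_scalingDomain ρ δ u)
      eqOn := fun v hv => Q_eq_R hN hζ (Metric.ball_subset_ball hr.2.le hv.1) hδ' hzr
        (ha v hv.2) hκ0.le hκ (hvκ v hv.2) (hsum v hv.1) }

end SeibergWitten


theorem mainTheorem4 (N : ℕ) (hN : 3 ≤ N) (ζ : ℂ) (hζ : ζ ^ N = -1) :
    (∀ ρ ∈ Set.Ioo (1 : ℝ) 2, ∀ r ∈ Set.Ioo (0 : ℝ) 1, ∃ δ > 0,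
      ∀ u : Fin (N - 2) → ℂ, (∀ i, ‖u i‖ < δ) →
        (∀ v ∈ Metric.ball (1 : ℂ) r, Summable (SeibergWitten.QTerm N ζ (1 - v) u)) ∧
        (∀ v ∈ SeibergWitten.scalingDomain N ρ δ u, SeibergWitten.RWellDefined N ζ v u) ∧
        SeibergWitten.IsAnalyticContinuation
          (fun v => SeibergWitten.Q N ζ (1 - v) u) (Metric.ball 1 r)
          (fun v => SeibergWitten.R N ζ v u) (SeibergWitten.scalingDomain N ρ δ u)) ∧
    (∀ α : ℝ, (∀ k : ℤ, 4 * α ≠ 2 * k + 1) →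
      (SeibergWitten.connectionMatrix α).det = 1 ∧
      ∀ v ∈ Metric.ball (1 : ℂ) 1,
        ![SeibergWitten.f₁ α v, SeibergWitten.f₂ α v] =
          ((SeibergWitten.connectionMatrix α).map Complex.ofReal).mulVec
            ![SeibergWitten.f₃ α v, SeibergWitten.f₄ α v]) :=
  ⟨fun _ hρ _ hr => SeibergWitten.exists_analyticContinuation hN hζ hρ hr,
    fun _ hα => ⟨SeibergWitten.connectionMatrix_det hα,
      fun _ hv => SeibergWitten.connection_formula hα hv⟩⟩
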